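/- Let $d\ge 1$, $R>0$, $\Omega=(-R,R)^d$, write $\mathbf x=(x_1,\dots,x_{d-1},z)$, and let $\Gamma^+=\{\mathbf x: z=R,\ |x_i|\le R \text{ for } 1\le i\le d-1\}$. Let $r>R+1$, $b>R+r$, $\epsilon_0>0$, $M>0$, let $p>\lceil d/2\rceil+2$ be an integer (so that $H^p(\Omega)\hookrightarrow C^2(\overline\Omega)$), and let $F=F(\mathbf x,s,\mathbf q)\in C^2(\overline\Omega\times\mathbb R\times\mathbb R^d)$. For $f:\partial\Omega\to\mathbb R$ and $g:\Gamma^+\to\mathbb R$ put $$H_{f,g}=\{u\in H^p(\Omega): u|_{\partial\Omega}=f,\ u_z|_{\Gamma^+}=g\},\qquad K_{f,g}=\{u\in H_{f,g}:\|u\|_{H^p(\Omega)}\le M\}.$$ For $\lambda,\beta>1$ and $\eta>0$ let $$J_{\lambda,\beta,\eta}(u)=\int_\Omega e^{2\lambda(\frac{z+r}{b})^\beta}\big|-\epsilon_0\Delta u+F(\mathbf x,u,\nabla u)\big|^2d\mathbf x+\eta\|u\|_{H^p(\Omega)}^2,$$ $$DJ_{\lambda,\beta,\eta}(u)h=2\int_\Omega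 e^{2\lambda(\frac{z+r}{b})^\beta}\big[-\epsilon_0\Delta u+F(\mathbf x,u,\nabla u)\big]\big[-\epsilon_0\Delta h+\partial_sF(\mathbf x,u,\nabla u)h+\nabla_{\mathbf q}F(\mathbf x,u,\nabla u)\cdot\nabla h\big]d\mathbf x+2\eta\langle u,h\rangle_{H^p(\Omega)}.$$ For $c>0$ consider the convexity inequality $$J_{\lambda,\beta,\eta}(v)-J_{\lambda,\beta,\eta}(u)-DJ_{\lambda,\beta,\eta}(u)(v-u)\ \ge\ c\,\|v-u\|_{H^1(\Omega)}^2+\eta\,\|v-u\|_{H^p(\Omega)}^2\qquad\text{for all } u,v\in K_{f,g}.\tag{$*$}$$ Fix $\beta>1$. Then: 1. There is $\lambda_0=\lambda_0(\epsilon_0,M,R,b,d,r,p,F,\beta)>1$ such that for every $\lambda>\lambda_0$ there is $c>0$ with which $(*)$ holds for all $\eta>0$ and all $f,g$. 2. For all $\lambda>1$ and $c>0$ there is $C>0$, depending only on $\lambda,\beta,c,R,r,b,d,p,M,F,\epsilon_0$, with the following property. Let $\eta>0$, $\delta>0$, let $f^*,g^*$ (exact data) and $f^\delta,g^\delta$ (noisy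 data) be such that some $\mathcal E\in H^p(\Omega)$ satisfies $$\|\mathcal E\|_{H^p(\Omega)}\le\delta,\qquad \mathcal E|_{\partial\Omega}=f^\delta-f^*,\qquad \mathcal E_z|_{\Gamma^+}=g^\delta-g^*,$$ and suppose that $(*)$ holds for $\lambda,\beta,\eta,c$ and the data $(f,g)=(f^\delta,g^\delta)$. Let $u^{\epsilon_0}\in H^p(\Omega)$ with $\|u^{\epsilon_0}\|_{H^p(\Omega)}<M-\delta$ be a solution (for instance the unique one) of $$-\epsilon_0\Delta u^{\epsilon_0}+F(\mathbf x,u^{\epsilon_0},\nabla u^{\epsilon_0})=0 \text{ in }\Omega,\qquad u^{\epsilon_0}=f^*\text{ on }\partial\Omega,\qquad u^{\epsilon_0}_z=g^*\text{ on }\Gamma^+,$$ and let $u^\delta_{\min}$ be a minimizer of $J_{\lambda,\beta,\eta}$ over $K_{f^\delta,g^\delta}$. Then $$\|u^\delta_{\min}-u^{\epsilon_0}\|_{H^1(\Omega)}^2\le C\big(\eta\,\|u^{\epsilon_0}\|_{H^p(\Omega)}^2+\delta^2\big).$$ -/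

import Mathlib

open MeasureTheory

noncomputable section

namespace HJ

/-- Points of `ℝ^d`; no definition below uses a norm on this type, all norms of gradients and
derivatives are written out as sums of squares of coordinates. -/
abbrev Pt (d : ℕ) : Type := Fin d → ℝ

/-- The open cube `(-R, R)^d`. -/
def cube (d : ℕ) (R : ℝ) : Set (Pt d) := {x | ∀ i, -R < x i ∧ x i < R}

/-- The last coordinate `z` of a point of `ℝ^(n+1)`. -/
def zc {n : ℕ} (x : Pt (n + 1)) : ℝ := x (Fin.last n)

/-- The closed face `Γ⁺ = {z = R}` of the cube. -/
def gammaPlus (n : ℕ) (R : ℝ) : Set (Pt (n + 1)) :=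
  {x | zc x = R ∧ ∀ i, i ≠ Fin.last n → |x i| ≤ R}

/-! ### Sobolev spaces on open sets, through weak derivatives -/

/-- The order `|α|` of a multi-index. -/
def order {d : ℕ} (α : Fin d → ℕ) : ℕ := ∑ i, α i

/-- All multi-indices of order at most `k`. -/
def multiIndices (d k : ℕ) : Finset (Fin d → ℕ) :=
  (Fintype.piFinset fun _ => Finset.range (k + 1)).filter fun α => order α ≤ k

theorem mem_multiIndices {d k : ℕ} {α : Fin d → ℕ} : α ∈ multiIndices d k ↔ order α ≤ k := by
  simp only [multiIndices, Finset.mem_filter, Fintype.mem_piFinset, Finset.mem_range,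
    and_iff_right_iff_imp]
  intro h i
  exact Nat.lt_succ_of_le
    (le_trans (Finset.single_le_sum (fun _ _ => Nat.zero_le _) (Finset.mem_univ i)) h)

/-- Classical partial derivative in the direction of the `i`-th coordinate. -/
def pderiv {d : ℕ} (i : Fin d) (φ : Pt d → ℝ) : Pt d → ℝ :=
  fun x => fderiv ℝ φ x (Pi.single i 1)

/-- Classical iterated partial derivative `∂^α φ`. -/
def mderiv {d : ℕ} (α : Fin d → ℕ) (φ : Pt d → ℝ) : Pt d → ℝ :=
  (List.finRange d).foldr (fun i ψ => (pderiv i)^[α i] ψ) φ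

/-- `φ ∈ C_c^∞(Ω)`. -/
def IsTestFunction {d : ℕ} (Ω : Set (Pt d)) (φ : Pt d → ℝ) : Prop :=
  ContDiff ℝ (⊤ : ℕ∞) φ ∧ HasCompactSupport φ ∧ tsupport φ ⊆ Ω

/-- `v ∈ L²(Ω)` is the weak derivative `∂^α u` on `Ω`. -/
def IsWeakDeriv {d : ℕ} (Ω : Set (Pt d)) (α : Fin d → ℕ) (u v : Pt d → ℝ) : Prop :=
  MemLp v 2 (volume.restrict Ω) ∧
    ∀ φ, IsTestFunction Ω φ →
      ∫ x in Ω, u x * mderiv α φ x = (-1) ^ order α * ∫ x in Ω, v x * φ x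

/-- `u ∈ H^k(Ω)`. -/
def MemH {d : ℕ} (Ω : Set (Pt d)) (k : ℕ) (u : Pt d → ℝ) : Prop :=
  MemLp u 2 (volume.restrict Ω) ∧ ∀ α, order α ≤ k → ∃ v, IsWeakDeriv Ω α u v

open Classical in
/-- The weak derivative `∂^α u` on `Ω`, a representative of its class in `L²(Ω)` (and `0` if there
is no such weak derivative). -/
def weakDeriv {d : ℕ} (Ω : Set (Pt d)) (α : Fin d → ℕ) (u : Pt d → ℝ) : Pt d → ℝ :=
  if h : ∃ v, IsWeakDeriv Ω α u v then h.choose else 0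

/-- The inner product of `H^k(Ω)`. -/
def sobInner {d : ℕ} (Ω : Set (Pt d)) (k : ℕ) (u v : Pt d → ℝ) : ℝ :=
  ∑ α ∈ multiIndices d k, ∫ x in Ω, weakDeriv Ω α u x * weakDeriv Ω α v x

/-- The norm of `H^k(Ω)`. -/
def sobNorm {d : ℕ} (Ω : Set (Pt d)) (k : ℕ) (u : Pt d → ℝ) : ℝ :=
  Real.sqrt (∑ α ∈ multiIndices d k, ∫ x in Ω, weakDeriv Ω α u x ^ 2)

/-- The weak gradient. -/
def grad {d : ℕ} (Ω : Set (Pt d)) (u : Pt d → ℝ) : Pt d → Pt d :=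
  fun x i => weakDeriv Ω (Pi.single i 1) u x

/-- The weak Laplacian. -/
def lap {d : ℕ} (Ω : Set (Pt d)) (u : Pt d → ℝ) : Pt d → ℝ :=
  fun x => ∑ i, weakDeriv Ω (Pi.single i 2) u x

/-- `u|_S = f` for a part `S` of the boundary of `Ω`: the class of `u` has a representative that is
continuous on the closure of `Ω` and equal to `f` on `S`. For an element of `H^p(Ω)` with
`H^p(Ω) ⊆ C²(closure Ω)`, and for its derivatives of first order, this is the boundary value. -/
def HasBoundaryValue {d : ℕ} (Ω S : Set (Pt d)) (u f : Pt d → ℝ) : Prop :=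
  ∃ w : Pt d → ℝ, ContinuousOn w (closure Ω) ∧ w =ᵐ[volume.restrict Ω] u ∧ ∀ x ∈ S, w x = f x

/-- The set `H` of all `u ∈ H^p(Ω)` with `u = f` on `∂Ω` and `u_z = g` on `Γ⁺`, where
`Ω = (-R, R)^(n+1)`. -/
def dataSet {n : ℕ} (R : ℝ) (p : ℕ) (f g : Pt (n + 1) → ℝ) : Set (Pt (n + 1) → ℝ) :=
  {u | MemH (cube (n + 1) R) p u ∧
    HasBoundaryValue (cube (n + 1) R) (frontier (cube (n + 1) R)) u f ∧
    HasBoundaryValue (cube (n + 1) R) (gammaPlus n R)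
      (weakDeriv (cube (n + 1) R) (Pi.single (Fin.last n) 1) u) g}

/-- `H ∩ closure (B(M))`. -/
def dataBall {n : ℕ} (R : ℝ) (p : ℕ) (M : ℝ) (f g : Pt (n + 1) → ℝ) : Set (Pt (n + 1) → ℝ) :=
  {u ∈ dataSet R p f g | sobNorm (cube (n + 1) R) p u ≤ M}

/-! ### The viscous equation and the functional -/

/-- `F(x, s, q)` is of class `C²` on `closure Ω × ℝ × ℝ^d`. -/
def IsC2On {d : ℕ} (Ω : Set (Pt d)) (F : Pt d → ℝ → Pt d → ℝ) : Prop :=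
  ContDiffOn ℝ 2 (fun y : Pt d × ℝ × Pt d => F y.1 y.2.1 y.2.2) (closure Ω ×ˢ Set.univ)

/-- The viscous operator `-ε₀ Δu + F(x, u, ∇u)`. -/
def viscOp {d : ℕ} (Ω : Set (Pt d)) (ε₀ : ℝ) (F : Pt d → ℝ → Pt d → ℝ) (u : Pt d → ℝ) :
    Pt d → ℝ :=
  fun x => -ε₀ * lap Ω u x + F x (u x) (grad Ω u x)

/-- Its linearization at `u`, applied to `h`:
`-ε₀ Δh + ∂_s F(x, u, ∇u) h + ∇_q F(x, u, ∇u) ⬝ ∇h`. -/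
def linOp {d : ℕ} (Ω : Set (Pt d)) (ε₀ : ℝ) (F : Pt d → ℝ → Pt d → ℝ) (u h : Pt d → ℝ) :
    Pt d → ℝ :=
  fun x => -ε₀ * lap Ω h x + deriv (fun s => F x s (grad Ω u x)) (u x) * h x
    + fderiv ℝ (fun q => F x (u x) q) (grad Ω u x) (grad Ω h x)

/-- The Carleman weight `exp (2 λ ((z + r) / b) ^ β)`. -/
def weight {n : ℕ} (r b lam β : ℝ) (x : Pt (n + 1)) : ℝ :=
  Real.exp (2 * lam * ((zc x + r) / b) ^ β)

/-- The functional `J_{λ, β, η}`. -/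
def J {n : ℕ} (R r b ε₀ : ℝ) (p : ℕ) (F : Pt (n + 1) → ℝ → Pt (n + 1) → ℝ) (lam β η : ℝ)
    (u : Pt (n + 1) → ℝ) : ℝ :=
  (∫ x in cube (n + 1) R, weight r b lam β x * viscOp (cube (n + 1) R) ε₀ F u x ^ 2)
    + η * sobNorm (cube (n + 1) R) p u ^ 2

/-- The derivative `DJ_{λ, β, η}(u) h`. -/
def DJ {n : ℕ} (R r b ε₀ : ℝ) (p : ℕ) (F : Pt (n + 1) → ℝ → Pt (n + 1) → ℝ) (lam β η : ℝ)
    (u h : Pt (n + 1) → ℝ) : ℝ :=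
  2 * (∫ x in cube (n + 1) R, weight r b lam β x * viscOp (cube (n + 1) R) ε₀ F u x
      * linOp (cube (n + 1) R) ε₀ F u h x)
    + 2 * η * sobInner (cube (n + 1) R) p u h

/-- The convexity inequality for `J_{λ, β, η}` on `H ∩ closure (B(M))`, with constant `c`. -/
def ConvexityInequality {n : ℕ} (R r b ε₀ : ℝ) (p : ℕ) (F : Pt (n + 1) → ℝ → Pt (n + 1) → ℝ)
    (M lam β η c : ℝ) (f g : Pt (n + 1) → ℝ) : Prop :=
  ∀ u ∈ dataBall R p M f g, ∀ v ∈ dataBall R p M f g,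
    c * sobNorm (cube (n + 1) R) 1 (v - u) ^ 2 + η * sobNorm (cube (n + 1) R) p (v - u) ^ 2 ≤
      J R r b ε₀ p F lam β η v - J R r b ε₀ p F lam β η u - DJ R r b ε₀ p F lam β η u (v - u)

/-- `u ∈ H^p(Ω)` solves the over-determined problem `-ε₀ Δu + F(x, u, ∇u) = 0` in `Ω`,
`u = f` on `∂Ω`, `u_z = g` on `Γ⁺`. -/
def IsSolution {n : ℕ} (R ε₀ : ℝ) (p : ℕ) (F : Pt (n + 1) → ℝ → Pt (n + 1) → ℝ)
    (f g : Pt (n + 1) → ℝ) (u : Pt (n + 1) → ℝ) : Prop :=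
  u ∈ dataSet R p f g ∧
    ∀ᵐ x ∂(volume.restrict (cube (n + 1) R)), viscOp (cube (n + 1) R) ε₀ F u x = 0

/-- `u` minimizes `J_{λ, β, η}` over its domain `H ∩ closure (B(M))`. -/
def IsMinimizer {n : ℕ} (R r b ε₀ : ℝ) (p : ℕ) (F : Pt (n + 1) → ℝ → Pt (n + 1) → ℝ)
    (M lam β η : ℝ) (f g : Pt (n + 1) → ℝ) (u : Pt (n + 1) → ℝ) : Prop :=
  u ∈ dataBall R p M f g ∧
    ∀ v ∈ dataBall R p M f g, J R r b ε₀ p F lam β η u ≤ J R r b ε₀ p F lam β η v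

end HJ

end

/-! Convexity. Put `h = v - u`, let `L` be the residual `-ε₀ Δu + F(x, u, ∇u)`, and write the
residual at `v` as `L + (a + D) + q`, where `a = -ε₀ Δh`, `D` is the part of the linearization that
involves only `h` and `∇h`, and `q` is the Taylor remainder of `F`. The weighted integral then
contributes the integral of the weight `W` times `(a + D + q)² + 2 L q` to the left side of the
convexity inequality. The ball of `H^p` is bounded in `C²`, so `L`, `D` and `q` are controlled by
constants that do not depend on `λ`, and the integrand is at least `W (ε₀² |Δh|² / 2 - K (h² +
|∇h|²))` (`convexity_pointwise`). The regularization term is the square of a Hilbert norm and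
contributes exactly `η ‖h‖²`.

The difference `h` vanishes on the whole boundary and `h_z` vanishes on `Γ⁺`. For such `h` a
Carleman estimate (`exists_carleman_estimate`) makes `∫ W |Δh|²` dominate any prescribed multiple of
`∫ W (h² + |∇h|²)` once `λ` is large. As `W ≥ 1` on the cube, `c = 1` is obtained. The estimate
comes from the substitution `v = exp(φ) h`, where `φ` is half the exponent of the weight: a
multiplier is chosen that produces all first derivatives with a positive sign, and the only
surviving boundary term, on the bottom face, has the good sign (`carleman_identity`).

Stability. The competitor `uε + err` has the noisy data and lies in the ball, and since the residual
of `uε` is zero, its functional value is at most a constant times `‖err‖²`, plus `η ‖uε + err‖²`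
(`exists_J_le`). Applying convexity at the midpoint between minimizer and competitor cancels the
derivative terms and bounds the distance by that value (`IsMinimizer.sobNorm_sub_sq_le`). For `η >
1` the term `η ‖err‖²` is not `O(δ²)` uniformly in `η`; there the regularization term alone bounds
the norm of the minimizer.

Both parts need classical representatives. The embedding of `H^p` of the cube into `C²`
(`exists_C2_rep`, `exists_C2_rep_closed`) is proved by mollification and a Sobolev inequality
obtained from averages along homotheties. -/

open MeasureTheory

noncomputable section

namespace HJ

open scoped ENNReal NNReal Topology ContDiff Convolution
open Filter

/-! ### Weak derivatives and the Hilbert structure of the Sobolev norm -/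

section WeakDerivatives

variable {d : ℕ} {Ω : Set (Pt d)} {α : Fin d → ℕ} {φ : Pt d → ℝ}

theorem contDiff_pderiv (i : Fin d) (h : ContDiff ℝ (⊤ : ℕ∞) φ) :
    ContDiff ℝ (⊤ : ℕ∞) (pderiv i φ) :=
  (h.fderiv_right (m := (⊤ : ℕ∞)) (by simp)).clm_apply contDiff_const

theorem contDiff_pderiv_iterate (i : Fin d) (k : ℕ) (h : ContDiff ℝ (⊤ : ℕ∞) φ) :
    ContDiff ℝ (⊤ : ℕ∞) ((pderiv i)^[k] φ) := by
  induction k with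
  | zero => exact h
  | succ k ih => rw [Function.iterate_succ_apply']; exact contDiff_pderiv i ih

theorem pderiv_comm (i j : Fin d) (h : ContDiff ℝ (⊤ : ℕ∞) φ) :
    pderiv i (pderiv j φ) = pderiv j (pderiv i φ) := by
  funext x
  have hd : DifferentiableAt ℝ (fderiv ℝ φ) x :=
    (((contDiff_infty.1 h 2).fderiv_right (m := 1) (by norm_num)).differentiable (by simp)) x
  have key : ∀ a b : Fin d, pderiv a (pderiv b φ) x
      = fderiv ℝ (fderiv ℝ φ) x (Pi.single a 1) (Pi.single b 1) := by
    intro a b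
    have : HasFDerivAt (pderiv b φ) ((ContinuousLinearMap.apply ℝ ℝ (Pi.single b 1 : Pt d)).comp
        (fderiv ℝ (fderiv ℝ φ) x)) x :=
      (ContinuousLinearMap.apply ℝ ℝ (Pi.single b 1 : Pt d)).hasFDerivAt.comp x hd.hasFDerivAt
    rw [pderiv, this.fderiv]
    rfl
  rw [key, key]
  exact ((contDiff_infty.1 h 2).contDiffAt.isSymmSndFDerivAt (by simp)) _ _

theorem pderiv_iterate_comm (i j : Fin d) (k : ℕ) (h : ContDiff ℝ (⊤ : ℕ∞) φ) :
    (pderiv j)^[k] (pderiv i φ) = pderiv i ((pderiv j)^[k] φ) := by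
  induction k with
  | zero => rfl
  | succ k ih =>
    rw [Function.iterate_succ_apply', Function.iterate_succ_apply', ih,
      pderiv_comm j i (contDiff_pderiv_iterate j k h)]

theorem contDiff_foldr_pderiv (l : List (Fin d)) (h : ContDiff ℝ (⊤ : ℕ∞) φ) :
    ContDiff ℝ (⊤ : ℕ∞) (l.foldr (fun i ψ => (pderiv i)^[α i] ψ) φ) := by
  induction l with
  | nil => exact h
  | cons j t ih => exact contDiff_pderiv_iterate j _ ih

theorem foldr_pderiv_comm (l : List (Fin d)) (i : Fin d) (h : ContDiff ℝ (⊤ : ℕ∞) φ) :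
    l.foldr (fun i ψ => (pderiv i)^[α i] ψ) (pderiv i φ)
      = pderiv i (l.foldr (fun i ψ => (pderiv i)^[α i] ψ) φ) := by
  induction l with
  | nil => rfl
  | cons j t ih =>
    simp only [List.foldr_cons]
    rw [ih, pderiv_iterate_comm i j _ (contDiff_foldr_pderiv t h)]

theorem foldr_pderiv_of_notMem (l : List (Fin d)) (i : Fin d) (hi : i ∉ l) :
    l.foldr (fun j ψ => (pderiv j)^[(α + Pi.single i 1 : Fin d → ℕ) j] ψ) φ
      = l.foldr (fun j ψ => (pderiv j)^[α j] ψ) φ := by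
  induction l with
  | nil => rfl
  | cons j t ih =>
    simp only [List.mem_cons, not_or] at hi
    have : (α + Pi.single i 1 : Fin d → ℕ) j = α j := by simp [Ne.symm hi.1]
    simp only [List.foldr_cons]
    rw [ih hi.2, this]

theorem foldr_pderiv_add_single (l : List (Fin d)) (hl : l.Nodup) (i : Fin d) (hi : i ∈ l)
    (h : ContDiff ℝ (⊤ : ℕ∞) φ) :
    l.foldr (fun j ψ => (pderiv j)^[(α + Pi.single i 1 : Fin d → ℕ) j] ψ) φ
      = pderiv i (l.foldr (fun j ψ => (pderiv j)^[α j] ψ) φ) := by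
  induction l with
  | nil => simp at hi
  | cons j t ih =>
    rw [List.nodup_cons] at hl
    simp only [List.foldr_cons]
    by_cases hij : i = j
    · subst hij
      rw [foldr_pderiv_of_notMem t i hl.1]
      have : (α + Pi.single i 1 : Fin d → ℕ) i = α i + 1 := by simp
      rw [this, Function.iterate_succ_apply']
    · have hit : i ∈ t := by simpa [hij] using hi
      have : (α + Pi.single i 1 : Fin d → ℕ) j = α j := by simp [Ne.symm hij]
      rw [ih hl.2 hit, this, pderiv_iterate_comm i j _ (contDiff_foldr_pderiv t h)]

/-- Partial derivatives of a smooth function commute, so the additional one can be moved through the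
fold to the slot of index `i`, which occurs exactly once in the list. -/
theorem mderiv_pderiv (i : Fin d) (h : ContDiff ℝ (⊤ : ℕ∞) φ) :
    mderiv α (pderiv i φ) = mderiv (α + Pi.single i 1) φ := by
  unfold mderiv
  rw [foldr_pderiv_comm _ _ h,
    foldr_pderiv_add_single _ (List.nodup_finRange d) i (List.mem_finRange i) h]

theorem mderiv_zero : mderiv (0 : Fin d → ℕ) φ = φ := by
  unfold mderiv
  induction List.finRange d with
  | nil => rfl
  | cons j t ih => exact ih

theorem tsupport_pderiv_subset (i : Fin d) : tsupport (pderiv i φ) ⊆ tsupport φ :=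
  (closure_mono fun x hx => by
    contrapose! hx
    have : fderiv ℝ φ x = 0 := by
      by_contra hne
      exact hx (support_fderiv_subset ℝ hne)
    simp [pderiv, this]).trans (closure_mono (Set.Subset.refl _) |>.trans
      (isClosed_tsupport φ).closure_subset)

theorem IsTestFunction.pderiv (i : Fin d) (h : IsTestFunction Ω φ) :
    IsTestFunction Ω (pderiv i φ) :=
  ⟨contDiff_pderiv i h.1, h.2.1.mono' ((subset_tsupport _).trans (tsupport_pderiv_subset i)),
    (tsupport_pderiv_subset i).trans h.2.2⟩

theorem IsTestFunction.mderiv (α : Fin d → ℕ) (h : IsTestFunction Ω φ) :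
    IsTestFunction Ω (mderiv α φ) := by
  unfold HJ.mderiv
  induction List.finRange d with
  | nil => exact h
  | cons j t ih =>
    simp only [List.foldr_cons]
    induction α j with
    | zero => exact ih
    | succ k ihk => rw [Function.iterate_succ_apply']; exact ihk.pderiv j

theorem IsTestFunction.memLp (h : IsTestFunction Ω φ) : MemLp φ 2 (volume.restrict Ω) :=
  (h.1.continuous.memLp_of_hasCompactSupport h.2.1).restrict _

theorem MemLp.integrable_mul_test {u : Pt d → ℝ} (hu : MemLp u 2 (volume.restrict Ω))
    (h : IsTestFunction Ω φ) : Integrable (fun x => u x * φ x) (volume.restrict Ω) :=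
  hu.integrable_mul h.memLp

theorem order_add (α β : Fin d → ℕ) : order (α + β) = order α + order β := by
  simp [order, Finset.sum_add_distrib]

theorem order_single (i : Fin d) (k : ℕ) : order (Pi.single i k) = k := by
  simp [order]

theorem order_zero : order (0 : Fin d → ℕ) = 0 := by simp [order]

/-- The fundamental lemma of the calculus of variations. Since `weakDeriv` is an arbitrary choice,
linearity and all other identities for it hold only almost everywhere, through this uniqueness. -/
theorem IsWeakDeriv.ae_eq (hΩ : IsOpen Ω) {u v w : Pt d → ℝ} (hv : IsWeakDeriv Ω α u v)
    (hw : IsWeakDeriv Ω α u w) : v =ᵐ[volume.restrict Ω] w := by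
  have hl : LocallyIntegrableOn (v - w) Ω volume := by
    refine locallyIntegrableOn_of_locallyIntegrable_restrict ?_
    exact (hv.1.sub hw.1).locallyIntegrable (by norm_num)
  have := hΩ.ae_eq_zero_of_integral_contDiff_smul_eq_zero hl (fun φ h1 h2 h3 => by
    have ht : IsTestFunction Ω φ := ⟨h1, h2, h3⟩
    have hz : ∫ x in Ω, (v - w) x * φ x = 0 := by
      have e1 := hv.2 φ ht
      have e2 := hw.2 φ ht
      rw [e1] at e2
      have e3 := mul_left_cancel₀ (pow_ne_zero _ (by norm_num)) e2
      simp only [Pi.sub_apply, sub_mul]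
      rw [integral_sub (MemLp.integrable_mul_test hv.1 ht) (MemLp.integrable_mul_test hw.1 ht), e3,
        sub_self]
    rw [← setIntegral_eq_integral_of_forall_compl_eq_zero (s := Ω)]
    · simpa [mul_comm] using hz
    · intro x hx
      have : φ x = 0 := image_eq_zero_of_notMem_tsupport fun h => hx (h3 h)
      simp [this])
  refine (ae_restrict_iff' hΩ.measurableSet).2 ?_
  filter_upwards [this] with x hx hxΩ
  exact sub_eq_zero.1 (hx hxΩ)

theorem IsWeakDeriv.linear {u u' v v' : Pt d → ℝ} (hu : MemLp u 2 (volume.restrict Ω))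
    (hu' : MemLp u' 2 (volume.restrict Ω)) (hv : IsWeakDeriv Ω α u v)
    (hv' : IsWeakDeriv Ω α u' v') (a b : ℝ) :
    IsWeakDeriv Ω α (a • u + b • u') (a • v + b • v') := by
  refine ⟨(hv.1.const_smul a).add (hv'.1.const_smul b), fun φ h => ?_⟩
  have hm := h.mderiv α
  have key : ∀ (f g ψ : Pt d → ℝ), MemLp f 2 (volume.restrict Ω) → MemLp g 2 (volume.restrict Ω) →
      IsTestFunction Ω ψ → ∫ x in Ω, (a • f + b • g) x * ψ x
        = a * (∫ x in Ω, f x * ψ x) + b * ∫ x in Ω, g x * ψ x := by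
    intro f g ψ hf hg hψ
    rw [← integral_const_mul, ← integral_const_mul, ← integral_add
      ((MemLp.integrable_mul_test hf hψ).const_mul a) ((MemLp.integrable_mul_test hg hψ).const_mul b)]
    congr 1; funext x; simp; ring
  rw [key _ _ _ hu hu' hm, key _ _ _ hv.1 hv'.1 h, hv.2 φ h, hv'.2 φ h]
  ring

theorem isWeakDeriv_zero {u : Pt d → ℝ} (hu : MemLp u 2 (volume.restrict Ω)) :
    IsWeakDeriv Ω 0 u u :=
  ⟨hu, fun φ _ => by simp [mderiv_zero, order_zero]⟩

theorem isWeakDeriv_weakDeriv {u : Pt d → ℝ} (h : ∃ v, IsWeakDeriv Ω α u v) :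
    IsWeakDeriv Ω α u (weakDeriv Ω α u) := by
  unfold weakDeriv
  rw [dif_pos h]
  exact h.choose_spec

theorem MemH.isWeakDeriv {k : ℕ} {u : Pt d → ℝ} (h : MemH Ω k u) (hα : order α ≤ k) :
    IsWeakDeriv Ω α u (weakDeriv Ω α u) :=
  isWeakDeriv_weakDeriv (h.2 α hα)

theorem MemH.memLp_weakDeriv {k : ℕ} {u : Pt d → ℝ} (h : MemH Ω k u) (hα : order α ≤ k) :
    MemLp (weakDeriv Ω α u) 2 (volume.restrict Ω) :=
  (h.isWeakDeriv hα).1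

theorem MemH.weakDeriv_zero_ae (hΩ : IsOpen Ω) {k : ℕ} {u : Pt d → ℝ} (h : MemH Ω k u) :
    weakDeriv Ω 0 u =ᵐ[volume.restrict Ω] u :=
  (h.isWeakDeriv (α := 0) (by simp [order_zero])).ae_eq hΩ (isWeakDeriv_zero h.1)

theorem MemH.linear {k : ℕ} {u v : Pt d → ℝ} (hu : MemH Ω k u) (hv : MemH Ω k v) (a b : ℝ) :
    MemH Ω k (a • u + b • v) :=
  ⟨(hu.1.const_smul a).add (hv.1.const_smul b), fun _ hα =>
    ⟨_, (hu.isWeakDeriv hα).linear hu.1 hv.1 (hv.isWeakDeriv hα) a b⟩⟩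

theorem MemH.weakDeriv_linear (hΩ : IsOpen Ω) {k : ℕ} {u v : Pt d → ℝ} (hu : MemH Ω k u)
    (hv : MemH Ω k v) (a b : ℝ) (hα : order α ≤ k) :
    weakDeriv Ω α (a • u + b • v) =ᵐ[volume.restrict Ω]
      fun x => a * weakDeriv Ω α u x + b * weakDeriv Ω α v x :=
  ((hu.linear hv a b).isWeakDeriv hα).ae_eq hΩ
    ((hu.isWeakDeriv hα).linear hu.1 hv.1 (hv.isWeakDeriv hα) a b)

/-- Testing `∂^α u` with `∂_i φ` is the same as testing `u` with `∂^(α + e_i) φ`. Thus the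
separately chosen weak derivatives are weak first derivatives of each other, which is the input for
mollification. -/
theorem MemH.integral_weakDeriv_mul_pderiv {k : ℕ} {u : Pt d → ℝ} (h : MemH Ω k u)
    (hα : order α < k) (i : Fin d) (hφ : IsTestFunction Ω φ) :
    ∫ x in Ω, weakDeriv Ω α u x * pderiv i φ x
      = - ∫ x in Ω, weakDeriv Ω (α + Pi.single i 1) u x * φ x := by
  have e1 := (h.isWeakDeriv hα.le).2 _ (hφ.pderiv i)
  have e2 := (h.isWeakDeriv (α := α + Pi.single i 1)
    (by rw [order_add, order_single]; omega)).2 _ hφ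
  rw [mderiv_pderiv i hφ.1, e2, order_add, order_single, pow_succ, mul_assoc] at e1
  have := mul_left_cancel₀ (pow_ne_zero _ (by norm_num)) e1
  linarith

/-! ### The Sobolev norm -/

theorem sobNorm_sq (Ω : Set (Pt d)) (k : ℕ) (u : Pt d → ℝ) :
    sobNorm Ω k u ^ 2 = ∑ α ∈ multiIndices d k, ∫ x in Ω, weakDeriv Ω α u x ^ 2 :=
  Real.sq_sqrt (Finset.sum_nonneg fun _ _ => integral_nonneg fun _ => sq_nonneg _)

theorem sobNorm_nonneg (Ω : Set (Pt d)) (k : ℕ) (u : Pt d → ℝ) : 0 ≤ sobNorm Ω k u :=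
  Real.sqrt_nonneg _

theorem integral_weakDeriv_sq_le {k : ℕ} (u : Pt d → ℝ) (hα : order α ≤ k) :
    ∫ x in Ω, weakDeriv Ω α u x ^ 2 ≤ sobNorm Ω k u ^ 2 := by
  rw [sobNorm_sq]
  exact Finset.single_le_sum (f := fun α => ∫ x in Ω, weakDeriv Ω α u x ^ 2)
    (fun _ _ => integral_nonneg fun _ => sq_nonneg _) (mem_multiIndices.2 hα)

theorem sobNorm_mono {k l : ℕ} (hkl : k ≤ l) (u : Pt d → ℝ) : sobNorm Ω k u ≤ sobNorm Ω l u := by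
  refine Real.sqrt_le_sqrt (Finset.sum_le_sum_of_subset_of_nonneg ?_
    fun _ _ _ => integral_nonneg fun _ => sq_nonneg _)
  intro α h
  exact mem_multiIndices.2 ((mem_multiIndices.1 h).trans hkl)

/-- Expansion of the square of the Sobolev norm of a linear combination. -/
theorem MemH.sobNorm_linear_sq (hΩ : IsOpen Ω) {k : ℕ} {u v : Pt d → ℝ} (hu : MemH Ω k u)
    (hv : MemH Ω k v) (a b : ℝ) :
    sobNorm Ω k (a • u + b • v) ^ 2
      = a ^ 2 * sobNorm Ω k u ^ 2 + 2 * a * b * sobInner Ω k u v + b ^ 2 * sobNorm Ω k v ^ 2 := by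
  rw [sobNorm_sq, sobNorm_sq, sobNorm_sq, sobInner, Finset.mul_sum, Finset.mul_sum, Finset.mul_sum,
    ← Finset.sum_add_distrib, ← Finset.sum_add_distrib]
  refine Finset.sum_congr rfl fun α hα => ?_
  have hα := mem_multiIndices.1 hα
  have i1 := (hu.memLp_weakDeriv hα).integrable_sq
  have i2 := (hv.memLp_weakDeriv hα).integrable_sq
  have i3 : Integrable (fun x => weakDeriv Ω α u x * weakDeriv Ω α v x) (volume.restrict Ω) :=
    (hu.memLp_weakDeriv hα).integrable_mul (hv.memLp_weakDeriv hα)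
  rw [← integral_const_mul, ← integral_const_mul, ← integral_const_mul,
    ← integral_add (i1.const_mul _) (i3.const_mul _),
    ← integral_add (by exact (i1.const_mul _).add (i3.const_mul _)) (i2.const_mul _)]
  refine integral_congr_ae ?_
  filter_upwards [hu.weakDeriv_linear hΩ hv a b hα] with x hx
  rw [hx]; ring

theorem MemH.sobInner_linear_right (hΩ : IsOpen Ω) {k : ℕ} {u v w : Pt d → ℝ} (hw : MemH Ω k w)
    (hu : MemH Ω k u) (hv : MemH Ω k v) (a b : ℝ) :
    sobInner Ω k w (a • u + b • v) = a * sobInner Ω k w u + b * sobInner Ω k w v := by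
  rw [sobInner, sobInner, sobInner, Finset.mul_sum, Finset.mul_sum, ← Finset.sum_add_distrib]
  refine Finset.sum_congr rfl fun α hα => ?_
  have hα := mem_multiIndices.1 hα
  have i1 : Integrable (fun x => weakDeriv Ω α w x * weakDeriv Ω α u x) (volume.restrict Ω) :=
    (hw.memLp_weakDeriv hα).integrable_mul (hu.memLp_weakDeriv hα)
  have i2 : Integrable (fun x => weakDeriv Ω α w x * weakDeriv Ω α v x) (volume.restrict Ω) :=
    (hw.memLp_weakDeriv hα).integrable_mul (hv.memLp_weakDeriv hα)
  rw [← integral_const_mul, ← integral_const_mul, ← integral_add (i1.const_mul _) (i2.const_mul _)]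
  refine integral_congr_ae ?_
  filter_upwards [hu.weakDeriv_linear hΩ hv a b hα] with x hx
  rw [hx]; ring

/-- The quadratic polynomial `t ↦ ‖u + t v‖²` is nonnegative, so its discriminant is at most zero.
-/
theorem MemH.abs_sobInner_le (hΩ : IsOpen Ω) {k : ℕ} {u v : Pt d → ℝ} (hu : MemH Ω k u)
    (hv : MemH Ω k v) : |sobInner Ω k u v| ≤ sobNorm Ω k u * sobNorm Ω k v := by
  have h : ∀ t : ℝ, 0 ≤ sobNorm Ω k v ^ 2 * (t * t) + 2 * sobInner Ω k u v * t
      + sobNorm Ω k u ^ 2 := by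
    intro t
    have := hu.sobNorm_linear_sq hΩ hv 1 t
    nlinarith [sq_nonneg (sobNorm Ω k ((1 : ℝ) • u + t • v))]
  have := discrim_le_zero h
  rw [discrim] at this
  refine abs_le_of_sq_le_sq ?_ (mul_nonneg (sobNorm_nonneg _ _ _) (sobNorm_nonneg _ _ _))
  nlinarith

theorem MemH.sobNorm_linear_le (hΩ : IsOpen Ω) {k : ℕ} {u v : Pt d → ℝ} (hu : MemH Ω k u)
    (hv : MemH Ω k v) (a b : ℝ) :
    sobNorm Ω k (a • u + b • v) ≤ |a| * sobNorm Ω k u + |b| * sobNorm Ω k v := by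
  have hu0 := sobNorm_nonneg Ω k u
  have hv0 := sobNorm_nonneg Ω k v
  refine abs_le_of_sq_le_sq' ?_ (by positivity) |>.2
  rw [hu.sobNorm_linear_sq hΩ hv a b, add_sq, mul_pow, mul_pow, sq_abs, sq_abs]
  have h1 : 2 * a * b * sobInner Ω k u v ≤ 2 * |a| * |b| * (sobNorm Ω k u * sobNorm Ω k v) := by
    calc _ ≤ |2 * a * b * sobInner Ω k u v| := le_abs_self _
      _ = 2 * |a| * |b| * |sobInner Ω k u v| := by simp [abs_mul]
      _ ≤ _ := by gcongr; exact hu.abs_sobInner_le hΩ hv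
  linarith

end WeakDerivatives

theorem isOpen_cube (d : ℕ) (R : ℝ) : IsOpen (cube d R) := by
  have : cube d R = Set.univ.pi fun _ => Set.Ioo (-R) R := by
    ext x; simp [cube]
  rw [this]
  exact isOpen_set_pi Set.finite_univ fun _ _ => isOpen_Ioo

/-! ### The Sobolev inequality on a cube, by averages along homotheties -/

section SobolevInequality

theorem convex_cube (d : ℕ) (R : ℝ) : Convex ℝ (cube d R) := by
  have : cube d R = Set.univ.pi fun _ => Set.Ioo (-R) R := by
    ext x; simp [cube]
  rw [this]
  exact convex_pi fun _ _ => convex_Ioo _ _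

theorem volume_cube (d : ℕ) (R : ℝ) : volume (cube d R) = ENNReal.ofReal (2 * R) ^ d := by
  have : cube d R = Set.univ.pi fun _ => Set.Ioo (-R) R := by
    ext x; simp [cube]
  rw [this, volume_pi_pi]
  simp [Real.volume_Ioo, two_mul]

/-- The factor `1 / (e - 1)` is at most `2`. The exponents in use are half-integers, so the
logarithmic case `e = 1` does not occur. -/
theorem lintegral_rpow_le {s e : ℝ} (hs : 0 < s) (hs1 : s ≤ 1) (he : 3 / 2 ≤ e) :
    ∫⁻ t in Set.Ioc s 1, ENNReal.ofReal (t ^ (-e)) ≤ ENNReal.ofReal (2 * s ^ (1 - e)) := by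
  have h0 : (0 : ℝ) ∉ Set.uIcc s 1 := by
    rw [Set.uIcc_of_le hs1]; exact fun h => absurd h.1 (not_le.2 hs)
  have hi : IntegrableOn (fun t : ℝ => t ^ (-e)) (Set.Ioc s 1) :=
    (intervalIntegral.intervalIntegrable_rpow (Or.inr h0)).1
  rw [← ofReal_integral_eq_lintegral_ofReal hi, ← intervalIntegral.integral_of_le hs1,
    integral_rpow (Or.inr ⟨by linarith, h0⟩)]
  · refine ENNReal.ofReal_le_ofReal ?_
    rw [Real.one_rpow, show -e + 1 = 1 - e by ring, ← neg_div_neg_eq,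
      div_le_iff₀ (by linarith)]
    have : 0 < s ^ (1 - e) := Real.rpow_pos_of_pos hs _
    nlinarith
  · refine (ae_restrict_iff' measurableSet_Ioc).2 (Filter.Eventually.of_forall fun t ht => ?_)
    exact Real.rpow_nonneg (hs.le.trans ht.1.le) _

theorem lintegral_rpow_neg_half :
    ∫⁻ t in Set.Ioc (0 : ℝ) 1, ENNReal.ofReal (t ^ (-(1 / 2) : ℝ)) ≤ ENNReal.ofReal 2 := by
  have hi : IntegrableOn (fun t : ℝ => t ^ (-(1 / 2) : ℝ)) (Set.Ioc 0 1) :=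
    (intervalIntegral.intervalIntegrable_rpow' (by norm_num)).1
  rw [← ofReal_integral_eq_lintegral_ofReal hi, ← intervalIntegral.integral_of_le zero_le_one,
    integral_rpow (Or.inl (by norm_num))]
  · refine ENNReal.ofReal_le_ofReal ?_
    rw [Real.one_rpow, Real.zero_rpow (by norm_num)]
    norm_num
  · refine (ae_restrict_iff' measurableSet_Ioc).2 (Filter.Eventually.of_forall fun t ht => ?_)
    exact Real.rpow_nonneg ht.1.le _

variable {d : ℕ} {ρ : ℝ} {x : Pt d}

theorem segment_mem_cube {y : Pt d} (hx : x ∈ cube d ρ) (hy : y ∈ cube d ρ) {s : ℝ}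
    (hs : s ∈ Set.Icc (0 : ℝ) 1) : x + s • (y - x) ∈ cube d ρ :=
  (convex_cube d ρ).add_smul_sub_mem hx hy hs

/-- By convexity the homothety with centre `x` maps the cube into itself, and its Jacobian is `s ^
d`. -/
theorem lintegral_comp_homothety_le (hx : x ∈ cube d ρ) {g : Pt d → ℝ≥0∞} (hg : Measurable g)
    {s : ℝ} (hs : 0 < s) (hs1 : s ≤ 1) :
    ∫⁻ y in cube d ρ, g (x + s • (y - x)) ≤ ENNReal.ofReal ((s ^ d)⁻¹) * ∫⁻ y in cube d ρ, g y := by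
  have hm := (isOpen_cube d ρ).measurableSet
  have hG : Measurable ((cube d ρ).indicator g) := hg.indicator hm
  calc ∫⁻ y in cube d ρ, g (x + s • (y - x))
      ≤ ∫⁻ y, (cube d ρ).indicator g ((x - s • x) + s • y) := by
        rw [← lintegral_indicator hm]
        refine lintegral_mono fun y => ?_
        by_cases hy : y ∈ cube d ρ
        · have h1 := segment_mem_cube hx hy ⟨hs.le, hs1⟩
          have h2 : (x - s • x) + s • y = x + s • (y - x) := by rw [smul_sub]; abel
          rw [Set.indicator_of_mem hy, h2, Set.indicator_of_mem h1]
        · rw [Set.indicator_of_notMem hy]; exact zero_le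
    _ = ∫⁻ z, (cube d ρ).indicator g ((x - s • x) + z) ∂(Measure.map (s • ·) volume) := by
        rw [lintegral_map (by fun_prop) (by fun_prop)]
    _ = ENNReal.ofReal ((s ^ d)⁻¹) * ∫⁻ z, (cube d ρ).indicator g ((x - s • x) + z) := by
        rw [Measure.map_addHaar_smul _ hs.ne', lintegral_smul_measure, smul_eq_mul,
          Module.finrank_fin_fun, abs_of_pos (by positivity)]
    _ = _ := by
        rw [lintegral_add_left_eq_self (fun z => (cube d ρ).indicator g z) (x - s • x),
          lintegral_indicator hm]

variable {w : (Fin d → ℕ) → Pt d → ℝ}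

/-- Mean of `|w|` along a homothety with centre `x`. -/
def homMean (ρ : ℝ) (x : Pt d) (w : Pt d → ℝ) (s : ℝ) : ℝ≥0∞ :=
  ∫⁻ y in cube d ρ, ‖w (x + s • (y - x))‖ₑ

/-- Cauchy–Schwarz on the cube, then the change of variables applied to the square: the loss is `s ^
(-d / 2)`. -/
theorem homMean_le_eLpNorm (hx : x ∈ cube d ρ) {w : Pt d → ℝ} (hw : Continuous w) {s : ℝ}
    (hs : 0 < s) (hs1 : s ≤ 1) :
    homMean ρ x w s ≤ ENNReal.ofReal (s ^ (-(d / 2 : ℝ))) *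
      (volume (cube d ρ) ^ (1 / 2 : ℝ) * eLpNorm w 2 (volume.restrict (cube d ρ))) := by
  have h1 := eLpNorm_le_eLpNorm_mul_rpow_measure_univ (p := 1) (q := 2) (by norm_num)
    (μ := volume.restrict (cube d ρ)) (f := fun y => w (x + s • (y - x)))
    (by fun_prop)
  have h2 : eLpNorm (fun y => w (x + s • (y - x))) 2 (volume.restrict (cube d ρ))
      ≤ ENNReal.ofReal (s ^ (-(d / 2 : ℝ))) * eLpNorm w 2 (volume.restrict (cube d ρ)) := by
    rw [eLpNorm_eq_lintegral_rpow_enorm_toReal (by norm_num) (by norm_num),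
      eLpNorm_eq_lintegral_rpow_enorm_toReal (by norm_num) (by norm_num)]
    have e : ENNReal.ofReal (s ^ (-(d / 2 : ℝ)))
        = ENNReal.ofReal ((s ^ d)⁻¹) ^ (1 / (2 : ℝ≥0∞).toReal) := by
      rw [ENNReal.ofReal_rpow_of_pos (by positivity), ← Real.rpow_natCast, ← Real.rpow_neg hs.le,
        ← Real.rpow_mul hs.le]
      congr 2
      simp; ring
    rw [e, ← ENNReal.mul_rpow_of_nonneg _ _ (by positivity)]
    gcongr
    exact lintegral_comp_homothety_le hx (g := fun y => ‖w y‖ₑ ^ (2 : ℝ≥0∞).toReal)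
      (by fun_prop) hs hs1
  rw [eLpNorm_one_eq_lintegral_enorm] at h1
  refine h1.trans ?_
  rw [Measure.restrict_apply_univ]
  calc _ ≤ _ := mul_le_mul_left h2 _
    _ = _ := by
      norm_num
      ring

/-- A family of functions indexed by multi-indices, closed under partial derivatives on `U` up to
order `k`. -/
def IsDerivFamily (U : Set (Pt d)) (k : ℕ) (w : (Fin d → ℕ) → Pt d → ℝ) : Prop :=
  ∀ α, order α < k → ∀ x ∈ U,
    HasFDerivAt (w α) (∑ i, w (α + Pi.single i 1) x • (ContinuousLinearMap.proj i : Pt d →L[ℝ] ℝ)) x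

/-- The fundamental theorem of calculus along the segment from `x + s (y - x)` to `y`, whose
velocity `y - x` has coordinates of size at most `2ρ`. -/
theorem enorm_le_add_lintegral_segment {k : ℕ} (hw : ∀ α, Continuous (w α))
    (hd : IsDerivFamily (cube d ρ) k w)
    {α : Fin d → ℕ} (hα : order α < k) (hx : x ∈ cube d ρ) {y : Pt d} (hy : y ∈ cube d ρ)
    {s : ℝ} (hs : s ∈ Set.Icc (0 : ℝ) 1) :
    ‖w α (x + s • (y - x))‖ₑ ≤ ‖w α (x + (1 : ℝ) • (y - x))‖ₑ + ENNReal.ofReal (2 * ρ) *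
      ∑ i, ∫⁻ t in Set.Ioc s 1, ‖w (α + Pi.single i 1) (x + t • (y - x))‖ₑ := by
  set f' : ℝ → ℝ := fun t => ∑ i, w (α + Pi.single i 1) (x + t • (y - x)) * (y i - x i) with hf'
  have hf'c : Continuous f' := by
    refine continuous_finsetSum _ fun i _ => ?_
    have := hw (α + Pi.single i 1)
    fun_prop
  have hder : ∀ t ∈ Set.uIcc s 1, HasDerivAt (fun t => w α (x + t • (y - x))) (f' t) t := by
    intro t ht
    rw [Set.uIcc_of_le hs.2] at ht
    have h1 := hd α hα _ (segment_mem_cube hx hy ⟨hs.1.trans ht.1, ht.2⟩)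
    have h2 : HasDerivAt (fun t : ℝ => x + t • (y - x)) (y - x) t := by
      simpa using ((hasDerivAt_id t).smul_const (y - x)).const_add x
    have h3 := h1.comp_hasDerivAt t h2
    refine h3.congr_deriv ?_
    simp [hf']
  have hint := intervalIntegral.integral_eq_sub_of_hasDerivAt hder
    (hf'c.intervalIntegrable _ _)
  have e1 : w α (x + s • (y - x)) = w α (x + (1 : ℝ) • (y - x)) - ∫ t in s..1, f' t := by
    rw [hint]; ring
  rw [e1]
  refine (enorm_sub_le).trans (add_le_add le_rfl ?_)
  rw [intervalIntegral.integral_of_le hs.2]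
  refine (enorm_integral_le_lintegral_enorm _).trans ?_
  rw [← lintegral_finsetSum, ← lintegral_const_mul]
  · refine lintegral_mono fun t => ?_
    rw [Finset.mul_sum]
    refine (enorm_sum_le _ _).trans (Finset.sum_le_sum fun i _ => ?_)
    rw [enorm_mul, mul_comm]
    gcongr
    rw [← ofReal_norm]
    refine ENNReal.ofReal_le_ofReal ?_
    rw [Real.norm_eq_abs, abs_le]
    have := hx i; have := hy i
    constructor <;> linarith
  · refine Finset.measurable_sum _ fun i _ => ?_
    exact ((hw (α + Pi.single i 1)).comp (by fun_prop)).enorm.measurable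
  · intro i _
    exact ((hw (α + Pi.single i 1)).comp (by fun_prop)).enorm.measurable

theorem homMean_le_add {k : ℕ} (hw : ∀ α, Continuous (w α))
    (hd : IsDerivFamily (cube d ρ) k w)
    {α : Fin d → ℕ} (hα : order α < k) (hx : x ∈ cube d ρ) {s : ℝ} (hs : s ∈ Set.Icc (0 : ℝ) 1) :
    homMean ρ x (w α) s ≤ homMean ρ x (w α) 1 + ENNReal.ofReal (2 * ρ) *
      ∑ i, ∫⁻ t in Set.Ioc s 1, homMean ρ x (w (α + Pi.single i 1)) t := by
  have hc : ∀ β, Continuous fun q : Pt d × ℝ => w β (x + q.2 • (q.1 - x)) := fun β => by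
    have := hw β
    fun_prop
  have hm : ∀ β, Measurable fun y : Pt d => ∫⁻ t in Set.Ioc s 1, ‖w β (x + t • (y - x))‖ₑ :=
    fun β => Measurable.lintegral_prod_right' (f := fun q : Pt d × ℝ => ‖w β (x + q.2 • (q.1 - x))‖ₑ)
      (hc β).enorm.measurable
  have hm1 : Measurable fun y : Pt d => ‖w α (x + (1 : ℝ) • (y - x))‖ₑ :=
    ((hw α).comp (by fun_prop)).enorm.measurable
  calc homMean ρ x (w α) s
      ≤ ∫⁻ y in cube d ρ, (‖w α (x + (1 : ℝ) • (y - x))‖ₑ + ENNReal.ofReal (2 * ρ) *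
          ∑ i, ∫⁻ t in Set.Ioc s 1, ‖w (α + Pi.single i 1) (x + t • (y - x))‖ₑ) :=
        setLIntegral_mono' (isOpen_cube d ρ).measurableSet fun y hy =>
          enorm_le_add_lintegral_segment hw hd hα hx hy hs
    _ = _ := by
        rw [lintegral_add_left hm1, lintegral_const_mul, lintegral_finsetSum]
        · congr 2
          refine Finset.sum_congr rfl fun i _ => ?_
          rw [lintegral_lintegral_swap]
          · rfl
          · exact (hc _).enorm.measurable.aemeasurable
        · exact fun i _ => hm _
        · exact Finset.measurable_sum _ fun i _ => hm _

/-- The constants in the estimate of `homMean`. -/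
def homConst (d : ℕ) (ρ : ℝ) : ℕ → ℝ
  | 0 => 1
  | m + 1 => 1 + 4 * ρ * d * homConst d ρ m

theorem homConst_nonneg (hρ : 0 ≤ ρ) (m : ℕ) : 0 ≤ homConst d ρ m := by
  induction m with
  | zero => simp [homConst]
  | succ m ih => simp only [homConst]; positivity

theorem homConst_mono {ρ' : ℝ} (hρ : 0 ≤ ρ) (h : ρ ≤ ρ') (m : ℕ) :
    homConst d ρ m ≤ homConst d ρ' m := by
  induction m with
  | zero => simp [homConst]
  | succ m ih =>
    simp only [homConst]
    have := homConst_nonneg (d := d) hρ m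
    have : 0 ≤ ρ' := hρ.trans h
    gcongr

/-- One trade of a derivative for a power of `s`: a bound with profile `ψ` for the derivatives of
order one higher is integrated over `[s, 1]`. The hypothesis `1 ≤ K` lets the term at `s = 1` be
absorbed into the same form. -/
theorem homMean_step {k : ℕ} (hρ : 0 < ρ) (hw : ∀ α, Continuous (w α))
    (hd : IsDerivFamily (cube d ρ) k w) {B : ℝ≥0∞} {α : Fin d → ℕ} (hα : order α < k)
    (hx : x ∈ cube d ρ) {s c : ℝ} (hs : s ∈ Set.Icc (0 : ℝ) 1) (hc : 0 ≤ c) {ψ : ℝ → ℝ} {K : ℝ}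
    (hK : 1 ≤ K)
    (h1 : homMean ρ x (w α) 1 ≤ B)
    (h2 : ∀ i, ∀ t ∈ Set.Ioc s 1, homMean ρ x (w (α + Pi.single i 1)) t
      ≤ ENNReal.ofReal c * B * ENNReal.ofReal (ψ t))
    (hψm : Measurable ψ)
    (hψ : ∫⁻ t in Set.Ioc s 1, ENNReal.ofReal (ψ t) ≤ ENNReal.ofReal (2 * K)) :
    homMean ρ x (w α) s ≤ ENNReal.ofReal (1 + 4 * ρ * d * c) * B * ENNReal.ofReal K := by
  have h3 : ∀ i, ∫⁻ t in Set.Ioc s 1, homMean ρ x (w (α + Pi.single i 1)) t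
      ≤ ENNReal.ofReal c * B * ENNReal.ofReal (2 * K) := by
    intro i
    refine (setLIntegral_mono' measurableSet_Ioc (h2 i)).trans ?_
    rw [lintegral_const_mul _ (by fun_prop)]
    gcongr
  calc homMean ρ x (w α) s
      ≤ homMean ρ x (w α) 1 + ENNReal.ofReal (2 * ρ) *
          ∑ i, ∫⁻ t in Set.Ioc s 1, homMean ρ x (w (α + Pi.single i 1)) t :=
        homMean_le_add hw hd hα hx hs
    _ ≤ B + ENNReal.ofReal (2 * ρ) * ∑ _i : Fin d, ENNReal.ofReal c * B * ENNReal.ofReal (2 * K) := by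
        gcongr with i
        exact h3 i
    _ = B + B * ENNReal.ofReal (4 * ρ * d * c * K) := by
        rw [Finset.sum_const, Finset.card_univ, Fintype.card_fin, nsmul_eq_mul,
          ← ENNReal.ofReal_natCast,
          show 4 * ρ * d * c * K = (2 * ρ) * (d * (c * (2 * K))) by ring,
          ENNReal.ofReal_mul (p := 2 * ρ) (by positivity), ENNReal.ofReal_mul (p := (d : ℝ)) (by positivity),
          ENNReal.ofReal_mul hc]
        ring
    _ ≤ B * ENNReal.ofReal K + B * ENNReal.ofReal (4 * ρ * d * c * K) := by
        gcongr
        calc B = B * 1 := (mul_one B).symm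
          _ ≤ _ := by gcongr; simpa using hK
    _ = _ := by
        rw [← mul_add, ← ENNReal.ofReal_add (by positivity) (by positivity),
          show K + 4 * ρ * d * c * K = (1 + 4 * ρ * d * c) * K by ring,
          ENNReal.ofReal_mul (by positivity)]
        ring

/-- Induction on the number `m` of derivatives still available above `α`. The start is the `L²`
bound, with `d / 2` replaced by the weaker `k - 1/2`; every integration in `s` then lowers the
exponent by one. -/
theorem homMean_le_rpow {k : ℕ} (hk : d + 1 ≤ 2 * k) (hρ : 0 < ρ) (hw : ∀ α, Continuous (w α))
    (hd : IsDerivFamily (cube d ρ) k w) {A : ℝ≥0∞}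
    (hA : ∀ α, order α ≤ k → eLpNorm (w α) 2 (volume.restrict (cube d ρ)) ≤ A)
    (hx : x ∈ cube d ρ) (m : ℕ) (hm : m + 1 ≤ k) (α : Fin d → ℕ) (hα : order α + m ≤ k)
    {s : ℝ} (hs : 0 < s) (hs1 : s ≤ 1) :
    homMean ρ x (w α) s ≤ ENNReal.ofReal (homConst d ρ m) * (volume (cube d ρ) ^ (1 / 2 : ℝ) * A) *
      ENNReal.ofReal (s ^ (-((k : ℝ) - m - 1 / 2))) := by
  induction m generalizing α s with
  | zero =>
    refine (homMean_le_eLpNorm hx (hw α) hs hs1).trans ?_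
    simp only [homConst, ENNReal.ofReal_one, one_mul, Nat.cast_zero, sub_zero]
    rw [mul_comm]
    have : (d : ℝ) + 1 ≤ 2 * k := by exact_mod_cast hk
    gcongr ?_ * ?_
    · gcongr
      exact hA α (by omega)
    · refine ENNReal.ofReal_le_ofReal (Real.rpow_le_rpow_of_exponent_ge hs hs1 ?_)
      linarith
  | succ m ih =>
    have hk2 : (m : ℝ) + 2 ≤ k := by exact_mod_cast hm
    refine homMean_step hρ hw hd (ψ := fun t => t ^ (-((k : ℝ) - m - 1 / 2))) (by omega) hx ⟨hs.le, hs1⟩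
      (homConst_nonneg hρ.le m) ?_ ?_ ?_ (by fun_prop) ?_
    · refine Real.one_le_rpow_of_pos_of_le_one_of_nonpos hs hs1 ?_
      push_cast; linarith
    · have := homMean_le_eLpNorm hx (hw α) zero_lt_one le_rfl
      simp only [Real.one_rpow, ENNReal.ofReal_one, one_mul] at this
      refine this.trans ?_
      gcongr
      exact hA α (by omega)
    · intro i t ht
      exact ih (by omega) _ (by rw [order_add, order_single]; omega) (hs.trans ht.1) ht.2
    · have := lintegral_rpow_le (e := (k : ℝ) - m - 1 / 2) hs hs1 (by linarith)
      rw [show -((k : ℝ) - ((m + 1 : ℕ) : ℝ) - 1 / 2) = 1 - (k - m - 1 / 2) by push_cast; ring]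
      exact this

/-- The Sobolev inequality on a cube: derivatives of order greater than `d / 2` in `L²` bound the
supremum. -/
theorem sobolev_inequality {k : ℕ} (hk : d + 1 ≤ 2 * k) (hρ : 0 < ρ) (hw : ∀ α, Continuous (w α))
    (hd : IsDerivFamily (cube d ρ) k w) {A : ℝ≥0∞}
    (hA : ∀ α, order α ≤ k → eLpNorm (w α) 2 (volume.restrict (cube d ρ)) ≤ A)
    (hx : x ∈ cube d ρ) :
    ‖w 0 x‖ₑ * volume (cube d ρ)
      ≤ ENNReal.ofReal (homConst d ρ k) * (volume (cube d ρ) ^ (1 / 2 : ℝ) * A) := by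
  have hk0 : 0 < k := by omega
  have h0 : homMean ρ x (w 0) 0 = ‖w 0 x‖ₑ * volume (cube d ρ) := by simp [homMean]
  rw [← h0]
  obtain ⟨m, rfl⟩ : ∃ m, k = m + 1 := ⟨k - 1, by omega⟩
  -- With `m = k - 1` the first derivatives of `w 0` are bounded by `t ^ (-1/2)`, which is
  -- integrable down to `0`. A last step at `s = 0`, where the average degenerates to the value at
  -- `x`, is therefore allowed.
  have := homMean_step (K := 1) hρ hw hd (B := volume (cube d ρ) ^ (1 / 2 : ℝ) * A) (α := 0)
    (by rw [order_zero]; omega) hx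
    (s := 0) (ψ := fun t => t ^ (-(1 / 2) : ℝ)) (by simp) (homConst_nonneg (d := d) hρ.le m) le_rfl
    ?_ ?_ (by fun_prop) (by simpa using lintegral_rpow_neg_half)
  · simpa [homConst] using this
  · have := homMean_le_eLpNorm hx (hw 0) zero_lt_one le_rfl
    simp only [Real.one_rpow, ENNReal.ofReal_one, one_mul] at this
    refine this.trans ?_
    gcongr
    exact hA 0 (by rw [order_zero]; omega)
  · intro i t ht
    have := homMean_le_rpow hk hρ hw hd hA hx m le_rfl (0 + Pi.single i 1)
      (by rw [order_add, order_single, order_zero]; omega) ht.1 ht.2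
    rwa [show -(((m + 1 : ℕ) : ℝ) - m - 1 / 2) = -(1 / 2) by push_cast; ring] at this

end SobolevInequality

/-! ### Mollification: convergence in `L²` and commutation with weak derivatives -/

section Mollifiers

variable {d : ℕ}

/-- Bump functions shrinking to the origin. -/
def shrinkingBump (d m : ℕ) : ContDiffBump (0 : Pt d) where
  rIn := 1 / (2 * (m + 1))
  rOut := 1 / (m + 1)
  rIn_pos := by positivity
  rIn_lt_rOut := by
    have : (0 : ℝ) < m + 1 := by positivity
    rw [div_lt_div_iff₀ (by positivity) this]
    linarith

/-- The normalized mollifier. -/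
def mollKernel (d m : ℕ) : Pt d → ℝ := (shrinkingBump d m).normed volume

/-- Mollification. -/
def moll (m : ℕ) (f : Pt d → ℝ) : Pt d → ℝ :=
  mollKernel d m ⋆[ContinuousLinearMap.lsmul ℝ ℝ, volume] f

theorem moll_apply (m : ℕ) (f : Pt d → ℝ) (x : Pt d) :
    moll m f x = ∫ t, mollKernel d m t * f (x - t) := rfl

theorem hasCompactSupport_mollKernel (m : ℕ) : HasCompactSupport (mollKernel d m) :=
  (shrinkingBump d m).hasCompactSupport_normed

theorem contDiff_mollKernel (m : ℕ) : ContDiff ℝ (⊤ : ℕ∞) (mollKernel d m) :=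
  (shrinkingBump d m).contDiff_normed

theorem mollKernel_nonneg (m : ℕ) (x : Pt d) : 0 ≤ mollKernel d m x :=
  (shrinkingBump d m).nonneg_normed x

theorem integral_mollKernel (m : ℕ) : ∫ x, mollKernel d m x = 1 :=
  (shrinkingBump d m).integral_normed

theorem tsupport_mollKernel (m : ℕ) :
    tsupport (mollKernel d m) = Metric.closedBall 0 (1 / (m + 1)) :=
  (shrinkingBump d m).tsupport_normed_eq

theorem continuous_moll (m : ℕ) {f : Pt d → ℝ} (hf : LocallyIntegrable f) :
    Continuous (moll m f) :=
  (hasCompactSupport_mollKernel m).continuous_convolution_left _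
    (contDiff_mollKernel m).continuous hf

theorem integrable_mollKernel_mul (m : ℕ) {f : Pt d → ℝ} (hf : LocallyIntegrable f) (x : Pt d) :
    Integrable fun t => mollKernel d m t * f (x - t) :=
  (hasCompactSupport_mollKernel m).convolutionExists_left (ContinuousLinearMap.lsmul ℝ ℝ)
    (contDiff_mollKernel m).continuous hf x

/-- The probability measure with density the mollifier. -/
def mollMeasure (d m : ℕ) : Measure (Pt d) :=
  volume.withDensity fun t => ENNReal.ofReal (mollKernel d m t)

instance (m : ℕ) : IsProbabilityMeasure (mollMeasure d m) := ⟨by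
  rw [mollMeasure, withDensity_apply _ MeasurableSet.univ, Measure.restrict_univ,
    ← ofReal_integral_eq_lintegral_ofReal, integral_mollKernel, ENNReal.ofReal_one]
  · exact (shrinkingBump d m).integrable_normed
  · exact Eventually.of_forall (mollKernel_nonneg m)⟩

/-- The kernel has integral one, so `f x` can be moved under the integral sign. -/
theorem enorm_moll_sub_le (m : ℕ) {f : Pt d → ℝ} (hf : LocallyIntegrable f) (x : Pt d) :
    ‖moll m f x - f x‖ₑ ≤ ∫⁻ t, ‖f (x - t) - f x‖ₑ ∂(mollMeasure d m) := by
  have h1 : moll m f x - f x = ∫ t, mollKernel d m t * (f (x - t) - f x) := by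
    simp only [mul_sub]
    rw [integral_sub (integrable_mollKernel_mul m hf x)
      (by exact (shrinkingBump d m).integrable_normed.mul_const _), integral_mul_const, integral_mollKernel,
      one_mul, moll_apply]
  rw [h1, mollMeasure, lintegral_withDensity_eq_lintegral_mul_non_measurable₀]
  · refine (enorm_integral_le_lintegral_enorm _).trans (le_of_eq ?_)
    congr 1
    funext t
    rw [enorm_mul, Real.enorm_of_nonneg (mollKernel_nonneg m t)]
    rfl
  · exact (contDiff_mollKernel m).continuous.measurable.ennreal_ofReal.aemeasurable
  · exact Eventually.of_forall fun _ => ENNReal.ofReal_lt_top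

/-- Translations preserve the measure, and composition in `L²` depends continuously on the
measure-preserving map; this is evaluated at the zero translation. -/
theorem exists_eLpNorm_translate_sub_le {f : Pt d → ℝ} (hf : MemLp f 2 volume) {ε : ℝ≥0∞}
    (hε : ε ≠ 0) :
    ∃ δ > 0, ∀ t : Pt d, ‖t‖ < δ → eLpNorm (fun x => f (x - t) - f x) 2 volume ≤ ε := by
  have : Fact ((1 : ℝ≥0∞) ≤ 2) := ⟨by norm_num⟩
  have hmp : ∀ t : Pt d, MeasurePreserving (fun x : Pt d => x - t) volume volume :=
    fun t => measurePreserving_sub_right volume t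
  let g : Pt d → C(Pt d, Pt d) := fun t => ⟨fun x => x - t, by fun_prop⟩
  have hg : Continuous g :=
    (ContinuousMap.curry ⟨fun q : Pt d × Pt d => q.2 - q.1, by fun_prop⟩).continuous
  have hT := (Continuous.compMeasurePreservingLp (f := fun _ : Pt d => hf.toLp f) (g := g)
    continuous_const hg hmp (by norm_num)).tendsto 0
  rw [EMetric.tendsto_nhds] at hT
  obtain ⟨δ, hδ, h⟩ := Metric.eventually_nhds_iff.1 (hT ε (pos_iff_ne_zero.2 hε))
  refine ⟨δ, hδ, fun t ht => ?_⟩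
  have h2 := (h (y := t) (by simpa using ht)).le
  rw [Lp.edist_def] at h2
  refine le_trans (le_of_eq (eLpNorm_congr_ae ?_)) h2
  have e1 := Lp.coeFn_compMeasurePreserving (hf.toLp f) (hmp t)
  have e2 := Lp.coeFn_compMeasurePreserving (hf.toLp f) (hmp 0)
  have e3 := (hmp t).quasiMeasurePreserving.ae_eq_comp hf.coeFn_toLp
  have e4 := (hmp 0).quasiMeasurePreserving.ae_eq_comp hf.coeFn_toLp
  filter_upwards [e1, e2, e3, e4] with x h1 h2 h3 h4
  simp only [Pi.sub_apply]
  have h1' : (Lp.compMeasurePreserving (g t) (hmp t) (hf.toLp f)) x = f (x - t) := h1.trans h3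
  have h2' : (Lp.compMeasurePreserving (g 0) (hmp 0) (hf.toLp f)) x = f (x - 0) := h2.trans h4
  rw [h1', h2', sub_zero]

theorem ae_norm_le_mollMeasure (m : ℕ) : ∀ᵐ t ∂(mollMeasure d m), ‖t‖ ≤ 1 / (m + 1) := by
  rw [mollMeasure, ae_withDensity_iff
    (contDiff_mollKernel m).continuous.measurable.ennreal_ofReal]
  refine Eventually.of_forall fun t ht => ?_
  have : t ∈ tsupport (mollKernel d m) := subset_tsupport _ fun h0 => ht (by simp [h0])
  rw [tsupport_mollKernel] at this
  simpa using this

/-- Mollifications converge in `L²`. -/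
theorem tendsto_eLpNorm_moll_sub {f : Pt d → ℝ} (hf : MemLp f 2 volume)
    (hfm : StronglyMeasurable f) :
    Tendsto (fun m => eLpNorm (moll m f - f) 2 volume) atTop (𝓝 0) := by
  rw [ENNReal.tendsto_atTop_zero]
  intro ε hε
  obtain ⟨δ, hδ, h⟩ := exists_eLpNorm_translate_sub_le hf hε.ne'
  obtain ⟨N, hN⟩ := exists_nat_one_div_lt hδ
  refine ⟨N, fun m hm => ?_⟩
  have hsq : ∀ g : Pt d → ℝ, ∀ μ : Measure (Pt d),
      eLpNorm g 2 μ = (∫⁻ x, ‖g x‖ₑ ^ (2 : ℝ) ∂μ) ^ (1 / 2 : ℝ) := by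
    intro g μ
    rw [eLpNorm_eq_lintegral_rpow_enorm_toReal (by norm_num) (by norm_num)]
    norm_num
  have hmeas : Measurable fun q : Pt d × Pt d => ‖f (q.1 - q.2) - f q.1‖ₑ ^ (2 : ℝ) := by
    have := hfm.measurable
    fun_prop
  have hpt : ∀ x, ‖(moll m f - f) x‖ₑ ^ (2 : ℝ)
      ≤ ∫⁻ t, ‖f (x - t) - f x‖ₑ ^ (2 : ℝ) ∂(mollMeasure d m) := by
    intro x
    have h1 := enorm_moll_sub_le m (hf.locallyIntegrable (by norm_num)) x
    -- `mollMeasure` is a probability measure, so the `L¹` norm in `t` is at most the `L²` norm.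
    have h2 := eLpNorm_le_eLpNorm_of_exponent_le (p := 1) (q := 2) (by norm_num)
      (μ := mollMeasure d m) (f := fun t => f (x - t) - f x)
      (by have := hfm.measurable; exact (by fun_prop : Measurable _).aestronglyMeasurable)
    rw [eLpNorm_one_eq_lintegral_enorm, hsq] at h2
    calc _ ≤ ((∫⁻ t, ‖f (x - t) - f x‖ₑ ^ (2 : ℝ) ∂(mollMeasure d m)) ^ (1 / 2 : ℝ)) ^ (2 : ℝ) := by
          gcongr
          exact h1.trans h2
      _ = _ := by rw [← ENNReal.rpow_mul]; norm_num
  have hε2 : ∀ t : Pt d, ‖t‖ < δ → ∫⁻ x, ‖f (x - t) - f x‖ₑ ^ (2 : ℝ) ≤ ε ^ (2 : ℝ) := by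
    intro t ht
    have := h t ht
    rw [hsq] at this
    calc _ = ((∫⁻ x, ‖f (x - t) - f x‖ₑ ^ (2 : ℝ)) ^ (1 / 2 : ℝ)) ^ (2 : ℝ) := by
          rw [← ENNReal.rpow_mul]; norm_num
      _ ≤ _ := by gcongr
  rw [hsq]
  calc (∫⁻ x, ‖(moll m f - f) x‖ₑ ^ (2 : ℝ)) ^ (1 / 2 : ℝ)
      ≤ (∫⁻ x, ∫⁻ t, ‖f (x - t) - f x‖ₑ ^ (2 : ℝ) ∂(mollMeasure d m)) ^ (1 / 2 : ℝ) := by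
        gcongr with x
        exact hpt x
    -- After Tonelli only translations by `t` in the support of the kernel matter, and these are
    -- shorter than `δ`.
    _ = (∫⁻ t, (∫⁻ x, ‖f (x - t) - f x‖ₑ ^ (2 : ℝ)) ∂(mollMeasure d m)) ^ (1 / 2 : ℝ) := by
        rw [lintegral_lintegral_swap hmeas.aemeasurable]
    _ ≤ (∫⁻ _, ε ^ (2 : ℝ) ∂(mollMeasure d m)) ^ (1 / 2 : ℝ) := by
        refine ENNReal.rpow_le_rpow (lintegral_mono_ae ?_) (by norm_num)
        filter_upwards [ae_norm_le_mollMeasure (d := d) m] with t ht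
        refine hε2 t (ht.trans_lt (lt_of_le_of_lt ?_ hN))
        gcongr
    _ = ε := by
        rw [lintegral_const, measure_univ, mul_one, ← ENNReal.rpow_mul]
        norm_num

theorem integral_eq_setIntegral_reflect {Ω : Set (Pt d)} {f ψ : Pt d → ℝ} {x : Pt d}
    (hψ : ∀ y, y ∉ Ω → ψ (x - y) = 0) :
    ∫ t, ψ t * f (x - t) = ∫ y in Ω, f y * ψ (x - y) := by
  rw [← integral_sub_left_eq_self _ volume x,
    ← setIntegral_eq_integral_of_forall_compl_eq_zero (s := Ω)]
  · congr 1; funext y; simp [mul_comm]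
  · intro y hy; simp [hψ y hy]

theorem isTestFunction_mollKernel_reflect {Ω : Set (Pt d)} {m : ℕ} {x : Pt d}
    (hx : Metric.closedBall x (1 / (m + 1)) ⊆ Ω) :
    IsTestFunction Ω fun y => mollKernel d m (x - y) := by
  have hsub : tsupport (fun y => mollKernel d m (x - y)) ⊆ Metric.closedBall x (1 / (m + 1)) := by
    refine closure_minimal ?_ Metric.isClosed_closedBall
    intro y hy
    have : x - y ∈ tsupport (mollKernel d m) := subset_tsupport _ hy
    rw [tsupport_mollKernel] at this
    rw [Metric.mem_closedBall, dist_comm, dist_eq_norm]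
    simpa using this
  refine ⟨(contDiff_mollKernel m).comp (contDiff_const.sub contDiff_id), ?_, hsub.trans hx⟩
  exact (isCompact_closedBall x _).of_isClosed_subset (isClosed_tsupport _) hsub

/-- The derivative of a mollification is the mollification of the weak derivative. -/
theorem hasFDerivAt_moll {Ω : Set (Pt d)} {m : ℕ} {x : Pt d}
    (hx : Metric.closedBall x (1 / (m + 1)) ⊆ Ω) {f : Pt d → ℝ} {g : Fin d → Pt d → ℝ}
    (hf : LocallyIntegrable f)
    (hfg : ∀ i φ, IsTestFunction Ω φ → ∫ y in Ω, f y * pderiv i φ y = - ∫ y in Ω, g i y * φ y) :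
    HasFDerivAt (moll m f)
      (∑ i, moll m (g i) x • (ContinuousLinearMap.proj i : Pt d →L[ℝ] ℝ)) x := by
  have hsm := contDiff_mollKernel (d := d) m
  have hcs := hasCompactSupport_mollKernel (d := d) m
  have hD := hcs.hasFDerivAt_convolution_left (ContinuousLinearMap.lsmul ℝ ℝ)
    (contDiff_infty.1 hsm 1) hf x
  refine hD.congr_fderiv ?_
  have htest := isTestFunction_mollKernel_reflect hx
  have hex : Integrable (fun t =>
      ((ContinuousLinearMap.lsmul ℝ ℝ).precompL (Pt d)) (fderiv ℝ (mollKernel d m) t) (f (x - t))) :=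
    (hcs.fderiv ℝ).convolutionExists_left
      (((ContinuousLinearMap.lsmul ℝ ℝ : ℝ →L[ℝ] ℝ →L[ℝ] ℝ)).precompL (Pt d))
      (hsm.continuous_fderiv (by simp)) hf x
  refine ContinuousLinearMap.coe_injective (LinearMap.pi_ext' fun i => LinearMap.ext_ring ?_)
  have hL : ((fderiv ℝ (mollKernel d m) ⋆[(ContinuousLinearMap.lsmul ℝ ℝ).precompL (Pt d), volume] f)
      x) (Pi.single i 1) = ∫ t, pderiv i (mollKernel d m) t * f (x - t) := by
    rw [convolution, ContinuousLinearMap.integral_apply hex]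
    rfl
  have h0 : ∀ y, y ∉ Ω → x - y ∉ tsupport (mollKernel d m) := by
    intro y hy hmem
    rw [tsupport_mollKernel] at hmem
    refine hy (hx ?_)
    rw [Metric.mem_closedBall, dist_comm, dist_eq_norm]
    simpa using hmem
  have hpd : ∀ y, pderiv i (fun y => mollKernel d m (x - y)) y
      = - pderiv i (mollKernel d m) (x - y) := by
    intro y
    have h1 : HasFDerivAt (mollKernel d m) _ (x - y) :=
      ((contDiff_infty.1 hsm 1).differentiable (by simp) (x - y)).hasFDerivAt
    have h2 := h1.comp y ((hasFDerivAt_id y).const_sub x)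
    rw [pderiv]
    rw [show fderiv ℝ (fun y => mollKernel d m (x - y)) y = _ from h2.fderiv]
    simp [pderiv]
  have hR : ∫ t, pderiv i (mollKernel d m) t * f (x - t) = moll m (g i) x := by
    rw [integral_eq_setIntegral_reflect (Ω := Ω), moll_apply,
      integral_eq_setIntegral_reflect (Ω := Ω)]
    -- The reflected kernel is an admissible test function in `Ω` because the ball around `x` lies
    -- in `Ω`. The minus sign from the reflection cancels the one in the definition of the weak
    -- derivative.
    · have := hfg i _ htest
      simp only [hpd, mul_neg, integral_neg] at this
      linarith
    · exact fun y hy => image_eq_zero_of_notMem_tsupport (h0 y hy)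
    · exact fun y hy => image_eq_zero_of_notMem_tsupport
        fun h => h0 y hy (tsupport_pderiv_subset i h)
  simp only [LinearMap.coe_comp, Function.comp_apply, LinearMap.single_apply,
    ContinuousLinearMap.coe_coe]
  rw [hL, hR]
  simp [Pi.single_apply]

end Mollifiers

/-! ### The embedding of `H^p` of the cube into `C²` -/

section Regularity

variable {d : ℕ}

theorem cube_mono {ρ R : ℝ} (h : ρ ≤ R) : cube d ρ ⊆ cube d R :=
  fun _ hx i => ⟨by linarith [(hx i).1], by linarith [(hx i).2]⟩

theorem IsDerivFamily.shift {U : Set (Pt d)} {k l : ℕ} {w : (Fin d → ℕ) → Pt d → ℝ}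
    (h : IsDerivFamily U k w) {α : Fin d → ℕ} (hα : order α + l ≤ k) :
    IsDerivFamily U l fun β => w (α + β) := by
  intro β hβ x hx
  have := h (α + β) (by rw [order_add]; omega) x hx
  simpa only [add_assoc] using this

theorem IsDerivFamily.mono {U V : Set (Pt d)} {k l : ℕ} {w : (Fin d → ℕ) → Pt d → ℝ}
    (h : IsDerivFamily U k w) (hVU : V ⊆ U) (hl : l ≤ k) : IsDerivFamily V l w :=
  fun α hα x hx => h α (hα.trans_le hl) x (hVU hx)

theorem IsDerivFamily.sub {U : Set (Pt d)} {k : ℕ} {v w : (Fin d → ℕ) → Pt d → ℝ}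
    (hv : IsDerivFamily U k v) (hw : IsDerivFamily U k w) :
    IsDerivFamily U k fun α => v α - w α := by
  intro α hα x hx
  refine ((hv α hα x hx).sub (hw α hα x hx)).congr_fderiv ?_
  rw [← Finset.sum_sub_distrib]
  exact Finset.sum_congr rfl fun i _ => (sub_smul _ _ _).symm

/-- The Sobolev inequality for derivatives of order at most two, uniformly over cubes. -/
theorem exists_sobolev_const {R : ℝ} (hR : 0 < R) {k p : ℕ} (hk : d + 1 ≤ 2 * k)
    (hp : k + 2 ≤ p) :
    ∃ C : ℝ, 0 < C ∧ ∀ ρ, R / 2 ≤ ρ → ρ < R → ∀ w : (Fin d → ℕ) → Pt d → ℝ,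
      (∀ α, Continuous (w α)) → IsDerivFamily (cube d ρ) p w → ∀ A : ℝ, 0 ≤ A →
      (∀ α, order α ≤ p → eLpNorm (w α) 2 volume ≤ ENNReal.ofReal A) →
      ∀ α, order α ≤ 2 → ∀ x ∈ cube d ρ, |w α x| ≤ C * A := by
  have hh := homConst_nonneg (d := d) hR.le k
  refine ⟨homConst d R k * ((R ^ d) ^ (1 / 2 : ℝ))⁻¹ + 1, by positivity, ?_⟩
  intro ρ hρ1 hρ2 w hw hd A hA0 hA α hα x hx
  have hρ : 0 < ρ := by linarith
  -- The shifted family turns a derivative of order at most two into the entry at index `0`, at the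
  -- cost of two orders: this is `k + 2 ≤ p`.
  have h := sobolev_inequality (w := fun β => w (α + β)) hk hρ (fun β => hw _)
    (hd.shift (by omega)) (A := ENNReal.ofReal A)
    (fun β hβ => (eLpNorm_restrict_le _ _ _ _).trans (hA _ (by rw [order_add]; omega))) hx
  simp only [add_zero] at h
  have hV : volume (cube d ρ) = ENNReal.ofReal ((2 * ρ) ^ d) := by
    rw [volume_cube, ENNReal.ofReal_pow (by positivity)]
  rw [hV, ENNReal.ofReal_rpow_of_pos (by positivity), Real.enorm_eq_ofReal_abs,
    ← ENNReal.ofReal_mul (by positivity), ← ENNReal.ofReal_mul (by positivity),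
    ← ENNReal.ofReal_mul (homConst_nonneg hρ.le k), ENNReal.ofReal_le_ofReal_iff
      (mul_nonneg (homConst_nonneg hρ.le k) (by positivity))] at h
  set V := (2 * ρ) ^ d with hVdef
  have hVpos : 0 < V := by positivity
  have hV2 : V = V ^ (1 / 2 : ℝ) * V ^ (1 / 2 : ℝ) := by
    rw [← Real.rpow_add hVpos]; norm_num
  have hVh : 0 < V ^ (1 / 2 : ℝ) := by positivity
  have h1 : |w α x| ≤ homConst d ρ k * (V ^ (1 / 2 : ℝ))⁻¹ * A := by
    rw [hV2, ← mul_assoc, ← mul_assoc] at h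
    have : |w α x| * V ^ (1 / 2 : ℝ) ≤ homConst d ρ k * A := by
      refine le_of_mul_le_mul_right ?_ hVh
      calc |w α x| * V ^ (1 / 2 : ℝ) * V ^ (1 / 2 : ℝ) ≤ _ := h
        _ = _ := by rw [← hV2]; ring
    rw [mul_right_comm, ← div_eq_mul_inv, le_div_iff₀ hVh]
    exact this
  refine h1.trans (mul_le_mul_of_nonneg_right ?_ hA0)
  -- The lower bound `R / 2 ≤ ρ` keeps the volume away from zero and makes the constant independent
  -- of `ρ`.
  have hRV : R ^ d ≤ V := pow_le_pow_left₀ hR.le (by linarith) d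
  have h2 : homConst d ρ k ≤ homConst d R k := homConst_mono hρ.le hρ2.le k
  have h3 : (V ^ (1 / 2 : ℝ))⁻¹ ≤ ((R ^ d) ^ (1 / 2 : ℝ))⁻¹ := by gcongr
  have : homConst d ρ k * (V ^ (1 / 2 : ℝ))⁻¹
      ≤ homConst d R k * ((R ^ d) ^ (1 / 2 : ℝ))⁻¹ := by gcongr
  linarith

/-- Each weak derivative is extended by zero on its own. The extensions need not be derivatives of
each other across the boundary, so their mollifications form a derivative family only on smaller
cubes. -/
theorem MemH.exists_globalDerivs {Ω : Set (Pt d)} (hΩ : IsOpen Ω) {p : ℕ} {u : Pt d → ℝ}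
    (hu : MemH Ω p u) :
    ∃ f : (Fin d → ℕ) → Pt d → ℝ, (∀ α, StronglyMeasurable (f α)) ∧
      (∀ α, MemLp (f α) 2 volume) ∧
      (∀ α, order α ≤ p → f α =ᵐ[volume.restrict Ω] weakDeriv Ω α u) ∧
      ∀ α, order α ≤ p → eLpNorm (f α) 2 volume ≤ ENNReal.ofReal (sobNorm Ω p u) := by
  have key : ∀ α, ∃ g : Pt d → ℝ, StronglyMeasurable g ∧ MemLp g 2 volume ∧
      (order α ≤ p → g =ᵐ[volume.restrict Ω] weakDeriv Ω α u) ∧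
      (order α ≤ p → eLpNorm g 2 volume ≤ ENNReal.ofReal (sobNorm Ω p u)) := by
    intro α
    by_cases hα : order α ≤ p
    · have hm := hu.memLp_weakDeriv hα
      have hi : MemLp (Ω.indicator (weakDeriv Ω α u)) 2 volume :=
        (memLp_indicator_iff_restrict hΩ.measurableSet).2 hm
      refine ⟨hi.1.mk _, hi.1.stronglyMeasurable_mk, hi.ae_eq hi.1.ae_eq_mk, fun _ => ?_,
        fun _ => ?_⟩
      · refine EventuallyEq.trans (ae_restrict_of_ae hi.1.ae_eq_mk.symm) ?_
        exact indicator_ae_eq_restrict hΩ.measurableSet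
      · rw [← eLpNorm_congr_ae hi.1.ae_eq_mk, eLpNorm_indicator_eq_eLpNorm_restrict hΩ.measurableSet,
          hm.eLpNorm_eq_integral_rpow_norm (by norm_num) (by norm_num)]
        refine ENNReal.ofReal_le_ofReal ?_
        have := integral_weakDeriv_sq_le (Ω := Ω) u hα
        have h2 := Real.sqrt_le_sqrt this
        rw [Real.sqrt_sq (sobNorm_nonneg _ _ _)] at h2
        refine le_trans (le_of_eq ?_) h2
        rw [Real.sqrt_eq_rpow]
        norm_num
    · exact ⟨0, stronglyMeasurable_zero, MemLp.zero, fun h => absurd h hα, fun h => absurd h hα⟩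
  choose f h1 h2 h3 h4 using key
  exact ⟨f, h1, h2, h3, h4⟩

theorem closedBall_subset_cube {ρ R r : ℝ} (h : ρ + r < R) {x : Pt d} (hx : x ∈ cube d ρ) :
    Metric.closedBall x r ⊆ cube d R := by
  intro y hy i
  have h1 : |y i - x i| ≤ r := by
    rw [← Real.dist_eq]
    exact (dist_le_pi_dist y x i).trans hy
  have h2 := abs_le.1 h1
  have := hx i
  constructor <;> linarith

theorem exists_mem_smaller_cube {R : ℝ} (hR : 0 < R) {x : Pt d} (hx : x ∈ cube d R) :
    ∃ ρ, R / 2 ≤ ρ ∧ ρ < R ∧ x ∈ cube d ρ := by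
  have : ∀ i, ∃ ρ, ρ < R ∧ |x i| < ρ := fun i => by
    obtain ⟨ρ, h1, h2⟩ := exists_between (abs_lt.2 (hx i))
    exact ⟨ρ, h2, h1⟩
  choose ρ h1 h2 using this
  -- The value `R / 2` enters the maximum so that the uniform constant of `exists_sobolev_const` is
  -- available on the smaller cube.
  have hne : (insert (R / 2) (Finset.univ.image ρ)).Nonempty := ⟨_, Finset.mem_insert_self _ _⟩
  refine ⟨(insert (R / 2) (Finset.univ.image ρ)).max' hne,
    Finset.le_max' _ _ (Finset.mem_insert_self _ _), ?_, fun i => ?_⟩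
  · rw [Finset.max'_lt_iff]
    intro y hy
    rw [Finset.mem_insert, Finset.mem_image] at hy
    rcases hy with rfl | ⟨i, -, rfl⟩
    · linarith
    · exact h1 i
  · refine abs_lt.1 ((h2 i).trans_le (Finset.le_max' _ _ ?_))
    exact Finset.mem_insert_of_mem (Finset.mem_image_of_mem _ (Finset.mem_univ i))

theorem IsDerivFamily.of_tendsto {U : Set (Pt d)} (hU : IsOpen U) {k : ℕ}
    {u : ℕ → (Fin d → ℕ) → Pt d → ℝ} {w : (Fin d → ℕ) → Pt d → ℝ} {N : ℕ}
    (h : ∀ m ≥ N, IsDerivFamily U k (u m))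
    (hu : ∀ α, order α ≤ k → TendstoUniformlyOn (fun m => u m α) (w α) atTop U) :
    IsDerivFamily U k w := by
  intro α hα x hx
  have hsh : ∀ β, order β ≤ k → TendstoUniformlyOn (fun m => u (m + N) β) (w β) atTop U :=
    fun β hβ s hs => (tendsto_add_atTop_nat N).eventually (hu β hβ s hs)
  refine hasFDerivAt_of_tendstoUniformlyOn hU (f := fun m => u (m + N) α)
    (f' := fun m x => ∑ i, u (m + N) (α + Pi.single i 1) x •
      (ContinuousLinearMap.proj i : Pt d →L[ℝ] ℝ))
    (g' := fun x => ∑ i, w (α + Pi.single i 1) x • (ContinuousLinearMap.proj i : Pt d →L[ℝ] ℝ))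
    ?_ (fun m y hy => h (m + N) (by omega) α hα y hy)
    (fun y hy => (hsh α hα.le).tendsto_at hy) hx
  rw [Metric.tendstoUniformlyOn_iff]
  intro ε hε
  -- Division by `d + 1` gives a strict inequality after summing `d` terms and also covers `d = 0`.
  have hev : ∀ i, ∀ᶠ m in atTop, ∀ y ∈ U,
      dist (w (α + Pi.single i 1) y) (u (m + N) (α + Pi.single i 1) y) < ε / (d + 1) :=
    fun i => Metric.tendstoUniformlyOn_iff.1
      (hsh (α + Pi.single i 1) (by rw [order_add, order_single]; omega)) _ (by positivity)
  filter_upwards [eventually_all.2 hev] with m hm y hy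
  rw [dist_eq_norm, ← Finset.sum_sub_distrib]
  calc _ ≤ ∑ _i : Fin d, ε / (d + 1) := by
        refine (norm_sum_le _ _).trans (Finset.sum_le_sum fun i _ => ?_)
        rw [← sub_smul, norm_smul, ← dist_eq_norm]
        calc _ ≤ dist (w (α + Pi.single i 1) y) (u (m + N) (α + Pi.single i 1) y) * 1 := by
              gcongr
              refine ContinuousLinearMap.opNorm_le_bound _ zero_le_one fun z => ?_
              rw [one_mul]; exact norm_le_pi_norm z i
          _ ≤ _ := by rw [mul_one]; exact (hm i y hy).le
    _ = d * (ε / (d + 1)) := by simp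
    _ < ε := by
      rw [mul_div_assoc', div_lt_iff₀ (by positivity)]
      nlinarith

/-- Elements of `H^p` of a cube have a representative of class `C²`, with bounded derivatives. -/
theorem exists_C2_rep {R : ℝ} (hR : 0 < R) {k p : ℕ} (hk : d + 1 ≤ 2 * k) (hp : k + 2 ≤ p) :
    ∃ C : ℝ, 0 < C ∧ ∀ u, MemH (cube d R) p u → ∃ w : (Fin d → ℕ) → Pt d → ℝ,
      (∀ α, order α ≤ 2 → ContinuousOn (w α) (cube d R)) ∧
      (∀ α, order α ≤ 2 → w α =ᵐ[volume.restrict (cube d R)] weakDeriv (cube d R) α u) ∧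
      (∀ α, order α ≤ 2 → ∀ x ∈ cube d R, |w α x| ≤ C * sobNorm (cube d R) p u) ∧
      IsDerivFamily (cube d R) 2 w := by
  obtain ⟨C, hC, hsob⟩ := exists_sobolev_const (d := d) hR hk hp
  refine ⟨C, hC, fun u hu => ?_⟩
  have hΩ := isOpen_cube d R
  obtain ⟨f, hfm, hfL, hfe, hfn⟩ := hu.exists_globalDerivs hΩ
  have hfl : ∀ α, LocallyIntegrable (f α) volume := fun α => (hfL α).locallyIntegrable (by norm_num)
  set U : ℕ → (Fin d → ℕ) → Pt d → ℝ := fun m α => moll m (f α) with hU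
  have hUc : ∀ m α, Continuous (U m α) := fun m α => continuous_moll m (hfl α)
  have hUd : ∀ ρ < R, ∃ N, ∀ m ≥ N, IsDerivFamily (cube d ρ) p (U m) := by
    intro ρ hρ
    obtain ⟨N, hN⟩ := exists_nat_one_div_lt (sub_pos.2 hρ)
    refine ⟨N, fun m hm α hα x hx => ?_⟩
    refine hasFDerivAt_moll (Ω := cube d R) (closedBall_subset_cube ?_ hx) (hfl α)
      (fun i φ hφ => ?_)
    · have : (1 : ℝ) / (m + 1) ≤ 1 / (N + 1) := by gcongr
      linarith
    · have := hu.integral_weakDeriv_mul_pderiv hα i hφ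
      have h1 : (fun x => f α x * pderiv i φ x) =ᵐ[volume.restrict (cube d R)]
          fun x => weakDeriv (cube d R) α u x * pderiv i φ x := by
        filter_upwards [hfe α hα.le] with x hx
        rw [hx]
      have h2 : (fun x => f (α + Pi.single i 1) x * φ x) =ᵐ[volume.restrict (cube d R)]
          fun x => weakDeriv (cube d R) (α + Pi.single i 1) u x * φ x := by
        filter_upwards [hfe (α + Pi.single i 1) (by rw [order_add, order_single]; omega)] with x hx
        rw [hx]
      rw [integral_congr_ae h1, integral_congr_ae h2, this]
  have hUL : ∀ ε > 0, ∀ᶠ m in atTop, ∀ α ∈ multiIndices d p,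
      eLpNorm (U m α - f α) 2 volume ≤ ENNReal.ofReal ε := by
    intro ε hε
    rw [Filter.eventually_all_finset]
    intro α _
    exact (tendsto_order.1 (tendsto_eLpNorm_moll_sub (hfL α) (hfm α))).2 _
      (ENNReal.ofReal_pos.2 hε) |>.mono fun _ h => h.le
  -- The Sobolev inequality is applied to the difference of two mollified families: Cauchy in `L²`
  -- for all orders up to `p` becomes uniformly Cauchy for orders up to two.
  have hdiff : ∀ α, order α ≤ 2 → ∀ ρ, R / 2 ≤ ρ → ρ < R →
      UniformCauchySeqOn (fun m => U m α) atTop (cube d ρ) := by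
    intro α hα ρ hρ1 hρ2
    rw [Metric.uniformCauchySeqOn_iff]
    intro ε hε
    obtain ⟨N1, hN1⟩ := hUd ρ hρ2
    obtain ⟨N2, hN2⟩ := eventually_atTop.1 (hUL (ε / (4 * C)) (by positivity))
    refine ⟨max N1 N2, fun m hm m' hm' x hx => ?_⟩
    have := hsob ρ hρ1 hρ2 (fun β => U m β - U m' β) (fun β => (hUc m β).sub (hUc m' β))
      ((hN1 m (le_of_max_le_left hm)).sub (hN1 m' (le_of_max_le_left hm'))) (ε / (2 * C))
      (by positivity) (fun β hβ => ?_) α hα x hx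
    · rw [Real.dist_eq]
      refine lt_of_le_of_lt this ?_
      rw [show C * (ε / (2 * C)) = ε / 2 by field_simp]
      linarith
    · have e : U m β - U m' β = (U m β - f β) - (U m' β - f β) := by abel
      rw [e]
      refine (eLpNorm_sub_le ((hUc m β).aestronglyMeasurable.sub (hfm β).aestronglyMeasurable)
        ((hUc m' β).aestronglyMeasurable.sub (hfm β).aestronglyMeasurable) (by norm_num)).trans ?_
      rw [show ε / (2 * C) = ε / (4 * C) + ε / (4 * C) by field_simp; norm_num,
        ENNReal.ofReal_add (by positivity) (by positivity)]
      exact add_le_add (hN2 m (le_of_max_le_right hm) β (mem_multiIndices.2 hβ))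
        (hN2 m' (le_of_max_le_right hm') β (mem_multiIndices.2 hβ))
  set w : (Fin d → ℕ) → Pt d → ℝ := fun α x => limUnder atTop fun m => U m α x with hw
  have hlim : ∀ α, order α ≤ 2 → ∀ x ∈ cube d R,
      Tendsto (fun m => U m α x) atTop (𝓝 (w α x)) := by
    intro α hα x hx
    obtain ⟨ρ, hρ1, hρ2, hxρ⟩ := exists_mem_smaller_cube hR hx
    have hc := (hdiff α hα ρ hρ1 hρ2).cauchySeq hxρ
    exact tendsto_nhds_limUnder (cauchySeq_tendsto_of_complete hc)
  have hunif : ∀ α, order α ≤ 2 → ∀ ρ, R / 2 ≤ ρ → ρ < R →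
      TendstoUniformlyOn (fun m => U m α) (w α) atTop (cube d ρ) := fun α hα ρ hρ1 hρ2 =>
    (hdiff α hα ρ hρ1 hρ2).tendstoUniformlyOn_of_tendsto
      fun x hx => hlim α hα x (cube_mono hρ2.le hx)
  refine ⟨w, fun α hα => ?_, fun α hα => ?_, fun α hα x hx => ?_, fun α hα x hx => ?_⟩
  · intro x hx
    obtain ⟨ρ, hρ1, hρ2, hxρ⟩ := exists_mem_smaller_cube hR hx
    have := (hunif α hα ρ hρ1 hρ2).continuousOn
      (Frequently.of_forall fun m => (hUc m α).continuousOn)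
    exact (this.continuousAt ((isOpen_cube d ρ).mem_nhds hxρ)).continuousWithinAt
  -- The `L²` limit is also an almost everywhere limit along a subsequence, which identifies the
  -- uniform limit with the weak derivative.
  · have ht := tendstoInMeasure_of_tendsto_eLpNorm (p := 2) (by norm_num)
      (fun m => (hUc m α).aestronglyMeasurable) (hfm α).aestronglyMeasurable
      (tendsto_eLpNorm_moll_sub (hfL α) (hfm α))
    obtain ⟨ns, hns, hae⟩ := ht.exists_seq_tendsto_ae
    have h1 : ∀ᵐ x ∂volume.restrict (cube d R), w α x = f α x := by
      refine (ae_restrict_iff' hΩ.measurableSet).2 ?_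
      filter_upwards [hae] with x hx hxR
      exact tendsto_nhds_unique ((hlim α hα x hxR).comp hns.tendsto_atTop) hx
    exact EventuallyEq.trans h1 (hfe α (hα.trans (by omega)))
  · refine le_of_forall_pos_le_add fun ε hε => ?_
    obtain ⟨ρ, hρ1, hρ2, hxρ⟩ := exists_mem_smaller_cube hR hx
    obtain ⟨N1, hN1⟩ := hUd ρ hρ2
    refine le_of_tendsto (hlim α hα x hx).abs ?_
    filter_upwards [eventually_ge_atTop N1, hUL (ε / C) (by positivity)] with m hm1 hm2
    -- The `L²` norms of the mollifications exceed the Sobolev norm by at most `ε / C`, and `ε` is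
    -- arbitrary, so the bound survives with the constant `C` itself.
    have := hsob ρ hρ1 hρ2 (U m) (hUc m) (hN1 m hm1) (sobNorm (cube d R) p u + ε / C)
      (add_nonneg (sobNorm_nonneg _ _ _) (by positivity)) (fun β hβ => ?_) α hα x hxρ
    · rwa [mul_add, mul_div_cancel₀ _ hC.ne'] at this
    · rw [show U m β = f β + (U m β - f β) by abel,
        ENNReal.ofReal_add (sobNorm_nonneg _ _ _) (by positivity)]
      exact (eLpNorm_add_le (hfm β).aestronglyMeasurable
        ((hUc m β).aestronglyMeasurable.sub (hfm β).aestronglyMeasurable) (by norm_num)).trans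
        (add_le_add (hfn β hβ) (hm2 β (mem_multiIndices.2 hβ)))
  · obtain ⟨ρ, hρ1, hρ2, hxρ⟩ := exists_mem_smaller_cube hR hx
    obtain ⟨N1, hN1⟩ := hUd ρ hρ2
    exact IsDerivFamily.of_tendsto (isOpen_cube d ρ)
      (fun m hm => (hN1 m hm).mono subset_rfl (by omega))
      (fun β hβ => hunif β hβ ρ hρ1 hρ2) α hα x hxρ

end Regularity

/-! ### Gradients in coordinates, bounded continuous functions, the closed cube -/

section Calculus

variable {d : ℕ}

/-- The linear form with the given coefficients. -/
def linForm (a : Fin d → ℝ) : Pt d →L[ℝ] ℝ :=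
  ∑ i, a i • (ContinuousLinearMap.proj i : Pt d →L[ℝ] ℝ)

theorem linForm_apply (a : Fin d → ℝ) (q : Pt d) : linForm a q = ∑ i, a i * q i := by
  simp [linForm]

theorem linForm_single (a : Fin d → ℝ) (i : Fin d) : linForm a (Pi.single i 1) = a i := by
  simp [linForm_apply, Pi.single_apply]

theorem clm_eq_linForm {L : Pt d →L[ℝ] ℝ} {a : Fin d → ℝ} (h : ∀ i, L (Pi.single i 1) = a i) :
    L = linForm a := by
  refine ContinuousLinearMap.coe_injective (LinearMap.pi_ext' fun i => LinearMap.ext_ring ?_)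
  simp [linForm_single, h]

/-- `f` has gradient `a` at `x`. -/
def HasGrad (f : Pt d → ℝ) (a : Fin d → ℝ) (x : Pt d) : Prop := HasFDerivAt f (linForm a) x

theorem HasGrad.mul {f g : Pt d → ℝ} {a b : Fin d → ℝ} {x : Pt d} (hf : HasGrad f a x)
    (hg : HasGrad g b x) : HasGrad (fun y => f y * g y) (fun i => f x * b i + a i * g x) x := by
  refine (HasFDerivAt.mul hf hg).congr_fderiv (clm_eq_linForm fun i => ?_)
  simp [linForm_single]; ring

theorem HasGrad.add {f g : Pt d → ℝ} {a b : Fin d → ℝ} {x : Pt d} (hf : HasGrad f a x)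
    (hg : HasGrad g b x) : HasGrad (fun y => f y + g y) (fun i => a i + b i) x := by
  refine (HasFDerivAt.add hf hg).congr_fderiv (clm_eq_linForm fun i => ?_)
  simp [linForm_single]

theorem HasGrad.const_mul {f : Pt d → ℝ} {a : Fin d → ℝ} {x : Pt d} (c : ℝ)
    (hf : HasGrad f a x) : HasGrad (fun y => c * f y) (fun i => c * a i) x := by
  refine (HasFDerivAt.const_mul hf c).congr_fderiv (clm_eq_linForm fun i => ?_)
  simp [linForm_single]

theorem HasGrad.sum {ι : Type*} {s : Finset ι} {f : ι → Pt d → ℝ} {a : ι → Fin d → ℝ} {x : Pt d}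
    (hf : ∀ j ∈ s, HasGrad (f j) (a j) x) :
    HasGrad (fun y => ∑ j ∈ s, f j y) (fun i => ∑ j ∈ s, a j i) x := by
  have : HasFDerivAt (fun y => ∑ j ∈ s, f j y) (∑ j ∈ s, linForm (a j)) x :=
    HasFDerivAt.fun_sum hf
  refine this.congr_fderiv (clm_eq_linForm fun i => ?_)
  simp [linForm_single]

theorem HasGrad.comp_coord {φ : ℝ → ℝ} {φ' : ℝ} {x : Pt d} (i : Fin d)
    (h : HasDerivAt φ φ' (x i)) : HasGrad (fun y => φ (y i)) (Pi.single i φ') x := by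
  have h1 : HasFDerivAt (fun y : Pt d => y i) (ContinuousLinearMap.proj i : Pt d →L[ℝ] ℝ) x :=
    (ContinuousLinearMap.proj i : Pt d →L[ℝ] ℝ).hasFDerivAt
  refine (h.comp_hasFDerivAt x h1).congr_fderiv (clm_eq_linForm fun j => ?_)
  by_cases hj : j = i
  · subst hj; simp
  · simp [hj, Ne.symm hj]

theorem IsDerivFamily.hasGrad {U : Set (Pt d)} {k : ℕ} {w : (Fin d → ℕ) → Pt d → ℝ}
    (h : IsDerivFamily U k w) {α : Fin d → ℕ} (hα : order α < k) {x : Pt d} (hx : x ∈ U) :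
    HasGrad (w α) (fun i => w (α + Pi.single i 1) x) x :=
  h α hα x hx

/-- Continuous and bounded on a set. -/
def BddContOn (U : Set (Pt d)) (f : Pt d → ℝ) : Prop :=
  ContinuousOn f U ∧ ∃ K, ∀ x ∈ U, |f x| ≤ K

namespace BddContOn

variable {U : Set (Pt d)} {f g : Pt d → ℝ}

theorem add (hf : BddContOn U f) (hg : BddContOn U g) : BddContOn U fun x => f x + g x := by
  obtain ⟨K, hK⟩ := hf.2
  obtain ⟨L, hL⟩ := hg.2
  exact ⟨hf.1.add hg.1, K + L, fun x hx => (abs_add_le _ _).trans (add_le_add (hK x hx) (hL x hx))⟩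

theorem mul (hf : BddContOn U f) (hg : BddContOn U g) : BddContOn U fun x => f x * g x := by
  obtain ⟨K, hK⟩ := hf.2
  obtain ⟨L, hL⟩ := hg.2
  refine ⟨hf.1.mul hg.1, K * L, fun x hx => ?_⟩
  rw [abs_mul]
  exact mul_le_mul (hK x hx) (hL x hx) (abs_nonneg _) ((abs_nonneg _).trans (hK x hx))

theorem const (c : ℝ) : BddContOn U fun _ => c := ⟨continuousOn_const, |c|, fun _ _ => le_rfl⟩

theorem neg (hf : BddContOn U f) : BddContOn U fun x => - f x := by
  simpa using (const (-1)).mul hf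

theorem sub (hf : BddContOn U f) (hg : BddContOn U g) : BddContOn U fun x => f x - g x := by
  simpa [sub_eq_add_neg] using hf.add hg.neg

theorem sq (hf : BddContOn U f) : BddContOn U fun x => f x ^ 2 := by
  simpa [pow_two] using hf.mul hf

theorem sum {ι : Type*} {s : Finset ι} {f : ι → Pt d → ℝ} (hf : ∀ i ∈ s, BddContOn U (f i)) :
    BddContOn U fun x => ∑ i ∈ s, f i x := by
  classical
  induction s using Finset.induction_on with
  | empty => simpa using const 0
  | insert i s hi ih =>
    simp only [Finset.sum_insert hi]
    exact (hf i (Finset.mem_insert_self _ _)).add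
      (ih fun j hj => hf j (Finset.mem_insert_of_mem hj))

theorem of_isCompact {V : Set (Pt d)} (hV : IsCompact V) (hUV : U ⊆ V) (hf : ContinuousOn f V) :
    BddContOn U f := by
  obtain ⟨K, hK⟩ := hV.exists_bound_of_continuousOn hf
  exact ⟨hf.mono hUV, K, fun x hx => hK x (hUV hx)⟩

theorem integrableOn (hf : BddContOn U f) (hU : MeasurableSet U) (hUv : volume U ≠ ⊤) :
    IntegrableOn f U := by
  obtain ⟨K, hK⟩ := hf.2
  have : IsFiniteMeasure (volume.restrict U) := ⟨by simpa using hUv.lt_top⟩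
  refine Integrable.of_bound (hf.1.aestronglyMeasurable hU) K ?_
  exact (ae_restrict_iff' hU).2 (Eventually.of_forall hK)

end BddContOn

theorem volume_cube_ne_top (R : ℝ) : volume (cube d R) ≠ ⊤ := by
  rw [volume_cube]; exact ENNReal.pow_ne_top ENNReal.ofReal_ne_top

/-- The closed cube. -/
def closedCube (d : ℕ) (R : ℝ) : Set (Pt d) := Set.Icc (fun _ => -R) (fun _ => R)

theorem mem_closedCube {R : ℝ} {x : Pt d} : x ∈ closedCube d R ↔ ∀ i, -R ≤ x i ∧ x i ≤ R := by
  simp [closedCube, Set.mem_Icc, Pi.le_def, forall_and]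

theorem cube_eq_pi (d : ℕ) (R : ℝ) : cube d R = Set.univ.pi fun _ => Set.Ioo (-R) R := by
  ext x; simp [cube]

theorem closure_cube {R : ℝ} (hR : 0 < R) : closure (cube d R) = closedCube d R := by
  rw [cube_eq_pi, closure_pi_set, closedCube, ← Set.pi_univ_Icc]
  congr 1
  funext i
  exact closure_Ioo (by linarith)

theorem isCompact_closedCube (d : ℕ) (R : ℝ) : IsCompact (closedCube d R) := isCompact_Icc

theorem cube_subset_closedCube (d : ℕ) (R : ℝ) : cube d R ⊆ closedCube d R :=
  fun _ hx => mem_closedCube.2 fun i => ⟨(hx i).1.le, (hx i).2.le⟩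

theorem cube_ae_eq_closedCube (d : ℕ) (R : ℝ) : cube d R =ᵐ[volume] closedCube d R := by
  rw [cube_eq_pi]
  exact Measure.univ_pi_Ioo_ae_eq_Icc

theorem mem_frontier_cube {R : ℝ} (hR : 0 < R) {x : Pt d} (hx : x ∈ closedCube d R) {j : Fin d}
    (hj : x j = R ∨ x j = -R) : x ∈ frontier (cube d R) := by
  rw [frontier, closure_cube hR, (isOpen_cube d R).interior_eq]
  refine ⟨hx, fun h => ?_⟩
  have := h j
  rcases hj with hj | hj <;> linarith

end Calculus

/-! ### The integral identity behind the Carleman estimate -/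

section Carleman

variable {n : ℕ} {R : ℝ}

/-- The right integrand minus the left one is the divergence of `V`, so the claim is that the total
flux of `V` is nonnegative. The multiplier `-2 φ₁ v_z - φ₂ v`, the antisymmetric part of the
conjugated Laplacian, would give no `|∇v|²` term; doubling the coefficient of `φ₂ v` yields `φ₂
|∇v|²` and still leaves `φ₁² φ₂ v²` with a positive sign. The second derivatives need only be
bounded in the open cube, since `V` contains at most first derivatives. -/
theorem carleman_identity (hR : 0 < R) {v : Pt (n + 1) → ℝ}
    {v₁ : Fin (n + 1) → Pt (n + 1) → ℝ} {v₂ : Fin (n + 1) → Fin (n + 1) → Pt (n + 1) → ℝ}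
    {φ₁ φ₂ φ₃ φ₄ : ℝ → ℝ}
    (hv : ContinuousOn v (closedCube (n + 1) R))
    (hv₁ : ∀ i, ContinuousOn (v₁ i) (closedCube (n + 1) R))
    (hv₂ : ∀ i j, BddContOn (cube (n + 1) R) (v₂ i j))
    (hsymm : ∀ i j, v₂ i j = v₂ j i)
    (hdv : ∀ x ∈ cube (n + 1) R, HasGrad v (fun i => v₁ i x) x)
    (hdv₁ : ∀ i, ∀ x ∈ cube (n + 1) R, HasGrad (v₁ i) (fun j => v₂ i j x) x)
    (hφ₁ : ContinuousOn φ₁ (Set.Icc (-R) R)) (hφ₂ : ContinuousOn φ₂ (Set.Icc (-R) R))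
    (hφ₃ : ContinuousOn φ₃ (Set.Icc (-R) R)) (hφ₄ : ContinuousOn φ₄ (Set.Icc (-R) R))
    (hd₁ : ∀ z ∈ Set.Ioo (-R) R, HasDerivAt φ₁ (φ₂ z) z)
    (hd₂ : ∀ z ∈ Set.Ioo (-R) R, HasDerivAt φ₂ (φ₃ z) z)
    (hd₃ : ∀ z ∈ Set.Ioo (-R) R, HasDerivAt φ₃ (φ₄ z) z)
    (hpos : 0 ≤ φ₁ (-R))
    (hb : ∀ x ∈ closedCube (n + 1) R, ∀ j, (x j = R ∨ x j = -R) → v x = 0)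
    (hb₁ : ∀ x ∈ closedCube (n + 1) R, ∀ i j, i ≠ j → (x j = R ∨ x j = -R) → v₁ i x = 0)
    (htop : ∀ x ∈ closedCube (n + 1) R, zc x = R → v₁ (Fin.last n) x = 0) :
    ∫ x in cube (n + 1) R, (2 * φ₂ (zc x) * v₁ (Fin.last n) x ^ 2
        + φ₂ (zc x) * ∑ i, v₁ i x ^ 2
        + (φ₁ (zc x) ^ 2 * φ₂ (zc x) - φ₄ (zc x)) * v x ^ 2) ≤
      ∫ x in cube (n + 1) R, (∑ i, v₂ i i x + φ₁ (zc x) ^ 2 * v x)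
        * (-2 * φ₁ (zc x) * v₁ (Fin.last n) x - 2 * φ₂ (zc x) * v x) := by
  set Q := cube (n + 1) R
  set z := Fin.last n
  have hmz : Set.MapsTo (fun x : Pt (n + 1) => x z) (closedCube (n + 1) R) (Set.Icc (-R) R) :=
    fun x hx => mem_closedCube.1 hx z
  have hzc : ContinuousOn (fun x : Pt (n + 1) => x z) (closedCube (n + 1) R) := by fun_prop
  have c₁ := hφ₁.comp hzc hmz
  have c₂ := hφ₂.comp hzc hmz
  have c₃ := hφ₃.comp hzc hmz
  have c₄ := hφ₄.comp hzc hmz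
  -- the field whose divergence is integrated
  set E : Pt (n + 1) → ℝ := fun x => φ₁ (x z) * v₁ z x + φ₂ (x z) * v x with hE
  set G : Pt (n + 1) → ℝ := fun x => φ₁ (x z) * ∑ j, v₁ j x * v₁ j x
    + (-1 * (φ₁ (x z) * (φ₁ (x z) * φ₁ (x z))) + φ₃ (x z)) * (v x * v x) with hG
  set V : Fin (n + 1) → Pt (n + 1) → ℝ := fun i x => -2 * (E x * v₁ i x)
    + (Pi.single z 1 : Fin (n + 1) → ℝ) i * G x with hV
  have hEc : ContinuousOn E (closedCube (n + 1) R) := (c₁.mul (hv₁ z)).add (c₂.mul hv)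
  have hGc : ContinuousOn G (closedCube (n + 1) R) := by
    refine (c₁.mul (continuousOn_finsetSum _ fun j _ => (hv₁ j).mul (hv₁ j))).add
      (((continuousOn_const.mul (c₁.mul (c₁.mul c₁))).add c₃).mul (hv.mul hv))
  have hVc : ∀ i, ContinuousOn (V i) (closedCube (n + 1) R) := fun i =>
    (continuousOn_const.mul (hEc.mul (hv₁ i))).add (continuousOn_const.mul hGc)
  have hgrad : ∀ x ∈ Q, ∃ a : Fin (n + 1) → Fin (n + 1) → ℝ, (∀ i, HasGrad (V i) (a i) x) ∧
      ∑ i, a i i = (∑ i, v₂ i i x + φ₁ (x z) ^ 2 * v x)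
        * (-2 * φ₁ (x z) * v₁ z x - 2 * φ₂ (x z) * v x)
        - (2 * φ₂ (x z) * v₁ z x ^ 2 + φ₂ (x z) * ∑ i, v₁ i x ^ 2
          + (φ₁ (x z) ^ 2 * φ₂ (x z) - φ₄ (x z)) * v x ^ 2) := by
    intro x hx
    have g₁ := HasGrad.comp_coord z (hd₁ (x z) (hx z))
    have g₂ := HasGrad.comp_coord z (hd₂ (x z) (hx z))
    have g₃ := HasGrad.comp_coord z (hd₃ (x z) (hx z))
    have gE := (g₁.mul (hdv₁ z x hx)).add (g₂.mul (hdv x hx))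
    have gG := (g₁.mul (HasGrad.sum (s := Finset.univ) fun j _ =>
      (hdv₁ j x hx).mul (hdv₁ j x hx))).add
      ((((g₁.mul (g₁.mul g₁)).const_mul (-1)).add g₃).mul ((hdv x hx).mul (hdv x hx)))
    refine ⟨_, fun i => ((gE.mul (hdv₁ i x hx)).const_mul (-2)).add
      (gG.const_mul ((Pi.single z 1 : Fin (n + 1) → ℝ) i)), ?_⟩
    simp only [Finset.sum_add_distrib, ← Finset.mul_sum]
    have s1 : ∀ t : Fin (n + 1) → ℝ, ∑ i, (Pi.single z 1 : Fin (n + 1) → ℝ) i * t i = t z := by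
      intro t; simp [Pi.single_apply]
    have s2 : ∀ (c : ℝ) (t : Fin (n + 1) → ℝ),
        ∑ i, (Pi.single z c : Fin (n + 1) → ℝ) i * t i = c * t z := by
      intro c t; simp [Pi.single_apply]
    rw [s1]
    simp only [Pi.single_eq_same, add_mul, mul_assoc, Finset.sum_add_distrib, ← Finset.mul_sum, s2]
    -- Symmetry of the Hessian matches the derivative of `φ₁ |∇v|²` in `z` with the derivative of
    -- `v_z` along the gradient.
    have e1 : ∑ i, v₁ i x * v₂ i z x = ∑ i, v₂ z i x * v₁ i x :=
      Finset.sum_congr rfl fun i _ => by rw [hsymm i z, mul_comm]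
    have e2 : ∑ i, v₂ i z x * v₁ i x = ∑ i, v₂ z i x * v₁ i x :=
      Finset.sum_congr rfl fun i _ => by rw [hsymm i z]
    rw [e1, e2]
    simp only [pow_two]
    ring
  choose! a ha hdiv using hgrad
  have hint1 : IntegrableOn (fun x => (∑ i, v₂ i i x + φ₁ (x z) ^ 2 * v x)
        * (-2 * φ₁ (x z) * v₁ z x - 2 * φ₂ (x z) * v x)) Q := by
    have k1 := BddContOn.of_isCompact (isCompact_closedCube _ _) (cube_subset_closedCube _ R) c₁
    have k2 := BddContOn.of_isCompact (isCompact_closedCube _ _) (cube_subset_closedCube _ R) c₂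
    have k3 := BddContOn.of_isCompact (isCompact_closedCube _ _) (cube_subset_closedCube _ R) hv
    have k4 := BddContOn.of_isCompact (isCompact_closedCube _ _) (cube_subset_closedCube _ R)
      (hv₁ z)
    exact (((BddContOn.sum (s := Finset.univ) fun i _ => hv₂ i i).add (k1.sq.mul k3)).mul
      ((((BddContOn.const (-2)).mul k1).mul k4).sub (((BddContOn.const 2).mul k2).mul k3))).integrableOn
      (isOpen_cube _ _).measurableSet (volume_cube_ne_top R)
  have hint2 : IntegrableOn (fun x => 2 * φ₂ (x z) * v₁ z x ^ 2 + φ₂ (x z) * ∑ i, v₁ i x ^ 2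
          + (φ₁ (x z) ^ 2 * φ₂ (x z) - φ₄ (x z)) * v x ^ 2) Q := by
    refine ContinuousOn.integrableOn_compact (isCompact_closedCube _ R) ?_ |>.mono_set
      (cube_subset_closedCube _ R)
    exact (((continuousOn_const.mul c₂).mul ((hv₁ z).pow 2)).add
      (c₂.mul (continuousOn_finsetSum _ fun i _ => (hv₁ i).pow 2))).add
      ((((c₁.pow 2).mul c₂).sub c₄).mul (hv.pow 2))
  have hlin : ∀ (x : Pt (n + 1)) (i : Fin (n + 1)), linForm (a x i) (Pi.single i 1) = a x i i :=
    fun x i => linForm_single _ _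
  have hdivint : IntegrableOn (fun x => ∑ i, linForm (a x i) (Pi.single i 1)) Q := by
    simp only [hlin]
    refine (hint1.sub hint2).congr_fun (fun x hx => ?_) (isOpen_cube _ _).measurableSet
    exact (hdiv x hx).symm
  have hthm := integral_divergence_of_hasFDerivAt_off_countable' (fun _ : Fin (n + 1) => -R)
    (fun _ => R) (fun _ => by linarith) V (fun i x => linForm (a x i)) ∅ Set.countable_empty hVc
    (fun x hx i => ha x (by rw [Set.sdiff_empty, ← cube_eq_pi] at hx; exact hx) i)
    (hdivint.congr_set_ae (cube_ae_eq_closedCube _ _).symm)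
  -- On lateral faces `v` and `v_z` vanish, on the top face the whole gradient does. On the bottom
  -- face only `v_z` survives, `V z = -φ₁ v_z²`, and the outward normal reverses its sign.
  have hface : ∀ i : Fin (n + 1), 0 ≤
      (∫ x in Set.Icc ((fun _ : Fin (n + 1) => -R) ∘ i.succAbove) ((fun _ => R) ∘ i.succAbove),
        V i (i.insertNth R x)) -
      ∫ x in Set.Icc ((fun _ : Fin (n + 1) => -R) ∘ i.succAbove) ((fun _ => R) ∘ i.succAbove),
        V i (i.insertNth (-R) x) := by
    intro i
    have hmem : ∀ c : ℝ, -R ≤ c → c ≤ R → ∀ x ∈ Set.Icc ((fun _ : Fin (n + 1) => -R) ∘ i.succAbove)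
        ((fun _ => R) ∘ i.succAbove), (i.insertNth c x : Pt (n + 1)) ∈ closedCube (n + 1) R := by
      intro c hc1 hc2 x hx
      refine mem_closedCube.2 fun j => ?_
      rcases Fin.eq_self_or_eq_succAbove i j with rfl | ⟨k, rfl⟩
      · simpa using ⟨hc1, hc2⟩
      · simpa using ⟨hx.1 k, hx.2 k⟩
    have hzero : ∀ y ∈ closedCube (n + 1) R, (y i = R ∨ y i = -R) → i ≠ z → V i y = 0 := by
      intro y hy hyi hiz
      have e1 : E y = 0 := by
        simp only [hE]
        rw [hb y hy i hyi, hb₁ y hy z i (Ne.symm hiz) hyi]; ring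
      simp [hV, e1, hiz]
    have hfront : ∫ x in Set.Icc ((fun _ : Fin (n + 1) => -R) ∘ i.succAbove)
        ((fun _ => R) ∘ i.succAbove), V i (i.insertNth R x) = 0 := by
      refine setIntegral_eq_zero_of_forall_eq_zero fun x hx => ?_
      have hy := hmem R (by linarith) le_rfl x hx
      have hyi : (i.insertNth R x : Pt (n + 1)) i = R := by simp
      generalize (i.insertNth R x : Pt (n + 1)) = y at hy hyi
      by_cases hiz : i = z
      · have e0 : ∀ j, v₁ j y = 0 := by
          intro j
          by_cases hj : j = z
          · rw [hj]; exact htop y hy (by rw [← hyi, hiz]; rfl)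
          · exact hb₁ y hy j i (by rw [hiz]; exact hj) (Or.inl hyi)
        simp [hV, hE, hG, e0, hb y hy i (Or.inl hyi)]
      · exact hzero y hy (Or.inl hyi) hiz
    have hback : ∫ x in Set.Icc ((fun _ : Fin (n + 1) => -R) ∘ i.succAbove)
        ((fun _ => R) ∘ i.succAbove), V i (i.insertNth (-R) x) ≤ 0 := by
      refine setIntegral_nonpos measurableSet_Icc fun x hx => ?_
      have hy := hmem (-R) le_rfl (by linarith) x hx
      have hyi : (i.insertNth (-R) x : Pt (n + 1)) i = -R := by simp
      generalize (i.insertNth (-R) x : Pt (n + 1)) = y at hy hyi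
      by_cases hiz : i = z
      · have e0 : ∀ j, j ≠ z → v₁ j y = 0 := fun j hj =>
          hb₁ y hy j i (by rw [hiz]; exact hj) (Or.inr hyi)
        have e1 : ∑ j, v₁ j y * v₁ j y = v₁ z y * v₁ z y :=
          Finset.sum_eq_single z (fun j _ hj => by rw [e0 j hj, mul_zero]) (by simp)
        have e2 := hb y hy i (Or.inr hyi)
        rw [hiz] at hyi ⊢
        simp only [hV, hE, hG, e1, e2, hyi, Pi.single_eq_same]
        nlinarith [mul_nonneg hpos (mul_self_nonneg (v₁ z y))]
      · exact (hzero y hy (Or.inr hyi) hiz).le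
    linarith
  have hdiv0 : 0 ≤ ∫ x in Q, ∑ i, linForm (a x i) (Pi.single i 1) := by
    rw [setIntegral_congr_set (cube_ae_eq_closedCube _ _)]
    rw [closedCube, hthm]
    exact Finset.sum_nonneg fun i _ => hface i
  rw [setIntegral_congr_fun (isOpen_cube _ _).measurableSet
    (g := fun x => (∑ i, v₂ i i x + φ₁ (x z) ^ 2 * v x)
        * (-2 * φ₁ (x z) * v₁ z x - 2 * φ₂ (x z) * v x)
        - (2 * φ₂ (x z) * v₁ z x ^ 2 + φ₂ (x z) * ∑ i, v₁ i x ^ 2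
          + (φ₁ (x z) ^ 2 * φ₂ (x z) - φ₄ (x z)) * v x ^ 2))
    (fun x hx => by simp only [hlin]; exact hdiv x hx), integral_sub hint1 hint2] at hdiv0
  exact sub_nonneg.1 hdiv0

end Carleman

/-! ### The Carleman estimate for the Laplacian -/

section Carleman

variable {n : ℕ} {R : ℝ}

theorem HasGrad.congr {d : ℕ} {f : Pt d → ℝ} {a b : Fin d → ℝ} {x : Pt d} (h : HasGrad f a x)
    (hab : ∀ i, a i = b i) : HasGrad f b x := by
  rwa [← funext hab]

/-- With `X = B + 2D` the left side is `(S + D) X - X²`, at most `(S + D)² / 4`. The extra `D²` is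
the price of the doubled coefficient in the multiplier. -/
theorem carleman_pointwise_upper (S B D : ℝ) :
    (S - B - D) * (B + 2 * D) ≤ 1 / 2 * S ^ 2 + 1 / 2 * D ^ 2 := by
  nlinarith [sq_nonneg (S - (B + 2 * D)), sq_nonneg (B + D)]

/-- Only half of the term `p₂ s'` is used, through `|∇h + p₁ h e_z|² ≥ |∇h|² / 2 - p₁² h²`; hence
the factor `4` in front of `κ` and the `1/2` in front of `p₁² p₂`. The summand `p₂² (e h)² / 2` is
reserved to cancel the `D²` of `carleman_pointwise_upper`. -/
theorem carleman_pointwise_lower {κ e p₁ p₂ p₄ h hz s s' : ℝ} (hp₂ : 4 * κ ≤ p₂)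
    (hκ : 0 ≤ κ) (hp : κ ≤ 1 / 2 * p₁ ^ 2 * p₂ - p₄ - 1 / 2 * p₂ ^ 2)
    (hs' : s' = e ^ 2 * (s + 2 * p₁ * h * hz + p₁ ^ 2 * h ^ 2)) (hs : hz ^ 2 ≤ s) :
    κ * (e ^ 2 * (h ^ 2 + s)) + 1 / 2 * p₂ ^ 2 * (e * h) ^ 2 ≤
      2 * p₂ * (e * (hz + p₁ * h)) ^ 2 + p₂ * s' + (p₁ ^ 2 * p₂ - p₄) * (e * h) ^ 2 := by
  have hp₂0 : 0 ≤ p₂ := by linarith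
  have h1 : 0 ≤ 2 * p₂ * (e * (hz + p₁ * h)) ^ 2 := by positivity
  have h2 : 0 ≤ s + 2 * p₁ * h * hz + p₁ ^ 2 * h ^ 2 := by nlinarith [sq_nonneg (hz + p₁ * h)]
  have h3 : 1 / 2 * s - p₁ ^ 2 * h ^ 2 ≤ s + 2 * p₁ * h * hz + p₁ ^ 2 * h ^ 2 := by
    nlinarith [sq_nonneg (hz + 2 * p₁ * h)]
  have h4 : κ * (h ^ 2 + s) + 1 / 2 * p₂ ^ 2 * h ^ 2 ≤
      p₂ * (s + 2 * p₁ * h * hz + p₁ ^ 2 * h ^ 2) + (p₁ ^ 2 * p₂ - p₄) * h ^ 2 := by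
    have h5 : p₂ * (1 / 2 * s - p₁ ^ 2 * h ^ 2)
        ≤ p₂ * (s + 2 * p₁ * h * hz + p₁ ^ 2 * h ^ 2) := mul_le_mul_of_nonneg_left h3 hp₂0
    have h6 : 0 ≤ p₂ * (s + 2 * p₁ * h * hz + p₁ ^ 2 * h ^ 2) := mul_nonneg hp₂0 h2
    have h7 : κ * h ^ 2 ≤ (1 / 2 * p₁ ^ 2 * p₂ - p₄ - 1 / 2 * p₂ ^ 2) * h ^ 2 :=
      mul_le_mul_of_nonneg_right hp (sq_nonneg h)
    have h8 : 4 * κ * s ≤ p₂ * s := mul_le_mul_of_nonneg_right hp₂ ((sq_nonneg hz).trans hs)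
    nlinarith
  have h9 := mul_le_mul_of_nonneg_left h4 (sq_nonneg e)
  rw [hs']
  nlinarith

/-- The Carleman estimate for the Laplacian, under conditions on the derivatives of the exponent. -/
theorem carleman_estimate_aux (hR : 0 < R) {h : Pt (n + 1) → ℝ}
    {h₁ : Fin (n + 1) → Pt (n + 1) → ℝ} {h₂ : Fin (n + 1) → Fin (n + 1) → Pt (n + 1) → ℝ}
    {φ φ₁ φ₂ φ₃ φ₄ : ℝ → ℝ} {κ : ℝ} (hκ : 0 ≤ κ)
    (hh : ContinuousOn h (closedCube (n + 1) R))
    (hh₁ : ∀ i, ContinuousOn (h₁ i) (closedCube (n + 1) R))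
    (hh₂ : ∀ i j, BddContOn (cube (n + 1) R) (h₂ i j))
    (hsymm : ∀ i j, h₂ i j = h₂ j i)
    (hdh : ∀ x ∈ cube (n + 1) R, HasGrad h (fun i => h₁ i x) x)
    (hdh₁ : ∀ i, ∀ x ∈ cube (n + 1) R, HasGrad (h₁ i) (fun j => h₂ i j x) x)
    (hφ : ContinuousOn φ (Set.Icc (-R) R))
    (hφ₁ : ContinuousOn φ₁ (Set.Icc (-R) R)) (hφ₂ : ContinuousOn φ₂ (Set.Icc (-R) R))
    (hφ₃ : ContinuousOn φ₃ (Set.Icc (-R) R)) (hφ₄ : ContinuousOn φ₄ (Set.Icc (-R) R))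
    (hd : ∀ z ∈ Set.Ioo (-R) R, HasDerivAt φ (φ₁ z) z)
    (hd₁ : ∀ z ∈ Set.Ioo (-R) R, HasDerivAt φ₁ (φ₂ z) z)
    (hd₂ : ∀ z ∈ Set.Ioo (-R) R, HasDerivAt φ₂ (φ₃ z) z)
    (hd₃ : ∀ z ∈ Set.Ioo (-R) R, HasDerivAt φ₃ (φ₄ z) z)
    (hpos : 0 ≤ φ₁ (-R))
    (hκ₂ : ∀ z ∈ Set.Icc (-R) R, 4 * κ ≤ φ₂ z)
    (hκ₄ : ∀ z ∈ Set.Icc (-R) R, κ ≤ 1 / 2 * φ₁ z ^ 2 * φ₂ z - φ₄ z - 1 / 2 * φ₂ z ^ 2)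
    (hb : ∀ x ∈ closedCube (n + 1) R, ∀ j, (x j = R ∨ x j = -R) → h x = 0)
    (hb₁ : ∀ x ∈ closedCube (n + 1) R, ∀ i j, i ≠ j → (x j = R ∨ x j = -R) → h₁ i x = 0)
    (htop : ∀ x ∈ closedCube (n + 1) R, zc x = R → h₁ (Fin.last n) x = 0) :
    κ * ∫ x in cube (n + 1) R, Real.exp (φ (zc x)) ^ 2 * (h x ^ 2 + ∑ i, h₁ i x ^ 2) ≤
      1 / 2 * ∫ x in cube (n + 1) R, Real.exp (φ (zc x)) ^ 2 * (∑ i, h₂ i i x) ^ 2 := by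
  set Q := cube (n + 1) R
  set z := Fin.last n with hz
  have hmz : Set.MapsTo (fun x : Pt (n + 1) => zc x) (closedCube (n + 1) R) (Set.Icc (-R) R) :=
    fun x hx => mem_closedCube.1 hx z
  have hzc : ContinuousOn (fun x : Pt (n + 1) => zc x) (closedCube (n + 1) R) := by
    unfold zc; fun_prop
  have c₁ := hφ₁.comp hzc hmz
  have c₂ := hφ₂.comp hzc hmz
  have c₄ := hφ₄.comp hzc hmz
  have ce := (hφ.comp hzc hmz).rexp
  set δ : Fin (n + 1) → ℝ := Pi.single z 1 with hδ
  set e : Pt (n + 1) → ℝ := fun x => Real.exp (φ (zc x)) with he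
  set v : Pt (n + 1) → ℝ := fun x => e x * h x with hv
  set v₁ : Fin (n + 1) → Pt (n + 1) → ℝ := fun i x => e x * (h₁ i x + δ i * (φ₁ (zc x) * h x))
    with hv₁
  set v₂ : Fin (n + 1) → Fin (n + 1) → Pt (n + 1) → ℝ := fun i j x =>
    e x * (h₂ i j x + (δ i * (φ₁ (zc x) * h₁ j x) + (δ j * (φ₁ (zc x) * h₁ i x)
      + δ i * δ j * ((φ₂ (zc x) + φ₁ (zc x) ^ 2) * h x)))) with hv₂
  have hcv : ContinuousOn v (closedCube (n + 1) R) := ce.mul hh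
  have hcv₁ : ∀ i, ContinuousOn (v₁ i) (closedCube (n + 1) R) := fun i =>
    ce.mul ((hh₁ i).add (continuousOn_const.mul (c₁.mul hh)))
  have bdd : ∀ {f : Pt (n + 1) → ℝ}, ContinuousOn f (closedCube (n + 1) R) → BddContOn Q f :=
    fun hf => BddContOn.of_isCompact (isCompact_closedCube _ _) (cube_subset_closedCube _ R) hf
  have hge : ∀ x ∈ Q, HasGrad e (fun i => δ i * (φ₁ (zc x) * e x)) x := by
    intro x hx
    refine (HasGrad.comp_coord (φ := fun t => Real.exp (φ t)) z (hd (x z) (hx z)).exp).congr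
      fun i => ?_
    by_cases hi : i = z
    · subst hi; simp [hδ, he, zc, mul_comm, ← hz]
    · simp [hδ, hi]
  have hgv : ∀ x ∈ Q, HasGrad v (fun i => v₁ i x) x := fun x hx =>
    ((hge x hx).mul (hdh x hx)).congr fun i => by simp only [hv₁]; ring
  have hgv₁ : ∀ i, ∀ x ∈ Q, HasGrad (v₁ i) (fun j => v₂ i j x) x := by
    intro i x hx
    have g₁ := HasGrad.comp_coord z (hd₁ (x z) (hx z))
    refine ((hge x hx).mul ((hdh₁ i x hx).add ((g₁.mul (hdh x hx)).const_mul (δ i)))).congr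
      fun j => ?_
    by_cases hj : j = z
    · subst hj
      simp only [hv₂, hδ, zc, Pi.single_eq_same, ← hz]
      ring
    · simp [hv₂, hδ, hj, zc, ← hz]
  have hsum1 : ∀ t : Fin (n + 1) → ℝ, ∑ i, δ i * t i = t z := by
    intro t; simp [hδ, Pi.single_apply]
  have hδz : δ z = 1 := by simp [hδ]
  have hsum2 : ∀ x, ∑ i, v₂ i i x = e x * (∑ i, h₂ i i x + 2 * (φ₁ (zc x) * h₁ z x)
      + (φ₂ (zc x) + φ₁ (zc x) ^ 2) * h x) := by
    intro x
    simp only [hv₂, ← Finset.mul_sum, Finset.sum_add_distrib, hsum1, mul_assoc, hδz]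
    ring
  have hsum3 : ∀ x, ∑ i, v₁ i x ^ 2 = e x ^ 2 * (∑ i, h₁ i x ^ 2 + 2 * φ₁ (zc x) * h x * h₁ z x
      + φ₁ (zc x) ^ 2 * h x ^ 2) := by
    intro x
    have : ∀ i, v₁ i x ^ 2 = e x ^ 2 * (h₁ i x ^ 2 + (δ i * (2 * φ₁ (zc x) * h x * h₁ i x)
        + δ i * (δ i * (φ₁ (zc x) ^ 2 * h x ^ 2)))) := fun i => by simp only [hv₁]; ring
    simp only [this, ← Finset.mul_sum, Finset.sum_add_distrib, hsum1, hδz]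
    ring
  have hid := carleman_identity hR hcv hcv₁ (v₂ := v₂)
    (fun i j => (bdd ce).mul ((hh₂ i j).add (((BddContOn.const _).mul (bdd (c₁.mul (hh₁ j)))).add
      (((BddContOn.const _).mul (bdd (c₁.mul (hh₁ i)))).add
        ((BddContOn.const _).mul (bdd ((c₂.add (c₁.pow 2)).mul hh)))))))
    (fun i j => by funext x; simp only [hv₂]; rw [hsymm i j]; ring)
    hgv hgv₁ hφ₁ hφ₂ hφ₃ hφ₄ hd₁ hd₂ hd₃ hpos
    (fun x hx j hj => by simp [hv, hb x hx j hj])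
    (fun x hx i j hij hj => by simp [hv₁, hb x hx j hj, hb₁ x hx i j hij hj])
    (fun x hx hxR => by simp [hv₁, hb x hx z (Or.inl hxR), htop x hx hxR, ← hz])
  have hmQ : MeasurableSet Q := (isOpen_cube _ _).measurableSet
  have int : ∀ {f : Pt (n + 1) → ℝ}, BddContOn Q f → IntegrableOn f Q :=
    fun hf => hf.integrableOn hmQ (volume_cube_ne_top R)
  have hlap : BddContOn Q fun x => ∑ i, h₂ i i x := BddContOn.sum fun i _ => hh₂ i i
  have b1 : BddContOn Q fun x => κ * (e x ^ 2 * (h x ^ 2 + ∑ i, h₁ i x ^ 2)) :=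
    (BddContOn.const κ).mul (bdd ((ce.pow 2).mul ((hh.pow 2).add
      (continuousOn_finsetSum _ fun i _ => (hh₁ i).pow 2))))
  have b2 : BddContOn Q fun x => 1 / 2 * φ₂ (zc x) ^ 2 * (e x * h x) ^ 2 :=
    bdd ((continuousOn_const.mul (c₂.pow 2)).mul ((ce.mul hh).pow 2))
  have b3 : BddContOn Q fun x => 1 / 2 * (e x ^ 2 * (∑ i, h₂ i i x) ^ 2) :=
    (BddContOn.const (1 / 2)).mul ((bdd (ce.pow 2)).mul hlap.sq)
  have b4 : BddContOn Q fun x => 2 * φ₂ (zc x) * v₁ z x ^ 2 + φ₂ (zc x) * ∑ i, v₁ i x ^ 2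
        + (φ₁ (zc x) ^ 2 * φ₂ (zc x) - φ₄ (zc x)) * v x ^ 2 :=
    bdd ((((continuousOn_const.mul c₂).mul ((hcv₁ z).pow 2)).add
      (c₂.mul (continuousOn_finsetSum _ fun i _ => (hcv₁ i).pow 2))).add
      ((((c₁.pow 2).mul c₂).sub c₄).mul (hcv.pow 2)))
  have b5 : BddContOn Q fun x => (∑ i, v₂ i i x + φ₁ (zc x) ^ 2 * v x)
        * (-2 * φ₁ (zc x) * v₁ z x - 2 * φ₂ (zc x) * v x) := by
    simp only [hsum2]
    exact (((bdd ce).mul ((hlap.add (bdd (continuousOn_const.mul (c₁.mul (hh₁ z))))).add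
      (bdd ((c₂.add (c₁.pow 2)).mul hh)))).add (bdd ((c₁.pow 2).mul hcv))).mul
      (bdd (((continuousOn_const.mul c₁).mul (hcv₁ z)).sub ((continuousOn_const.mul c₂).mul hcv)))
  have low : (∫ x in Q, κ * (e x ^ 2 * (h x ^ 2 + ∑ i, h₁ i x ^ 2)))
      + ∫ x in Q, 1 / 2 * φ₂ (zc x) ^ 2 * (e x * h x) ^ 2 ≤
      ∫ x in Q, (2 * φ₂ (zc x) * v₁ z x ^ 2 + φ₂ (zc x) * ∑ i, v₁ i x ^ 2
        + (φ₁ (zc x) ^ 2 * φ₂ (zc x) - φ₄ (zc x)) * v x ^ 2) := by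
    rw [← integral_add (int b1) (int b2)]
    refine setIntegral_mono_on (int (b1.add b2)) (int b4) hmQ fun x hx => ?_
    have hzx := hmz (cube_subset_closedCube _ R hx)
    have := carleman_pointwise_lower (e := e x) (h := h x) (hz := h₁ z x) (hκ₂ _ hzx) hκ
      (hκ₄ _ hzx) (hsum3 x) (Finset.single_le_sum (f := fun i => h₁ i x ^ 2)
        (fun i _ => sq_nonneg _) (Finset.mem_univ z))
    simpa only [hv₁, hδz, one_mul] using this
  have up : ∫ x in Q, (∑ i, v₂ i i x + φ₁ (zc x) ^ 2 * v x)
        * (-2 * φ₁ (zc x) * v₁ z x - 2 * φ₂ (zc x) * v x) ≤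
      (∫ x in Q, 1 / 2 * (e x ^ 2 * (∑ i, h₂ i i x) ^ 2))
        + ∫ x in Q, 1 / 2 * φ₂ (zc x) ^ 2 * (e x * h x) ^ 2 := by
    rw [← integral_add (int b3) (int b2)]
    refine setIntegral_mono_on (int b5) (int (b3.add b2)) hmQ fun x hx => ?_
    -- Here `S = exp(φ) Δh`, and `S - B - D = Δv + φ₁² v` is the symmetric part of the conjugated
    -- operator.
    have := carleman_pointwise_upper (e x * ∑ i, h₂ i i x) (-2 * φ₁ (zc x) * v₁ z x)
      (- φ₂ (zc x) * v x)
    simp only [hsum2]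
    simp only [hv₁, hv, hδz, one_mul] at this ⊢
    calc _ = _ := by ring
      _ ≤ _ := this
      _ = _ := by ring
  rw [← integral_const_mul, ← integral_const_mul]
  linarith

/-- The Carleman estimate: for large `λ` the constant is as large as desired. -/
theorem exists_carleman_estimate (n : ℕ) (hR : 0 < R) {r b β : ℝ} (hr : R < r) (hb0 : 0 < b)
    (hβ : 1 < β) (K : ℝ) :
    ∃ lam₀ : ℝ, 1 < lam₀ ∧ ∀ lam, lam₀ < lam → ∀ (h : Pt (n + 1) → ℝ)
      (h₁ : Fin (n + 1) → Pt (n + 1) → ℝ) (h₂ : Fin (n + 1) → Fin (n + 1) → Pt (n + 1) → ℝ),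
      ContinuousOn h (closedCube (n + 1) R) →
      (∀ i, ContinuousOn (h₁ i) (closedCube (n + 1) R)) →
      (∀ i j, BddContOn (cube (n + 1) R) (h₂ i j)) →
      (∀ i j, h₂ i j = h₂ j i) →
      (∀ x ∈ cube (n + 1) R, HasGrad h (fun i => h₁ i x) x) →
      (∀ i, ∀ x ∈ cube (n + 1) R, HasGrad (h₁ i) (fun j => h₂ i j x) x) →
      (∀ x ∈ closedCube (n + 1) R, ∀ j, (x j = R ∨ x j = -R) → h x = 0) →
      (∀ x ∈ closedCube (n + 1) R, ∀ i j, i ≠ j → (x j = R ∨ x j = -R) → h₁ i x = 0) →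
      (∀ x ∈ closedCube (n + 1) R, zc x = R → h₁ (Fin.last n) x = 0) →
      K * ∫ x in cube (n + 1) R, weight r b lam β x * (h x ^ 2 + ∑ i, h₁ i x ^ 2) ≤
        ∫ x in cube (n + 1) R, weight r b lam β x * (∑ i, h₂ i i x) ^ 2 := by
  have hpos : ∀ z ∈ Set.Icc (-R) R, 0 < (z + r) / b := fun z hz => by
    have := hz.1
    exact div_pos (by linarith) hb0
  have hcont : ∀ γ : ℝ, ContinuousOn (fun z : ℝ => ((z + r) / b) ^ γ) (Set.Icc (-R) R) := fun γ =>
    ContinuousOn.rpow_const (by fun_prop) fun z hz => Or.inl (hpos z hz).ne'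
  have hder : ∀ γ c : ℝ, ∀ z ∈ Set.Ioo (-R) R, HasDerivAt (fun z : ℝ => c * ((z + r) / b) ^ γ)
      (c * γ / b * ((z + r) / b) ^ (γ - 1)) z := by
    intro γ c z hz
    have h1 : HasDerivAt (fun z : ℝ => (z + r) / b) (1 / b) z :=
      ((hasDerivAt_id z).add_const r).div_const b
    refine ((h1.rpow_const (p := γ)
      (Or.inl (hpos z (Set.Ioo_subset_Icc_self hz)).ne')).const_mul c).congr_deriv ?_
    ring
  set a₁ := β / b
  set a₂ := a₁ * (β - 1) / b
  set a₃ := a₂ * (β - 1 - 1) / b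
  set a₄ := a₃ * (β - 1 - 1 - 1) / b
  have ha₁ : 0 < a₁ := div_pos (by linarith) hb0
  have ha₂ : 0 < a₂ := div_pos (mul_pos ha₁ (by linarith)) hb0
  set ψ₁ : ℝ → ℝ := fun z => a₁ * ((z + r) / b) ^ (β - 1)
  set ψ₂ : ℝ → ℝ := fun z => a₂ * ((z + r) / b) ^ (β - 1 - 1)
  set ψ₃ : ℝ → ℝ := fun z => a₃ * ((z + r) / b) ^ (β - 1 - 1 - 1)
  set ψ₄ : ℝ → ℝ := fun z => a₄ * ((z + r) / b) ^ (β - 1 - 1 - 1 - 1)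
  have c₁ : ContinuousOn ψ₁ (Set.Icc (-R) R) := continuousOn_const.mul (hcont _)
  have c₂ : ContinuousOn ψ₂ (Set.Icc (-R) R) := continuousOn_const.mul (hcont _)
  have c₃ : ContinuousOn ψ₃ (Set.Icc (-R) R) := continuousOn_const.mul (hcont _)
  have c₄ : ContinuousOn ψ₄ (Set.Icc (-R) R) := continuousOn_const.mul (hcont _)
  have p₁ : ∀ z ∈ Set.Icc (-R) R, 0 < ψ₁ z := fun z hz =>
    mul_pos ha₁ (Real.rpow_pos_of_pos (hpos z hz) _)
  have p₂ : ∀ z ∈ Set.Icc (-R) R, 0 < ψ₂ z := fun z hz =>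
    mul_pos ha₂ (Real.rpow_pos_of_pos (hpos z hz) _)
  have hne : (Set.Icc (-R) R).Nonempty := Set.nonempty_Icc.2 (by linarith)
  obtain ⟨z₂, hz₂, hmin₂⟩ := isCompact_Icc.exists_isMinOn hne c₂
  obtain ⟨z₁, hz₁, hmin₁⟩ := isCompact_Icc.exists_isMinOn hne ((c₁.pow 2).mul c₂)
  obtain ⟨M₂, hM₂⟩ := isCompact_Icc.exists_bound_of_continuousOn (c₂.pow 2)
  obtain ⟨M₄, hM₄⟩ := isCompact_Icc.exists_bound_of_continuousOn c₄
  set m₂ := ψ₂ z₂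
  set m₁ := ψ₁ z₁ ^ 2 * ψ₂ z₁
  have hm₂ : 0 < m₂ := p₂ _ hz₂
  have hm₁ : 0 < m₁ := mul_pos (pow_pos (p₁ _ hz₁) 2) (p₂ _ hz₁)
  set κ := |K| / 2
  have hκ : 0 ≤ κ := by positivity
  -- The two quotients secure the conditions on `φ₂` and on `φ₁² φ₂ / 2 - φ₄ - φ₂² / 2`. The cubic
  -- term in `λ` beats `φ₂²`, which is quadratic, and `φ₄`, which is linear; `m₁` and `m₂` are
  -- positive because `β > 1` and `R < r`.
  refine ⟨1 + 1 + 4 * κ / m₂ + 2 * (|M₄| + 1 / 2 * |M₂| + κ) / m₁, ?_, ?_⟩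
  · have : 0 ≤ 4 * κ / m₂ := by positivity
    have : 0 ≤ 2 * (|M₄| + 1 / 2 * |M₂| + κ) / m₁ := by positivity
    linarith
  intro lam hlam h h₁ h₂ q1 q2 q3 q4 q5 q6 q7 q8 q9
  have t1 : 0 ≤ 4 * κ / m₂ := by positivity
  have t2 : 0 ≤ 2 * (|M₄| + 1 / 2 * |M₂| + κ) / m₁ := by positivity
  have hl1 : 1 ≤ lam := by linarith
  have hl2 : 4 * κ ≤ lam * m₂ := by
    rw [← div_le_iff₀ hm₂]; linarith
  have hl3 : 2 * (|M₄| + 1 / 2 * |M₂| + κ) ≤ lam * m₁ := by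
    rw [← div_le_iff₀ hm₁]; linarith
  have hw : ∀ x : Pt (n + 1), weight r b lam β x
      = Real.exp (lam * ((zc x + r) / b) ^ β) ^ 2 := by
    intro x
    rw [weight, ← Real.exp_nat_mul]
    congr 1; push_cast; ring
  have hmain := carleman_estimate_aux (φ := fun z => lam * ((z + r) / b) ^ β)
    (φ₁ := fun z => lam * ψ₁ z) (φ₂ := fun z => lam * ψ₂ z) (φ₃ := fun z => lam * ψ₃ z)
    (φ₄ := fun z => lam * ψ₄ z) hR hκ q1 q2 q3 q4 q5 q6 (continuousOn_const.mul (hcont β))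
    (continuousOn_const.mul c₁) (continuousOn_const.mul c₂) (continuousOn_const.mul c₃)
    (continuousOn_const.mul c₄)
    (fun z hz => (hder β lam z hz).congr_deriv (by simp only [ψ₁, a₁]; ring))
    (fun z hz => (hder _ a₁ z hz).const_mul lam)
    (fun z hz => (hder _ a₂ z hz).const_mul lam)
    (fun z hz => (hder _ a₃ z hz).const_mul lam)
    (mul_nonneg (by linarith) (p₁ _ ⟨le_rfl, by linarith⟩).le)
    (fun z hz => hl2.trans (mul_le_mul_of_nonneg_left (hmin₂ hz) (by linarith)))
    (fun z hz => ?_) q7 q8 q9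
  · simp only [hw]
    have hnn : 0 ≤ ∫ x in cube (n + 1) R, Real.exp (lam * ((zc x + r) / b) ^ β) ^ 2 *
        (h x ^ 2 + ∑ i, h₁ i x ^ 2) := integral_nonneg fun x => by positivity
    have := mul_le_mul_of_nonneg_right (le_abs_self K) hnn
    have e : κ = |K| / 2 := rfl
    rw [e] at hmain
    linarith
  · have k1 : m₁ ≤ ψ₁ z ^ 2 * ψ₂ z := hmin₁ hz
    have k2 : ψ₂ z ^ 2 ≤ |M₂| := (le_abs_self _).trans ((hM₂ z hz).trans (le_abs_self _))
    have k4 : ψ₄ z ≤ |M₄| := (le_abs_self _).trans ((hM₄ z hz).trans (le_abs_self _))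
    have l2 : 1 ≤ lam ^ 2 := one_le_pow₀ hl1
    have l0 : 0 ≤ lam ^ 2 := by positivity
    have s1 : lam ^ 3 * m₁ ≤ lam ^ 3 * (ψ₁ z ^ 2 * ψ₂ z) :=
      mul_le_mul_of_nonneg_left k1 (by positivity)
    have s2 : lam ^ 2 * (2 * (|M₄| + 1 / 2 * |M₂| + κ)) ≤ lam ^ 2 * (lam * m₁) :=
      mul_le_mul_of_nonneg_left hl3 l0
    have s3 : lam ^ 2 * ψ₂ z ^ 2 ≤ lam ^ 2 * |M₂| := mul_le_mul_of_nonneg_left k2 l0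
    have s4 : lam * ψ₄ z ≤ lam ^ 2 * |M₄| := by
      calc lam * ψ₄ z ≤ lam * |M₄| := mul_le_mul_of_nonneg_left k4 (by linarith)
        _ ≤ lam ^ 2 * |M₄| := mul_le_mul_of_nonneg_right (by nlinarith) (abs_nonneg _)
    have s5 : κ ≤ lam ^ 2 * κ := le_mul_of_one_le_left hκ l2
    nlinarith

end Carleman

/-! ### Representatives up to the boundary and their boundary values -/

section Representatives

variable {d : ℕ} {R : ℝ}

/-- `w` collects a representative of `u` of class `C²` on the open cube and its derivatives, which
are bounded by `B`; the representative and its derivatives of first order are continuous up to the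
boundary. -/
structure IsC2Rep (R B : ℝ) (u : Pt d → ℝ) (w : (Fin d → ℕ) → Pt d → ℝ) : Prop where
  cont : ∀ α, order α ≤ 1 → Continuous (w α)
  contOn : ∀ α, order α ≤ 2 → ContinuousOn (w α) (cube d R)
  ae_eq : ∀ α, order α ≤ 2 → w α =ᵐ[volume.restrict (cube d R)] weakDeriv (cube d R) α u
  bound : ∀ α, order α ≤ 2 → ∀ x ∈ cube d R, |w α x| ≤ B
  family : IsDerivFamily (cube d R) 2 w

theorem norm_linForm_le (a : Fin d → ℝ) {B : ℝ} (h : ∀ i, |a i| ≤ B) : ‖linForm a‖ ≤ d * B := by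
  calc ‖linForm a‖ ≤ ∑ _i : Fin d, B := by
        refine (norm_sum_le _ _).trans (Finset.sum_le_sum fun i _ => ?_)
        rw [norm_smul, Real.norm_eq_abs]
        calc _ ≤ |a i| * 1 := by
              gcongr
              refine ContinuousLinearMap.opNorm_le_bound _ zero_le_one fun z => ?_
              rw [one_mul]; exact norm_le_pi_norm z i
          _ ≤ B := by rw [mul_one]; exact h i
    _ = d * B := by simp

theorem exists_C2_rep_closed (hR : 0 < R) {k p : ℕ} (hk : d + 1 ≤ 2 * k) (hp : k + 2 ≤ p) :
    ∃ C : ℝ, 0 < C ∧ ∀ u, MemH (cube d R) p u → ∃ w : (Fin d → ℕ) → Pt d → ℝ,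
      IsC2Rep R (C * sobNorm (cube d R) p u) u w := by
  classical
  obtain ⟨C, hC, h⟩ := exists_C2_rep (d := d) hR hk hp
  refine ⟨C, hC, fun u hu => ?_⟩
  obtain ⟨w, hw1, hw2, hw3, hw4⟩ := h u hu
  set B := C * sobNorm (cube d R) p u
  have hB : 0 ≤ B := mul_nonneg hC.le (sobNorm_nonneg _ _ _)
  have hext : ∀ α, order α ≤ 1 → ∃ g : Pt d → ℝ, Continuous g ∧ Set.EqOn (w α) g (cube d R) := by
    intro α hα
    -- The derivatives of next order are bounded on a convex set, so orders `0` and `1` are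
    -- Lipschitz and extend continuously. Order two is left on the open cube.
    have hl : LipschitzOnWith (Real.toNNReal (d * B)) (w α) (cube d R) := by
      refine (convex_cube d R).lipschitzOnWith_of_nnnorm_hasFDerivWithin_le
        (fun x hx => (hw4 α (by omega) x hx).hasFDerivWithinAt) (fun x hx => ?_)
      rw [← NNReal.coe_le_coe, Real.coe_toNNReal _ (by positivity), coe_nnnorm]
      exact norm_linForm_le _ fun i => hw3 _ (by rw [order_add, order_single]; omega) x hx
    obtain ⟨g, hg1, hg2⟩ := hl.extend_real
    exact ⟨g, hg1.continuous, hg2⟩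
  choose! g hg1 hg2 using hext
  set W : (Fin d → ℕ) → Pt d → ℝ := fun α => if order α ≤ 1 then g α else w α with hW
  have hWw : ∀ α, Set.EqOn (W α) (w α) (cube d R) := by
    intro α x hx
    by_cases hα : order α ≤ 1
    · simp [hW, hα, hg2 α hα hx]
    · simp [hW, hα]
  refine ⟨W, fun α hα => by simpa [hW, hα] using hg1 α hα,
    fun α hα => (hw1 α hα).congr (hWw α), fun α hα => ?_, fun α hα x hx => ?_,
    fun α hα x hx => ?_⟩
  · refine EventuallyEq.trans ?_ (hw2 α hα)
    exact (ae_restrict_iff' (isOpen_cube d R).measurableSet).2 (Eventually.of_forall (hWw α))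
  · rw [hWw α hx]; exact hw3 α hα x hx
  · have e1 : W α =ᶠ[𝓝 x] w α := (hWw α).eventuallyEq_of_mem ((isOpen_cube d R).mem_nhds hx)
    refine ((hw4 α hα x hx).congr_of_eventuallyEq e1).congr_fderiv ?_
    exact Finset.sum_congr rfl fun i _ => by rw [hWw _ hx]

theorem IsC2Rep.mono {B B' : ℝ} {u : Pt d → ℝ} {w : (Fin d → ℕ) → Pt d → ℝ}
    (h : IsC2Rep R B u w) (hB : B ≤ B') : IsC2Rep R B' u w :=
  ⟨h.cont, h.contOn, h.ae_eq, fun α hα x hx => (h.bound α hα x hx).trans hB, h.family⟩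

theorem IsC2Rep.sub {B B' : ℝ} {p : ℕ} (hp : 2 ≤ p) {u v : Pt d → ℝ}
    {w w' : (Fin d → ℕ) → Pt d → ℝ}
    (hu : MemH (cube d R) p u) (hv : MemH (cube d R) p v)
    (h : IsC2Rep R B u w) (h' : IsC2Rep R B' v w') :
    IsC2Rep R (B + B') (u - v) fun α => w α - w' α where
  cont α hα := (h.cont α hα).sub (h'.cont α hα)
  contOn α hα := (h.contOn α hα).sub (h'.contOn α hα)
  ae_eq α hα := by
    have e : u - v = (1 : ℝ) • u + (-1 : ℝ) • v := by
      rw [one_smul, neg_one_smul, sub_eq_add_neg]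
    rw [e]
    filter_upwards [hu.weakDeriv_linear (isOpen_cube d R) hv 1 (-1) (hα.trans hp), h.ae_eq α hα,
      h'.ae_eq α hα] with x h1 h2 h3
    rw [h1, Pi.sub_apply, h2, h3]; ring
  bound α hα x hx := (abs_sub _ _).trans (add_le_add (h.bound α hα x hx) (h'.bound α hα x hx))
  family := h.family.sub h'.family

/-- Two continuous functions that agree almost everywhere on the open cube agree on it, hence on its
closure; so boundary values do not depend on the continuous representative. -/
theorem HasBoundaryValue.eq_of_ae_eq (hR : 0 < R) {S : Set (Pt d)} {u f g : Pt d → ℝ}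
    (h : HasBoundaryValue (cube d R) S u f) (hS : S ⊆ closedCube d R) (hg : Continuous g)
    (hgu : g =ᵐ[volume.restrict (cube d R)] u) {x : Pt d} (hx : x ∈ S) : g x = f x := by
  obtain ⟨w, hw1, hw2, hw3⟩ := h
  rw [← hw3 x hx]
  have h1 : Set.EqOn g w (cube d R) := Measure.eqOn_open_of_ae_eq (hgu.trans hw2.symm)
    (isOpen_cube d R) hg.continuousOn (hw1.mono subset_closure)
  exact h1.of_subset_closure hg.continuousOn hw1 subset_closure subset_rfl
    (by rw [closure_cube hR]; exact hS hx)

/-- Tangential derivatives of a function that vanishes on the boundary vanish there. -/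
theorem tangential_derivative_eq_zero (hR : 0 < R) {h : Pt d → ℝ} {h₁ : Fin d → Pt d → ℝ}
    (hh : Continuous h) (hh₁ : ∀ i, Continuous (h₁ i))
    (hd : ∀ x ∈ cube d R, HasGrad h (fun i => h₁ i x) x)
    (hb : ∀ x ∈ closedCube d R, ∀ j, (x j = R ∨ x j = -R) → h x = 0)
    {x : Pt d} (hx : x ∈ closedCube d R) {i j : Fin d} (hij : i ≠ j)
    (hj : x j = R ∨ x j = -R) : h₁ i x = 0 := by
  have hlc : Continuous fun y => linForm fun k => h₁ k y := by
    unfold linForm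
    exact continuous_finsetSum _ fun k _ => (hh₁ k).smul continuous_const
  -- The gradient extends continuously to the boundary, so `h` is differentiable there relative to
  -- the closed cube.
  have hF : HasFDerivWithinAt h (linForm fun k => h₁ k x) (closedCube d R) x := by
    rw [← closure_cube hR]
    refine hasFDerivWithinAt_closure_of_tendsto_fderiv
      (fun y hy => (hd y hy).differentiableAt.differentiableWithinAt) (convex_cube d R)
      (isOpen_cube d R) (fun y _ => hh.continuousWithinAt) ?_
    refine (hlc.tendsto x |>.mono_left nhdsWithin_le_nhds).congr' ?_
    filter_upwards [self_mem_nhdsWithin] with y hy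
    exact (hd y hy).fderiv.symm
  set I := Set.Icc (-R - x i) (R - x i)
  have hxi := mem_closedCube.1 hx i
  have h0 : (0 : ℝ) ∈ I := ⟨by linarith, by linarith⟩
  have hl : HasDerivWithinAt (fun s : ℝ => x + s • (Pi.single i 1 : Pt d)) (Pi.single i 1) I 0 := by
    simpa using (((hasDerivAt_id (0 : ℝ)).smul_const (Pi.single i 1 : Pt d)).const_add
      x).hasDerivWithinAt (s := I)
  have hmap : Set.MapsTo (fun s : ℝ => x + s • (Pi.single i 1 : Pt d)) I (closedCube d R) := by
    intro s hs
    refine mem_closedCube.2 fun k => ?_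
    by_cases hk : k = i
    · subst hk
      simp only [Pi.add_apply, Pi.smul_apply, Pi.single_eq_same, smul_eq_mul, mul_one]
      constructor <;> linarith [hs.1, hs.2]
    · simpa [hk] using mem_closedCube.1 hx k
  have hF' : HasFDerivWithinAt h (linForm fun k => h₁ k x) (closedCube d R)
      (x + (0 : ℝ) • (Pi.single i 1 : Pt d)) := by simpa using hF
  have hcomp := hF'.comp_hasDerivWithinAt (0 : ℝ) hl hmap
  rw [linForm_single] at hcomp
  -- A line in a direction `i ≠ j` stays in the face, where `h` is identically zero.
  have hz : HasDerivWithinAt (h ∘ fun s : ℝ => x + s • (Pi.single i 1 : Pt d)) 0 I 0 := by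
    refine (hasDerivWithinAt_const (0 : ℝ) I (0 : ℝ)).congr_of_mem (fun s hs => ?_) h0
    refine hb _ (hmap hs) j ?_
    simpa [Ne.symm hij] using hj
  exact (uniqueDiffOn_Icc (by linarith) 0 h0).eq_deriv _ hcomp hz

theorem eq_zero_or_single_of_order_le_one {α : Fin d → ℕ} (h : order α ≤ 1) :
    α = 0 ∨ ∃ i, α = Pi.single i 1 := by
  by_cases h0 : α = 0
  · exact Or.inl h0
  right
  obtain ⟨i, hi⟩ : ∃ i, α i ≠ 0 := by
    by_contra hne
    push Not at hne
    exact h0 (funext hne)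
  refine ⟨i, funext fun j => ?_⟩
  have h1 : ∑ k, α k ≤ 1 := h
  rw [← Finset.add_sum_erase _ _ (Finset.mem_univ i)] at h1
  by_cases hj : j = i
  · subst hj; simp only [Pi.single_eq_same]; omega
  · have h2 : α j ≤ ∑ k ∈ Finset.univ.erase i, α k :=
      Finset.single_le_sum (f := α) (fun _ _ => Nat.zero_le _)
        (Finset.mem_erase.2 ⟨hj, Finset.mem_univ j⟩)
    simp only [Pi.single_eq_of_ne hj]; omega

theorem sobNorm_one_sq (Ω : Set (Pt d)) (u : Pt d → ℝ) :
    sobNorm Ω 1 u ^ 2 = (∫ x in Ω, weakDeriv Ω 0 u x ^ 2)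
      + ∑ i, ∫ x in Ω, weakDeriv Ω (Pi.single i 1) u x ^ 2 := by
  have : multiIndices d 1 = insert 0 (Finset.univ.image fun i : Fin d => (Pi.single i 1)) := by
    ext α
    rw [mem_multiIndices, Finset.mem_insert, Finset.mem_image]
    constructor
    · intro h
      rcases eq_zero_or_single_of_order_le_one h with h | ⟨i, h⟩
      · exact Or.inl h
      · exact Or.inr ⟨i, Finset.mem_univ i, h.symm⟩
    · rintro (h | ⟨i, -, h⟩)
      · rw [h, order_zero]; omega
      · rw [← h, order_single]
  rw [sobNorm_sq, this, Finset.sum_insert, Finset.sum_image]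
  · intro i _ j _ hij
    by_contra hne
    have := congrFun hij i
    simp [hne] at this
  · simp only [Finset.mem_image, Finset.mem_univ, true_and, not_exists]
    intro i hi
    have := congrFun hi i
    simp at this

end Representatives

/-! ### Taylor bounds on compact convex sets -/

section Taylor

/-- Compactness bounds `G` and its first two derivatives within `S`; convexity gives mean value
inequalities. The quadratic remainder is the mean value inequality for `G` minus its linearization
at `p`, on the segment from `p` to `q`. -/
theorem ContDiffOn.exists_taylor_bounds {E : Type*} [NormedAddCommGroup E] [NormedSpace ℝ E]
    {S K : Set E} (hS : UniqueDiffOn ℝ S) {G : E → ℝ} (hG : ContDiffOn ℝ 2 G S)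
    (hK : IsCompact K) (hKc : Convex ℝ K) (hKS : K ⊆ S) :
    ∃ C : ℝ, 0 ≤ C ∧ (∀ p ∈ K, |G p| ≤ C) ∧ (∀ p ∈ K, ‖fderivWithin ℝ G S p‖ ≤ C) ∧
      (∀ p ∈ K, ∀ q ∈ K, |G q - G p| ≤ C * ‖q - p‖) ∧
      ∀ p ∈ K, ∀ q ∈ K, |G q - G p - fderivWithin ℝ G S p (q - p)| ≤ C * ‖q - p‖ ^ 2 := by
  set G' := fderivWithin ℝ G S
  have hG' : ContDiffOn ℝ 1 G' S := hG.fderivWithin hS (by norm_num)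
  set G'' := fderivWithin ℝ G' S
  have hG'' : ContinuousOn G'' S := (hG'.fderivWithin (m := 0) hS (by norm_num)).continuousOn
  obtain ⟨C₀, h₀⟩ := hK.exists_bound_of_continuousOn (hG.continuousOn.mono hKS)
  obtain ⟨C₁, h₁⟩ := hK.exists_bound_of_continuousOn (hG'.continuousOn.mono hKS)
  obtain ⟨C₂, h₂⟩ := hK.exists_bound_of_continuousOn (E := E →L[ℝ] E →L[ℝ] ℝ)
    (f := G'') (hG''.mono hKS)
  have hd : ∀ p ∈ K, HasFDerivWithinAt G (G' p) K p := fun p hp =>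
    ((hG.differentiableOn (by norm_num)) p (hKS hp)).hasFDerivWithinAt.mono hKS
  have hd' : ∀ p ∈ K, HasFDerivWithinAt G' (G'' p) K p := fun p hp =>
    ((hG'.differentiableOn (by norm_num)) p (hKS hp)).hasFDerivWithinAt.mono hKS
  refine ⟨max 0 (max C₀ (max C₁ C₂)), le_max_left _ _, fun p hp => ?_, fun p hp => ?_,
    fun p hp q hq => ?_, fun p hp q hq => ?_⟩
  · exact (h₀ p hp).trans (by simp)
  · exact (h₁ p hp).trans (by simp)
  · have := hKc.norm_image_sub_le_of_norm_hasFDerivWithin_le hd h₁ hp hq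
    rw [Real.norm_eq_abs] at this
    exact this.trans (by gcongr; simp)
  · have hseg := hKc.segment_subset hp hq
    have hC₂ : 0 ≤ C₂ := (norm_nonneg _).trans (h₂ p hp)
    have := (convex_segment p q).norm_image_sub_le_of_norm_hasFDerivWithin_le'
      (f := G) (f' := G') (φ := G' p) (C := C₂ * ‖q - p‖)
      (fun z hz => (hd z (hseg hz)).mono hseg)
      (fun z hz => ?_) (left_mem_segment ℝ p q) (right_mem_segment ℝ p q)
    · rw [Real.norm_eq_abs] at this
      refine this.trans ?_
      rw [mul_assoc, ← pow_two]
      gcongr; simp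
    · refine (hKc.norm_image_sub_le_of_norm_hasFDerivWithin_le hd' h₂ hp (hseg hz)).trans ?_
      gcongr
      obtain ⟨t, ht, rfl⟩ := segment_eq_image' ℝ p q ▸ hz
      simp only [add_sub_cancel_left, norm_smul, Real.norm_eq_abs, abs_of_nonneg ht.1]
      exact mul_le_of_le_one_left (norm_nonneg _) ht.2

end Taylor

/-! ### The nonlinearity and the operators in terms of representatives -/

section Functional

variable {d : ℕ} {R : ℝ}

/-- The nonlinearity as a function of one variable. -/
def uncurryF (F : Pt d → ℝ → Pt d → ℝ) : Pt d × ℝ × Pt d → ℝ := fun y => F y.1 y.2.1 y.2.2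

/-- The domain of the nonlinearity. -/
def domF (d : ℕ) (R : ℝ) : Set (Pt d × ℝ × Pt d) := closure (cube d R) ×ˢ Set.univ

/-- The derivative of the nonlinearity. -/
def derivF (R : ℝ) (F : Pt d → ℝ → Pt d → ℝ) (y : Pt d × ℝ × Pt d) : Pt d × ℝ × Pt d →L[ℝ] ℝ :=
  fderivWithin ℝ (uncurryF F) (domF d R) y

/-- Value and gradient. -/
def jet (w : (Fin d → ℕ) → Pt d → ℝ) (x : Pt d) : ℝ × Pt d := (w 0 x, fun i => w (Pi.single i 1) x)

/-- The Laplacian, in terms of the family of derivatives. -/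
def lapRep (w : (Fin d → ℕ) → Pt d → ℝ) (x : Pt d) : ℝ :=
  ∑ i, w (Pi.single i 1 + Pi.single i 1) x

/-- The sum of squares of value and gradient. -/
def jetSq (w : (Fin d → ℕ) → Pt d → ℝ) (x : Pt d) : ℝ :=
  w 0 x ^ 2 + ∑ i, w (Pi.single i 1) x ^ 2

/-- The viscous operator, in terms of the family of derivatives. -/
def viscRep (ε₀ : ℝ) (F : Pt d → ℝ → Pt d → ℝ) (w : (Fin d → ℕ) → Pt d → ℝ) (x : Pt d) : ℝ :=
  -ε₀ * lapRep w x + uncurryF F (x, jet w x)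

/-- The linearized operator, in terms of the families of derivatives. -/
def linRep (R ε₀ : ℝ) (F : Pt d → ℝ → Pt d → ℝ) (w w' : (Fin d → ℕ) → Pt d → ℝ) (x : Pt d) : ℝ :=
  -ε₀ * lapRep w' x + derivF R F (x, jet w x) (0, jet w' x)

/-- The compact set in which the arguments of the nonlinearity lie. -/
def argSet (d : ℕ) (R B : ℝ) : Set (Pt d × ℝ × Pt d) :=
  closedCube d R ×ˢ Metric.closedBall (0 : ℝ × Pt d) B

theorem isCompact_argSet (R B : ℝ) : IsCompact (argSet d R B) :=
  (isCompact_closedCube d R).prod (isCompact_closedBall _ _)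

theorem convex_argSet (R B : ℝ) : Convex ℝ (argSet d R B) :=
  (convex_Icc _ _).prod (convex_closedBall _ _)

theorem argSet_subset (hR : 0 < R) (B : ℝ) : argSet d R B ⊆ domF d R := by
  rw [domF, closure_cube hR]
  exact Set.prod_mono subset_rfl (Set.subset_univ _)

theorem uniqueDiffOn_domF (hR : 0 < R) : UniqueDiffOn ℝ (domF d R) := by
  refine UniqueDiffOn.prod ?_ uniqueDiffOn_univ
  refine uniqueDiffOn_convex (convex_cube d R).closure ⟨0, ?_⟩
  exact interior_mono subset_closure ((isOpen_cube d R).interior_eq.symm ▸ fun i => by simpa using hR)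

theorem IsC2On.exists_bounds (hR : 0 < R) {F : Pt d → ℝ → Pt d → ℝ} (hF : IsC2On (cube d R) F)
    (B : ℝ) :
    ∃ C : ℝ, 0 ≤ C ∧ (∀ p ∈ argSet d R B, |uncurryF F p| ≤ C) ∧
      (∀ p ∈ argSet d R B, ‖derivF R F p‖ ≤ C) ∧
      (∀ p ∈ argSet d R B, ∀ q ∈ argSet d R B,
        |uncurryF F q - uncurryF F p| ≤ C * ‖q - p‖) ∧
      ∀ p ∈ argSet d R B, ∀ q ∈ argSet d R B,
        |uncurryF F q - uncurryF F p - derivF R F p (q - p)| ≤ C * ‖q - p‖ ^ 2 :=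
  ContDiffOn.exists_taylor_bounds (uniqueDiffOn_domF hR) hF (isCompact_argSet R B)
    (convex_argSet R B) (argSet_subset hR B)

theorem IsC2On.hasFDerivAt {F : Pt d → ℝ → Pt d → ℝ} (hF : IsC2On (cube d R) F)
    {x : Pt d} (hx : x ∈ cube d R) (y : ℝ × Pt d) :
    HasFDerivAt (uncurryF F) (derivF R F (x, y)) (x, y) := by
  have hn : domF d R ∈ 𝓝 (x, y) :=
    prod_mem_nhds (mem_of_superset ((isOpen_cube d R).mem_nhds hx) subset_closure) univ_mem
  have h1 : DifferentiableWithinAt ℝ (uncurryF F) (domF d R) (x, y) :=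
    (ContDiffOn.differentiableOn hF (by norm_num)) _ (mem_of_mem_nhds hn)
  exact h1.hasFDerivWithinAt.hasFDerivAt hn

/-- The chain rule connects the separate partial derivatives in `linOp` with the joint derivative,
for which the Taylor bounds hold. -/
theorem IsC2On.derivF_apply {F : Pt d → ℝ → Pt d → ℝ} (hF : IsC2On (cube d R) F)
    {x : Pt d} (hx : x ∈ cube d R) (s t : ℝ) (q k : Pt d) :
    derivF R F (x, s, q) (0, t, k)
      = deriv (fun s => F x s q) s * t + fderiv ℝ (fun q => F x s q) q k := by
  have h := hF.hasFDerivAt hx (s, q)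
  have h1 : HasFDerivAt (fun s : ℝ => (x, s, q)) ((0 : ℝ →L[ℝ] Pt d).prod
      ((ContinuousLinearMap.id ℝ ℝ).prod (0 : ℝ →L[ℝ] Pt d))) s :=
    (hasFDerivAt_const x s).prodMk ((hasFDerivAt_id s).prodMk (hasFDerivAt_const q s))
  have h2 : HasFDerivAt (fun q : Pt d => (x, s, q)) ((0 : Pt d →L[ℝ] Pt d).prod
      ((0 : Pt d →L[ℝ] ℝ).prod (ContinuousLinearMap.id ℝ (Pt d)))) q :=
    (hasFDerivAt_const x q).prodMk ((hasFDerivAt_const s q).prodMk (hasFDerivAt_id q))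
  have c1 : HasFDerivAt (fun s => F x s q) _ s := HasFDerivAt.comp s (g := uncurryF F) h h1
  have c2 : HasFDerivAt (fun q => F x s q) _ q := HasFDerivAt.comp q (g := uncurryF F) h h2
  have e1 : deriv (fun s => F x s q) s = derivF R F (x, s, q) (0, 1, 0) := by
    rw [c1.hasDerivAt.deriv]; simp
  have e2 : fderiv ℝ (fun q => F x s q) q k = derivF R F (x, s, q) (0, 0, k) := by
    rw [c2.fderiv]; simp
  rw [e1, e2, mul_comm, ← smul_eq_mul, ← map_smul, ← map_add]
  simp

theorem norm_jet_le {w : (Fin d → ℕ) → Pt d → ℝ} {x : Pt d} {B : ℝ}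
    (h : ∀ α, order α ≤ 1 → |w α x| ≤ B) : ‖jet w x‖ ≤ B := by
  have h0 := h 0 (by rw [order_zero]; omega)
  rw [jet, Prod.norm_mk, max_le_iff]
  refine ⟨h0, (pi_norm_le_iff_of_nonneg ((abs_nonneg _).trans h0)).2 fun i => ?_⟩
  exact h _ (by rw [order_single])

/-- The norm on the product is a maximum norm, and a maximum is bounded by the Euclidean norm. This
passes from Taylor bounds to integrands of `H¹` type. -/
theorem norm_jet_sq_le (w : (Fin d → ℕ) → Pt d → ℝ) (x : Pt d) : ‖jet w x‖ ^ 2 ≤ jetSq w x := by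
  have hs : 0 ≤ ∑ i, w (Pi.single i 1) x ^ 2 := Finset.sum_nonneg fun _ _ => sq_nonneg _
  have h0 : 0 ≤ jetSq w x := add_nonneg (sq_nonneg _) hs
  have h1 : ‖jet w x‖ ≤ Real.sqrt (jetSq w x) := by
    refine norm_jet_le fun α hα => Real.abs_le_sqrt ?_
    rcases eq_zero_or_single_of_order_le_one hα with rfl | ⟨i, rfl⟩
    · exact le_add_of_nonneg_right hs
    · exact (Finset.single_le_sum (f := fun i => w (Pi.single i 1) x ^ 2)
        (fun _ _ => sq_nonneg _) (Finset.mem_univ i)).trans (le_add_of_nonneg_left (sq_nonneg _))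
  calc _ ≤ Real.sqrt (jetSq w x) ^ 2 := pow_le_pow_left₀ (norm_nonneg _) h1 2
    _ = _ := Real.sq_sqrt h0

section RepLemmas

variable {B B' ε₀ : ℝ} {p : ℕ} {F : Pt d → ℝ → Pt d → ℝ} {u u' : Pt d → ℝ}
  {w w' : (Fin d → ℕ) → Pt d → ℝ}

theorem IsC2Rep.mem_argSet (h : IsC2Rep R B u w) {x : Pt d} (hx : x ∈ cube d R) :
    (x, jet w x) ∈ argSet d R B :=
  ⟨cube_subset_closedCube d R hx, by
    rw [mem_closedBall_zero_iff]
    exact norm_jet_le fun α hα => h.bound α (by omega) x hx⟩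

theorem IsC2Rep.ae_eq_self (h : IsC2Rep R B u w) (hu : MemH (cube d R) p u) :
    w 0 =ᵐ[volume.restrict (cube d R)] u :=
  (h.ae_eq 0 (by rw [order_zero]; omega)).trans (hu.weakDeriv_zero_ae (isOpen_cube d R))

theorem single_two (i : Fin d) : (Pi.single i 2 : Fin d → ℕ) = Pi.single i 1 + Pi.single i 1 := by
  rw [← Pi.single_add]

theorem IsC2Rep.lap_ae (h : IsC2Rep R B u w) :
    lap (cube d R) u =ᵐ[volume.restrict (cube d R)] lapRep w := by
  have : ∀ᵐ x ∂volume.restrict (cube d R), ∀ i : Fin d,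
      w (Pi.single i 2) x = weakDeriv (cube d R) (Pi.single i 2) u x :=
    ae_all_iff.2 fun i => h.ae_eq _ (by rw [order_single])
  filter_upwards [this] with x hx
  exact Finset.sum_congr rfl fun i _ => by rw [← hx i, single_two]

theorem IsC2Rep.grad_ae (h : IsC2Rep R B u w) :
    ∀ᵐ x ∂volume.restrict (cube d R), grad (cube d R) u x = (jet w x).2 := by
  have : ∀ᵐ x ∂volume.restrict (cube d R), ∀ i : Fin d,
      w (Pi.single i 1) x = weakDeriv (cube d R) (Pi.single i 1) u x :=
    ae_all_iff.2 fun i => h.ae_eq _ (by rw [order_single]; omega)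
  filter_upwards [this] with x hx
  funext i
  exact (hx i).symm

theorem IsC2Rep.viscOp_ae (h : IsC2Rep R B u w) (hu : MemH (cube d R) p u) :
    viscOp (cube d R) ε₀ F u =ᵐ[volume.restrict (cube d R)] viscRep ε₀ F w := by
  filter_upwards [h.lap_ae, h.grad_ae, h.ae_eq_self hu] with x h1 h2 h3
  rw [viscOp, viscRep, h1, h2, ← h3]
  rfl

theorem IsC2Rep.linOp_ae (hF : IsC2On (cube d R) F) (h : IsC2Rep R B u w)
    (hu : MemH (cube d R) p u) (h' : IsC2Rep R B' u' w') (hu' : MemH (cube d R) p u') :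
    linOp (cube d R) ε₀ F u u' =ᵐ[volume.restrict (cube d R)] linRep R ε₀ F w w' := by
  filter_upwards [h.grad_ae, h.ae_eq_self hu, h'.lap_ae, h'.grad_ae, h'.ae_eq_self hu',
    ae_restrict_mem (isOpen_cube d R).measurableSet] with x h1 h2 h3 h4 h5 hx
  rw [linOp, linRep, h1, h3, h4, ← h2, ← h5, jet, jet, hF.derivF_apply hx, add_assoc]

theorem IsC2Rep.bddContOn (h : IsC2Rep R B u w) {α : Fin d → ℕ} (hα : order α ≤ 2) :
    BddContOn (cube d R) (w α) := ⟨h.contOn α hα, B, h.bound α hα⟩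

theorem IsC2Rep.bddContOn_lapRep (h : IsC2Rep R B u w) : BddContOn (cube d R) (lapRep w) :=
  BddContOn.sum fun i _ => h.bddContOn (by rw [order_add, order_single])

theorem IsC2Rep.bddContOn_jetSq (h : IsC2Rep R B u w) : BddContOn (cube d R) (jetSq w) :=
  (h.bddContOn (by rw [order_zero]; omega)).sq.add
    (BddContOn.sum fun i _ => (h.bddContOn (by rw [order_single]; omega)).sq)

theorem IsC2Rep.continuousOn_jet (h : IsC2Rep R B u w) : ContinuousOn (jet w) (cube d R) :=
  (h.contOn 0 (by rw [order_zero]; omega)).prodMk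
    (continuousOn_pi.2 fun i => h.contOn _ (by rw [order_single]; omega))

theorem IsC2Rep.bddContOn_viscRep (hR : 0 < R) (hF : IsC2On (cube d R) F) (h : IsC2Rep R B u w) :
    BddContOn (cube d R) (viscRep ε₀ F w) := by
  obtain ⟨C, _, hC, -⟩ := hF.exists_bounds hR B
  refine ((BddContOn.const (-ε₀)).mul h.bddContOn_lapRep).add ⟨?_, C, fun x hx =>
    hC _ (h.mem_argSet hx)⟩
  exact (ContDiffOn.continuousOn hF).comp (continuousOn_id.prodMk h.continuousOn_jet)
    fun x hx => argSet_subset hR B (h.mem_argSet hx)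

theorem IsC2Rep.bddContOn_linRep (hR : 0 < R) (hF : IsC2On (cube d R) F) (h : IsC2Rep R B u w)
    (h' : IsC2Rep R B' u' w') : BddContOn (cube d R) (linRep R ε₀ F w w') := by
  obtain ⟨C, hC0, -, hC, -⟩ := hF.exists_bounds hR B
  refine ((BddContOn.const (-ε₀)).mul h'.bddContOn_lapRep).add ⟨?_, C * B', fun x hx => ?_⟩
  · have h1 : ContinuousOn (derivF R F) (domF d R) :=
      (ContDiffOn.fderivWithin (m := 1) hF (uniqueDiffOn_domF hR) (by norm_num)).continuousOn
    exact (h1.comp (continuousOn_id.prodMk h.continuousOn_jet)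
      fun x hx => argSet_subset hR B (h.mem_argSet hx)).clm_apply
      (continuousOn_const.prodMk h'.continuousOn_jet)
  · have h2 : ‖((0 : Pt d), jet w' x)‖ ≤ B' := by
      rw [Prod.norm_mk, norm_zero, max_eq_right (norm_nonneg _)]
      exact norm_jet_le fun α hα => h'.bound α (by omega) x hx
    refine ((derivF R F (x, jet w x)).le_opNorm _).trans ?_
    exact mul_le_mul (hC _ (h.mem_argSet hx)) h2 (norm_nonneg _) hC0

theorem IsC2Rep.integral_jetSq (h : IsC2Rep R B u w) :
    ∫ x in cube d R, jetSq w x = sobNorm (cube d R) 1 u ^ 2 := by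
  have hm := (isOpen_cube d R).measurableSet
  have int : ∀ α : Fin d → ℕ, order α ≤ 2 → IntegrableOn (fun x => w α x ^ 2) (cube d R) :=
    fun α hα => (h.bddContOn hα).sq.integrableOn hm (volume_cube_ne_top R)
  have heq : ∀ α : Fin d → ℕ, order α ≤ 2 → ∫ x in cube d R, w α x ^ 2
      = ∫ x in cube d R, weakDeriv (cube d R) α u x ^ 2 := fun α hα =>
    integral_congr_ae ((h.ae_eq α hα).mono fun x hx => by simp only [hx])
  rw [sobNorm_one_sq, ← heq 0 (by rw [order_zero]; omega)]
  simp only [jetSq]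
  rw [integral_add (int 0 (by rw [order_zero]; omega))
    (integrable_finsetSum _ fun i _ => int _ (by rw [order_single]; omega)),
    integral_finsetSum _ fun i _ => int _ (by rw [order_single]; omega)]
  congr 1
  exact Finset.sum_congr rfl fun i _ => heq _ (by rw [order_single]; omega)

end RepLemmas

end Functional

/-! ### The Carleman weight -/

section Weight

variable {n : ℕ} {R r b lam β : ℝ}

theorem continuousOn_weight (hr : R < r) (hb : 0 < b) :
    ContinuousOn (weight r b lam β : Pt (n + 1) → ℝ) (closedCube (n + 1) R) := by
  unfold weight
  refine (continuousOn_const.mul (ContinuousOn.rpow_const (by unfold zc; fun_prop)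
    fun x hx => Or.inl ?_)).rexp
  have := (mem_closedCube.1 hx (Fin.last n)).1
  exact (div_pos (by rw [zc]; linarith) hb).ne'

theorem bddContOn_weight (hr : R < r) (hb : 0 < b) :
    BddContOn (cube (n + 1) R) (weight r b lam β) :=
  BddContOn.of_isCompact (isCompact_closedCube _ R) (cube_subset_closedCube _ R)
    (continuousOn_weight hr hb)

theorem one_le_weight (hr : R < r) (hb : 0 < b) (hlam : 0 ≤ lam) {x : Pt (n + 1)}
    (hx : x ∈ cube (n + 1) R) : 1 ≤ weight r b lam β x := by
  rw [weight, Real.one_le_exp_iff]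
  have : -R < zc x := (hx (Fin.last n)).1
  exact mul_nonneg (by linarith) (Real.rpow_nonneg (div_nonneg (by linarith) hb.le) _)

theorem IsC2Rep.functional_eq {B ε₀ η : ℝ} {p : ℕ} {F : Pt (n + 1) → ℝ → Pt (n + 1) → ℝ}
    {u : Pt (n + 1) → ℝ} {w : (Fin (n + 1) → ℕ) → Pt (n + 1) → ℝ} (h : IsC2Rep R B u w)
    (hu : MemH (cube (n + 1) R) p u) :
    J R r b ε₀ p F lam β η u
      = (∫ x in cube (n + 1) R, weight r b lam β x * viscRep ε₀ F w x ^ 2)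
        + η * sobNorm (cube (n + 1) R) p u ^ 2 := by
  have : (fun x => weight r b lam β x * viscOp (cube (n + 1) R) ε₀ F u x ^ 2)
      =ᵐ[volume.restrict (cube (n + 1) R)] fun x => weight r b lam β x * viscRep ε₀ F w x ^ 2 := by
    filter_upwards [h.viscOp_ae hu] with x hx
    rw [hx]
  rw [J, integral_congr_ae this]

end Weight

/-! ### Strict convexity of the functional -/

section Convexity

/-- The right side equals `(a + D + q)² + 2 L q`, and `(a + s)² ≥ a² / 2 - s²` with `s = D + q`. The
a priori bound `t ≤ T` makes the quadratic remainder linear in `t`, so that its square is again of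
order `t²`. -/
theorem convexity_pointwise {a D q L t T C A L' : ℝ} (hC : 0 ≤ C) (ht0 : 0 ≤ t) (ht : t ≤ T)
    (hD : |D| ≤ C * t) (hq : |q| ≤ C * t ^ 2) (hL : |L| ≤ A) (hL' : L' = L + (a + D) + q) :
    1 / 2 * a ^ 2 - ((C + C * T) ^ 2 + 2 * A * C) * t ^ 2
      ≤ L' ^ 2 - L ^ 2 - 2 * (L * (a + D)) := by
  have hA : 0 ≤ A := (abs_nonneg L).trans hL
  have h1 : |D + q| ≤ (C + C * T) * t := by
    refine (abs_add_le _ _).trans ?_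
    have : C * t ^ 2 ≤ C * T * t := by
      rw [pow_two, ← mul_assoc]
      exact mul_le_mul_of_nonneg_right (mul_le_mul_of_nonneg_left ht hC) ht0
    linarith
  have h2 : (D + q) ^ 2 ≤ ((C + C * T) * t) ^ 2 := by
    rw [← sq_abs (D + q)]
    exact pow_le_pow_left₀ (abs_nonneg _) h1 2
  have h3 : -(A * (C * t ^ 2)) ≤ L * q := by
    have : |L * q| ≤ A * (C * t ^ 2) := by
      rw [abs_mul]; exact mul_le_mul hL hq (abs_nonneg _) hA
    exact (abs_le.1 this).1
  subst hL'
  nlinarith [sq_nonneg (a + 2 * (D + q))]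

/-- The functional is strictly convex for a sufficiently large parameter of the weight. -/
theorem exists_convexityInequality (n : ℕ) {R r b ε₀ M β : ℝ} {p : ℕ}
    (hR : 0 < R) (hr : R < r) (hb : 0 < b) (hε₀ : 0 < ε₀) (hM : 0 < M) {k : ℕ}
    (hk : n + 1 + 1 ≤ 2 * k) (hp : k + 2 ≤ p)
    {F : Pt (n + 1) → ℝ → Pt (n + 1) → ℝ} (hF : IsC2On (cube (n + 1) R) F) (hβ : 1 < β) :
    ∃ lam₀ : ℝ, 1 < lam₀ ∧ ∀ lam : ℝ, lam₀ < lam →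
      ∀ η : ℝ, ∀ f g : Pt (n + 1) → ℝ, ConvexityInequality R r b ε₀ p F M lam β η 1 f g := by
  obtain ⟨Cs, hCs, hrep⟩ := exists_C2_rep_closed (d := n + 1) hR hk hp
  set B := Cs * M
  have hB : 0 ≤ B := by positivity
  obtain ⟨C, hC0, hCF, hCD, -, hCT⟩ := hF.exists_bounds hR B
  -- `A` bounds the residual of any element of the ball; `K` is the loss from `convexity_pointwise`
  -- with `T = B + B`, the bound for a difference. Neither depends on `λ`.
  set A := ε₀ * ((n + 1 : ℕ) * B) + C
  set K := (C + C * (B + B)) ^ 2 + 2 * A * C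
  have hA0 : 0 ≤ A := by positivity
  have hK0 : 0 ≤ K := by positivity
  -- After multiplication by `ε₀² / 2` this factor is `K + 1`: `K` pays for the lower order terms,
  -- and the remaining `1` is the convexity constant.
  obtain ⟨lam₀, hlam₀, hcarl⟩ := exists_carleman_estimate n hR hr hb hβ (2 * (K + 1) / ε₀ ^ 2)
  refine ⟨lam₀, hlam₀, fun lam hlam η f g u hu v hv => ?_⟩
  obtain ⟨⟨huH, huf, hug⟩, huM⟩ := hu
  obtain ⟨⟨hvH, hvf, hvg⟩, hvM⟩ := hv
  obtain ⟨wu, hwu'⟩ := hrep u huH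
  obtain ⟨wv, hwv'⟩ := hrep v hvH
  have hwu : IsC2Rep R B u wu := hwu'.mono (mul_le_mul_of_nonneg_left huM hCs.le)
  have hwv : IsC2Rep R B v wv := hwv'.mono (mul_le_mul_of_nonneg_left hvM hCs.le)
  have hΩ := isOpen_cube (n + 1) R
  have hm := hΩ.measurableSet
  have hsub : v - u = (1 : ℝ) • v + (-1 : ℝ) • u := by
    rw [one_smul, neg_one_smul, sub_eq_add_neg]
  have hhH : MemH (cube (n + 1) R) p (v - u) := hsub ▸ hvH.linear huH 1 (-1)
  set wh : (Fin (n + 1) → ℕ) → Pt (n + 1) → ℝ := fun α => wv α - wu α with hwh_def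
  have hwh : IsC2Rep R (B + B) (v - u) wh := hwv.sub (by omega) hvH huH hwu
  have o0 : order (0 : Fin (n + 1) → ℕ) ≤ 1 := by rw [order_zero]; omega
  have o1 : ∀ i : Fin (n + 1), order (Pi.single i 1 : Fin (n + 1) → ℕ) ≤ 1 := fun i => by
    rw [order_single]
  have o2 : ∀ i j : Fin (n + 1),
      order (Pi.single i 1 + Pi.single j 1 : Fin (n + 1) → ℕ) ≤ 2 := fun i j => by
    rw [order_add, order_single, order_single]
  -- boundary values of the difference
  have hb0 : ∀ x ∈ closedCube (n + 1) R, ∀ j, (x j = R ∨ x j = -R) → wh 0 x = 0 := by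
    intro x hx j hj
    have hfr := mem_frontier_cube hR hx hj
    have hsubF : frontier (cube (n + 1) R) ⊆ closedCube (n + 1) R := by
      rw [← closure_cube hR]; exact frontier_subset_closure
    have e1 := hvf.eq_of_ae_eq hR hsubF (hwv.cont 0 o0) (hwv.ae_eq_self hvH) hfr
    have e2 := huf.eq_of_ae_eq hR hsubF (hwu.cont 0 o0) (hwu.ae_eq_self huH) hfr
    simp [hwh_def, e1, e2]
  have hgrad0 : ∀ x ∈ cube (n + 1) R, HasGrad (wh 0) (fun i => wh (Pi.single i 1) x) x :=
    fun x hx => (hwh.family.hasGrad (α := 0) (by rw [order_zero]; omega) hx).congr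
      fun i => by rw [zero_add]
  have hgrad1 : ∀ i, ∀ x ∈ cube (n + 1) R, HasGrad (wh (Pi.single i 1))
      (fun j => wh (Pi.single i 1 + Pi.single j 1) x) x :=
    fun i x hx => hwh.family.hasGrad (by rw [order_single]; omega) hx
  have htop : ∀ x ∈ closedCube (n + 1) R, zc x = R → wh (Pi.single (Fin.last n) 1) x = 0 := by
    intro x hx hxR
    have hmem : x ∈ gammaPlus n R := ⟨hxR, fun i _ => abs_le.2 (mem_closedCube.1 hx i)⟩
    have hsubG : gammaPlus n R ⊆ closedCube (n + 1) R := by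
      intro y hy
      refine mem_closedCube.2 fun i => ?_
      by_cases hi : i = Fin.last n
      · have : y i = R := by rw [hi]; exact hy.1
        constructor <;> linarith
      · exact abs_le.1 (hy.2 i hi)
    have e1 := hvg.eq_of_ae_eq hR hsubG (hwv.cont _ (o1 _)) (hwv.ae_eq _ ((o1 _).trans (by omega)))
      hmem
    have e2 := hug.eq_of_ae_eq hR hsubG (hwu.cont _ (o1 _)) (hwu.ae_eq _ ((o1 _).trans (by omega)))
      hmem
    simp [hwh_def, e1, e2]
  have hcarl' := hcarl lam hlam (wh 0) (fun i => wh (Pi.single i 1))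
    (fun i j => wh (Pi.single i 1 + Pi.single j 1)) (hwh.cont 0 o0).continuousOn
    (fun i => (hwh.cont _ (o1 i)).continuousOn) (fun i j => hwh.bddContOn (o2 i j))
    (fun i j => congrArg wh (add_comm _ _)) hgrad0 hgrad1 hb0
    (fun x hx i j hij hj => tangential_derivative_eq_zero hR (hwh.cont 0 o0)
      (fun i => hwh.cont _ (o1 i)) hgrad0 hb0 hx hij hj) htop
  -- the functionals in terms of the representatives
  set Wt : Pt (n + 1) → ℝ := weight r b lam β with hWt
  have hW : BddContOn (cube (n + 1) R) Wt := bddContOn_weight hr hb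
  have bLu : BddContOn (cube (n + 1) R) (viscRep ε₀ F wu) := hwu.bddContOn_viscRep hR hF
  have bLv : BddContOn (cube (n + 1) R) (viscRep ε₀ F wv) := hwv.bddContOn_viscRep hR hF
  have bl : BddContOn (cube (n + 1) R) (linRep R ε₀ F wu wh) := hwu.bddContOn_linRep hR hF hwh
  have int : ∀ {φ : Pt (n + 1) → ℝ}, BddContOn (cube (n + 1) R) φ → IntegrableOn φ (cube (n + 1) R) :=
    fun h => h.integrableOn hm (volume_cube_ne_top R)
  have hJu := hwu.functional_eq (r := r) (b := b) (ε₀ := ε₀) (F := F) (lam := lam) (β := β) (η := η) huH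
  have hJv := hwv.functional_eq (r := r) (b := b) (ε₀ := ε₀) (F := F) (lam := lam) (β := β) (η := η) hvH
  have hDJ : DJ R r b ε₀ p F lam β η u (v - u)
      = 2 * (∫ x in cube (n + 1) R, Wt x * viscRep ε₀ F wu x * linRep R ε₀ F wu wh x)
      + 2 * η * sobInner (cube (n + 1) R) p u (v - u) := by
    have : (fun x => weight r b lam β x * viscOp (cube (n + 1) R) ε₀ F u x
        * linOp (cube (n + 1) R) ε₀ F u (v - u) x) =ᵐ[volume.restrict (cube (n + 1) R)]
        fun x => Wt x * viscRep ε₀ F wu x * linRep R ε₀ F wu wh x := by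
      filter_upwards [hwu.viscOp_ae huH, hwu.linOp_ae hF huH hwh hhH] with x h1 h2
      rw [h1, h2]
    rw [DJ, integral_congr_ae this]
  -- In a Hilbert space the second-order expansion of the squared norm is exact, which gives the
  -- regularization term with equality.
  have hnorm : sobNorm (cube (n + 1) R) p v ^ 2 = sobNorm (cube (n + 1) R) p u ^ 2
      + 2 * sobInner (cube (n + 1) R) p u (v - u) + sobNorm (cube (n + 1) R) p (v - u) ^ 2 := by
    have := huH.sobNorm_linear_sq hΩ hhH 1 1
    rw [one_smul, one_smul, add_sub_cancel] at this
    rw [this]; ring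
  -- the integral inequality
  have hpt : ∀ x ∈ cube (n + 1) R, Wt x * (1 / 2 * ε₀ ^ 2 * lapRep wh x ^ 2) - Wt x * (K * jetSq wh x)
      ≤ Wt x * viscRep ε₀ F wv x ^ 2 - Wt x * viscRep ε₀ F wu x ^ 2
        - 2 * (Wt x * viscRep ε₀ F wu x * linRep R ε₀ F wu wh x) := by
    intro x hx
    have hW0 : 0 ≤ Wt x := zero_le_one.trans (one_le_weight hr hb (by linarith) hx)
    have hjet : jet wv x - jet wu x = jet wh x := rfl
    have hpq : ((x, jet wv x) : Pt (n + 1) × ℝ × Pt (n + 1)) - (x, jet wu x) = (0, jet wh x) := by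
      rw [Prod.mk_sub_mk, sub_self, hjet]
    have hnj : ‖((0 : Pt (n + 1)), jet wh x)‖ = ‖jet wh x‖ := by
      rw [Prod.norm_mk, norm_zero, max_eq_right (norm_nonneg _)]
    have hT := hCT _ (hwu.mem_argSet hx) _ (hwv.mem_argSet hx)
    rw [hpq, hnj] at hT
    have hD : |derivF R F (x, jet wu x) (0, jet wh x)| ≤ C * ‖jet wh x‖ := by
      rw [← hnj]
      exact ((derivF R F (x, jet wu x)).le_opNorm _).trans
        (mul_le_mul_of_nonneg_right (hCD _ (hwu.mem_argSet hx)) (norm_nonneg _))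
    have hlap : lapRep wh x = lapRep wv x - lapRep wu x := by
      simp only [lapRep, hwh_def, Pi.sub_apply, Finset.sum_sub_distrib]
    have hLA : |viscRep ε₀ F wu x| ≤ A := by
      refine (abs_add_le _ _).trans (add_le_add ?_ (hCF _ (hwu.mem_argSet hx)))
      rw [abs_mul, abs_neg, abs_of_pos hε₀]
      refine mul_le_mul_of_nonneg_left ?_ hε₀.le
      refine (Finset.abs_sum_le_sum_abs _ _).trans ?_
      calc _ ≤ ∑ _i : Fin (n + 1), B := Finset.sum_le_sum fun i _ => hwu.bound _ (o2 i i) x hx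
        _ = _ := by simp
    have key := convexity_pointwise (a := -ε₀ * lapRep wh x) hC0 (norm_nonneg (jet wh x))
      (norm_jet_le fun α hα => hwh.bound α (by omega) x hx) hD hT hLA
      (L' := viscRep ε₀ F wv x) (by
        simp only [viscRep, hlap]; ring)
    have hK : K * ‖jet wh x‖ ^ 2 ≤ K * jetSq wh x :=
      mul_le_mul_of_nonneg_left (norm_jet_sq_le wh x) hK0
    have h2 : 1 / 2 * ε₀ ^ 2 * lapRep wh x ^ 2 - K * jetSq wh x
        ≤ viscRep ε₀ F wv x ^ 2 - viscRep ε₀ F wu x ^ 2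
          - 2 * (viscRep ε₀ F wu x * linRep R ε₀ F wu wh x) := by
      have e : linRep R ε₀ F wu wh x
        = -ε₀ * lapRep wh x + derivF R F (x, jet wu x) (0, jet wh x) := rfl
      rw [e]
      linarith
    have h3 := mul_le_mul_of_nonneg_left h2 hW0
    linarith
  have i1 := int (hW.mul ((BddContOn.const (1 / 2 * ε₀ ^ 2)).mul hwh.bddContOn_lapRep.sq))
  have i2 := int (hW.mul ((BddContOn.const K).mul hwh.bddContOn_jetSq))
  have i3 := int (hW.mul bLv.sq)
  have i4 := int (hW.mul bLu.sq)
  have i5 := int ((BddContOn.const 2).mul ((hW.mul bLu).mul bl))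
  have i34 : IntegrableOn (fun x => Wt x * viscRep ε₀ F wv x ^ 2 - Wt x * viscRep ε₀ F wu x ^ 2)
    (cube (n + 1) R) := i3.sub i4
  have hint := setIntegral_mono_on (i1.sub i2) (i34.sub i5) hm hpt
  simp only [Pi.sub_apply] at hint
  rw [integral_sub i1 i2, integral_sub i34 i5, integral_sub i3 i4, integral_const_mul] at hint
  have e1 : ∫ x in cube (n + 1) R, Wt x * (1 / 2 * ε₀ ^ 2 * lapRep wh x ^ 2)
      = 1 / 2 * ε₀ ^ 2 * ∫ x in cube (n + 1) R, Wt x * lapRep wh x ^ 2 := by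
    rw [← integral_const_mul]; congr 1; funext x; ring
  have e2 : ∫ x in cube (n + 1) R, Wt x * (K * jetSq wh x)
      = K * ∫ x in cube (n + 1) R, Wt x * jetSq wh x := by
    rw [← integral_const_mul]; congr 1; funext x; ring
  rw [e1, e2] at hint
  have hc2 : 2 * (K + 1) / ε₀ ^ 2 * ∫ x in cube (n + 1) R, Wt x * jetSq wh x
      ≤ ∫ x in cube (n + 1) R, Wt x * lapRep wh x ^ 2 := hcarl'
  have hc3 : (K + 1) * ∫ x in cube (n + 1) R, Wt x * jetSq wh x
      ≤ 1 / 2 * ε₀ ^ 2 * ∫ x in cube (n + 1) R, Wt x * lapRep wh x ^ 2 := by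
    have h1 := mul_le_mul_of_nonneg_left hc2 (by positivity : (0 : ℝ) ≤ 1 / 2 * ε₀ ^ 2)
    refine le_trans (le_of_eq ?_) h1
    field_simp
  have hlow : sobNorm (cube (n + 1) R) 1 (v - u) ^ 2
      ≤ ∫ x in cube (n + 1) R, Wt x * jetSq wh x := by
    rw [← hwh.integral_jetSq]
    refine setIntegral_mono_on (int hwh.bddContOn_jetSq) (int (hW.mul hwh.bddContOn_jetSq)) hm
      fun x hx => ?_
    refine le_mul_of_one_le_left ?_ (one_le_weight hr hb (by linarith) hx)
    exact (sq_nonneg _).trans (norm_jet_sq_le wh x)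
  rw [hJu, hJv, hDJ, hnorm, one_mul]
  linarith

end Convexity

/-! ### Linear combinations of admissible functions -/

section DataSets

variable {d n p : ℕ} {R M : ℝ}

theorem MemH.mono {Ω : Set (Pt d)} {k l : ℕ} {u : Pt d → ℝ} (hu : MemH Ω l u) (hkl : k ≤ l) :
    MemH Ω k u := ⟨hu.1, fun α hα => hu.2 α (hα.trans hkl)⟩

theorem HasBoundaryValue.linear {Ω S : Set (Pt d)} {u u' v f f' : Pt d → ℝ}
    (h : HasBoundaryValue Ω S u f) (h' : HasBoundaryValue Ω S u' f') (a b : ℝ)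
    (hv : v =ᵐ[volume.restrict Ω] fun x => a * u x + b * u' x) :
    HasBoundaryValue Ω S v (a • f + b • f') := by
  obtain ⟨w, hw, hwu, hwf⟩ := h
  obtain ⟨w', hw', hwu', hwf'⟩ := h'
  refine ⟨a • w + b • w', (hw.const_smul a).add (hw'.const_smul b), ?_, fun x hx => ?_⟩
  · filter_upwards [hv, hwu, hwu'] with x h1 h2 h3
    simp [h1, h2, h3]
  · simp [hwf x hx, hwf' x hx]

theorem dataSet_linear (hp : 1 ≤ p) {f f' g g' u u' : Pt (n + 1) → ℝ} (hu : u ∈ dataSet R p f g)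
    (hu' : u' ∈ dataSet R p f' g') (a b : ℝ) :
    a • u + b • u' ∈ dataSet R p (a • f + b • f') (a • g + b • g') := by
  obtain ⟨h1, h2, h3⟩ := hu
  obtain ⟨h1', h2', h3'⟩ := hu'
  exact ⟨h1.linear h1' a b, h2.linear h2' a b (Eventually.of_forall fun x => rfl),
    h3.linear h3' a b (h1.weakDeriv_linear (isOpen_cube _ R) h1' a b
      (by rw [order_single]; exact hp))⟩

theorem midpoint_mem_dataBall (hp : 1 ≤ p) {f g u v : Pt (n + 1) → ℝ} (hu : u ∈ dataBall R p M f g)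
    (hv : v ∈ dataBall R p M f g) :
    (1 / 2 : ℝ) • u + (1 / 2 : ℝ) • v ∈ dataBall R p M f g := by
  have half : ∀ φ : Pt (n + 1) → ℝ, (1 / 2 : ℝ) • φ + (1 / 2 : ℝ) • φ = φ := fun φ => by
    rw [← add_smul]; norm_num
  constructor
  · have := dataSet_linear hp hu.1 hv.1 (1 / 2) (1 / 2)
    rwa [half, half] at this
  · have := hu.1.1.sobNorm_linear_le (isOpen_cube _ R) hv.1.1 (1 / 2) (1 / 2)
    rw [abs_of_pos (by norm_num)] at this
    linarith [hu.2, hv.2]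

end DataSets

/-! ### Distance to a minimizer -/

section Linearity

variable {d n p : ℕ} {R r b ε₀ lam β η : ℝ}

theorem MemH.linOp_neg_ae {Ω : Set (Pt d)} (hΩ : IsOpen Ω) {F : Pt d → ℝ → Pt d → ℝ}
    {u h : Pt d → ℝ} (hp : 2 ≤ p) (hh : MemH Ω p h) :
    linOp Ω ε₀ F u (-h) =ᵐ[volume.restrict Ω] -linOp Ω ε₀ F u h := by
  have hneg : -h = (-1 : ℝ) • h + (0 : ℝ) • h := by simp
  have key : ∀ α : Fin d → ℕ, order α ≤ 2 → ∀ᵐ x ∂volume.restrict Ω,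
      weakDeriv Ω α (-h) x = -weakDeriv Ω α h x := fun α hα => by
    rw [hneg]
    filter_upwards [hh.weakDeriv_linear hΩ hh (-1) 0 (hα.trans hp)] with x hx
    rw [hx]; ring
  have k1 : ∀ᵐ x ∂volume.restrict Ω, ∀ i : Fin d, weakDeriv Ω (Pi.single i 1) (-h) x
      = -weakDeriv Ω (Pi.single i 1) h x :=
    ae_all_iff.2 fun i => key _ (by rw [order_single]; omega)
  have k2 : ∀ᵐ x ∂volume.restrict Ω, ∀ i : Fin d, weakDeriv Ω (Pi.single i 2) (-h) x
      = -weakDeriv Ω (Pi.single i 2) h x :=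
    ae_all_iff.2 fun i => key _ (by rw [order_single])
  filter_upwards [k1, k2] with x h1 h2
  have e1 : lap Ω (-h) x = -lap Ω h x := by simp [lap, h2]
  have e2 : grad Ω (-h) x = -grad Ω h x := funext h1
  rw [Pi.neg_apply, linOp, linOp, e1, e2, map_neg, Pi.neg_apply]
  ring

/-- At a midpoint the two increments are opposite, so oddness is all that is needed to cancel the
derivative terms. -/
theorem MemH.DJ_neg {F : Pt (n + 1) → ℝ → Pt (n + 1) → ℝ} {u h : Pt (n + 1) → ℝ} (hp : 2 ≤ p)
    (hu : MemH (cube (n + 1) R) p u) (hh : MemH (cube (n + 1) R) p h) :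
    DJ R r b ε₀ p F lam β η u (-h) = -DJ R r b ε₀ p F lam β η u h := by
  have hΩ := isOpen_cube (n + 1) R
  have h1 : (fun x => weight r b lam β x * viscOp (cube (n + 1) R) ε₀ F u x
        * linOp (cube (n + 1) R) ε₀ F u (-h) x) =ᵐ[volume.restrict (cube (n + 1) R)]
      fun x => -(weight r b lam β x * viscOp (cube (n + 1) R) ε₀ F u x
        * linOp (cube (n + 1) R) ε₀ F u h x) := by
    filter_upwards [hh.linOp_neg_ae hΩ (ε₀ := ε₀) (F := F) (u := u) hp] with x hx
    rw [hx, Pi.neg_apply, mul_neg]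
  have h2 : sobInner (cube (n + 1) R) p u (-h) = -sobInner (cube (n + 1) R) p u h := by
    have := hu.sobInner_linear_right hΩ hh hh (-1) 0
    rw [show (-1 : ℝ) • h + (0 : ℝ) • h = -h by simp] at this
    rw [this]; ring
  rw [DJ, DJ, integral_congr_ae h1, integral_neg, h2]
  ring

theorem J_nonneg {F : Pt (n + 1) → ℝ → Pt (n + 1) → ℝ} (hη : 0 ≤ η) (u : Pt (n + 1) → ℝ) :
    0 ≤ J R r b ε₀ p F lam β η u :=
  add_nonneg (integral_nonneg fun _ => mul_nonneg (Real.exp_pos _).le (sq_nonneg _))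
    (mul_nonneg hη (sq_nonneg _))

theorem le_J {F : Pt (n + 1) → ℝ → Pt (n + 1) → ℝ} (u : Pt (n + 1) → ℝ) :
    η * sobNorm (cube (n + 1) R) p u ^ 2 ≤ J R r b ε₀ p F lam β η u :=
  le_add_of_nonneg_left (integral_nonneg fun _ => mul_nonneg (Real.exp_pos _).le (sq_nonneg _))

/-- The distance to a minimizer is controlled by the value of a strictly convex functional. -/
theorem IsMinimizer.sobNorm_sub_sq_le {F : Pt (n + 1) → ℝ → Pt (n + 1) → ℝ} {M c : ℝ}
    {f g u v : Pt (n + 1) → ℝ} (hp : 2 ≤ p) (hη : 0 ≤ η)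
    (hconv : ConvexityInequality R r b ε₀ p F M lam β η c f g)
    (hu : IsMinimizer R r b ε₀ p F M lam β η f g u) (hv : v ∈ dataBall R p M f g) :
    c / 2 * sobNorm (cube (n + 1) R) 1 (v - u) ^ 2 ≤ J R r b ε₀ p F lam β η v := by
  have hΩ := isOpen_cube (n + 1) R
  set m := (1 / 2 : ℝ) • u + (1 / 2 : ℝ) • v with hm
  have hmB : m ∈ dataBall R p M f g := midpoint_mem_dataBall (by omega) hu.1 hv
  set k := v - m with hk
  have huk : u - m = -k := by
    funext x
    simp only [hk, hm, Pi.sub_apply, Pi.add_apply, Pi.neg_apply, Pi.smul_apply, smul_eq_mul]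
    ring
  have hvu : v - u = (2 : ℝ) • k + (0 : ℝ) • k := by
    funext x
    simp only [hk, hm, Pi.sub_apply, Pi.add_apply, Pi.smul_apply, smul_eq_mul]
    ring
  have hkH : MemH (cube (n + 1) R) p k := by
    have := hv.1.1.linear hmB.1.1 1 (-1)
    rwa [one_smul, neg_one_smul, ← sub_eq_add_neg] at this
  -- Adding the two inequalities gives `J v + J u - 2 J m ≥ 2 c ‖k‖²`, in which no derivative at the
  -- minimizer appears. Then `J u ≤ J m` and `0 ≤ J m` leave `J v`, and `v - u = 2 k` turns `2 c`
  -- into `c / 2`.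
  have h1 := hconv m hmB v hv
  have h2 := hconv m hmB u hu.1
  rw [huk, hmB.1.1.DJ_neg hp hkH] at h2
  have hneg : ∀ l ≤ p, sobNorm (cube (n + 1) R) l (-k) ^ 2 = sobNorm (cube (n + 1) R) l k ^ 2 := by
    intro l hl
    have := (hkH.mono hl).sobNorm_linear_sq hΩ (hkH.mono hl) (-1) 0
    rw [show (-1 : ℝ) • k + (0 : ℝ) • k = -k by simp] at this
    rw [this]; ring
  rw [hneg 1 (by omega), hneg p le_rfl] at h2
  have h3 := hu.2 m hmB
  have h4 := J_nonneg (R := R) (r := r) (b := b) (ε₀ := ε₀) (p := p) (lam := lam) (β := β) (F := F)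
    hη m
  have h5 : 0 ≤ η * sobNorm (cube (n + 1) R) p k ^ 2 := mul_nonneg hη (sq_nonneg _)
  have h6 : sobNorm (cube (n + 1) R) 1 (v - u) ^ 2 = 4 * sobNorm (cube (n + 1) R) 1 k ^ 2 := by
    rw [hvu, (hkH.mono (by omega)).sobNorm_linear_sq hΩ (hkH.mono (by omega))]
    ring
  rw [h6]
  linarith

end Linearity

/-! ### Stability with respect to noise -/

section Stability

variable {n p k : ℕ} {R r b ε₀ M β lam : ℝ}

theorem IsC2Rep.integral_lapRep_sq_le {d : ℕ} {B : ℝ} {u : Pt d → ℝ}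
    {w : (Fin d → ℕ) → Pt d → ℝ} (h : IsC2Rep R B u w) (hp : 2 ≤ p) :
    ∫ x in cube d R, lapRep w x ^ 2 ≤ (d : ℝ) ^ 2 * sobNorm (cube d R) p u ^ 2 := by
  have hm := (isOpen_cube d R).measurableSet
  have o2 : ∀ i : Fin d, order (Pi.single i 1 + Pi.single i 1 : Fin d → ℕ) ≤ 2 := fun i => by
    rw [order_add, order_single]
  have int : ∀ i : Fin d, IntegrableOn (fun x => w (Pi.single i 1 + Pi.single i 1) x ^ 2)
      (cube d R) := fun i => (h.bddContOn (o2 i)).sq.integrableOn hm (volume_cube_ne_top R)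
  have hle : ∀ i : Fin d, ∫ x in cube d R, w (Pi.single i 1 + Pi.single i 1) x ^ 2
      ≤ sobNorm (cube d R) p u ^ 2 := fun i => by
    refine le_trans (le_of_eq ?_) (integral_weakDeriv_sq_le u ((o2 i).trans hp))
    exact integral_congr_ae ((h.ae_eq _ (o2 i)).mono fun x hx => by simp only [hx])
  calc ∫ x in cube d R, lapRep w x ^ 2
      ≤ ∫ x in cube d R, (d : ℝ) * ∑ i, w (Pi.single i 1 + Pi.single i 1) x ^ 2 := by
        refine setIntegral_mono_on (h.bddContOn_lapRep.sq.integrableOn hm (volume_cube_ne_top R))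
          ((integrable_finsetSum _ fun i _ => int i).const_mul _) hm fun x _ => ?_
        have := sq_sum_le_card_mul_sum_sq (s := (Finset.univ : Finset (Fin d)))
          (f := fun i => w (Pi.single i 1 + Pi.single i 1) x)
        simpa [lapRep] using this
    _ = d * ∑ i, ∫ x in cube d R, w (Pi.single i 1 + Pi.single i 1) x ^ 2 := by
        rw [integral_const_mul, integral_finsetSum _ fun i _ => int i]
    _ ≤ d * ∑ _i : Fin d, sobNorm (cube d R) p u ^ 2 :=
        mul_le_mul_of_nonneg_left (Finset.sum_le_sum fun i _ => hle i) (Nat.cast_nonneg d)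
    _ = _ := by simp; ring

/-- The functional is small at small perturbations of solutions. -/
theorem exists_J_le (hR : 0 < R) (hr : R < r) (hb : 0 < b)
    (hk : n + 1 + 1 ≤ 2 * k) (hp : k + 2 ≤ p)
    {F : Pt (n + 1) → ℝ → Pt (n + 1) → ℝ} (hF : IsC2On (cube (n + 1) R) F) (lam β ε₀ : ℝ) :
    ∃ C : ℝ, 0 ≤ C ∧ ∀ η : ℝ, ∀ u v : Pt (n + 1) → ℝ,
      MemH (cube (n + 1) R) p u → MemH (cube (n + 1) R) p v →
      sobNorm (cube (n + 1) R) p u ≤ M → sobNorm (cube (n + 1) R) p v ≤ M →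
      (∀ᵐ x ∂volume.restrict (cube (n + 1) R), viscOp (cube (n + 1) R) ε₀ F u x = 0) →
      J R r b ε₀ p F lam β η v ≤ C * sobNorm (cube (n + 1) R) p (v - u) ^ 2
        + η * sobNorm (cube (n + 1) R) p v ^ 2 := by
  obtain ⟨Cs, hCs, hrep⟩ := exists_C2_rep_closed (d := n + 1) hR hk hp
  obtain ⟨C, hC0, -, -, hCL, -⟩ := hF.exists_bounds hR (Cs * M)
  obtain ⟨hWc, Wm, hWm⟩ := bddContOn_weight (n := n) (R := R) (lam := lam) (β := β) hr hb
  have hm := (isOpen_cube (n + 1) R).measurableSet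
  refine ⟨|Wm| * (2 * ε₀ ^ 2 * ((n + 1 : ℕ) : ℝ) ^ 2 + 2 * C ^ 2), by positivity,
    fun η u v huH hvH huM hvM hu0 => ?_⟩
  obtain ⟨wu, hwu'⟩ := hrep u huH
  obtain ⟨wv, hwv'⟩ := hrep v hvH
  have hwu := hwu'.mono (mul_le_mul_of_nonneg_left huM hCs.le)
  have hwv := hwv'.mono (mul_le_mul_of_nonneg_left hvM hCs.le)
  have hwh := hwv.sub (by omega) hvH huH hwu
  set wh : (Fin (n + 1) → ℕ) → Pt (n + 1) → ℝ := fun α => wv α - wu α with hwh_def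
  have bW := bddContOn_weight (n := n) (R := R) (lam := lam) (β := β) hr hb
  have int : ∀ {φ : Pt (n + 1) → ℝ}, BddContOn (cube (n + 1) R) φ →
      IntegrableOn φ (cube (n + 1) R) := fun h => h.integrableOn hm (volume_cube_ne_top R)
  have b1 := (BddContOn.const (|Wm| * (2 * ε₀ ^ 2))).mul hwh.bddContOn_lapRep.sq
  have b2 := (BddContOn.const (|Wm| * (2 * C ^ 2))).mul hwh.bddContOn_jetSq
  have hpt : ∀ᵐ x ∂volume.restrict (cube (n + 1) R), weight r b lam β x * viscRep ε₀ F wv x ^ 2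
      ≤ |Wm| * (2 * ε₀ ^ 2) * lapRep wh x ^ 2 + |Wm| * (2 * C ^ 2) * jetSq wh x := by
    filter_upwards [hu0, hwu.viscOp_ae (ε₀ := ε₀) (F := F) huH, ae_restrict_mem hm] with x h0 h1 hx
    have hz : viscRep ε₀ F wu x = 0 := h1 ▸ h0
    have hnj : ‖((x, jet wv x) : Pt (n + 1) × ℝ × Pt (n + 1)) - (x, jet wu x)‖ = ‖jet wh x‖ := by
      have hjet : jet wv x - jet wu x = jet wh x := rfl
      rw [Prod.mk_sub_mk, sub_self, hjet, Prod.norm_mk, norm_zero, max_eq_right (norm_nonneg _)]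
    have hL := hCL _ (hwu.mem_argSet hx) _ (hwv.mem_argSet hx)
    rw [hnj] at hL
    have hlap : lapRep wh x = lapRep wv x - lapRep wu x := by
      simp only [lapRep, hwh_def, Pi.sub_apply, Finset.sum_sub_distrib]
    set q := uncurryF F (x, jet wv x) - uncurryF F (x, jet wu x)
    -- The residual at `u` is zero, so the residual at `v` is a difference, linear in `Δ(v - u)` and
    -- Lipschitz in the lower order terms.
    have hv : viscRep ε₀ F wv x = -ε₀ * lapRep wh x + q := by
      rw [← sub_zero (viscRep ε₀ F wv x), ← hz, hlap, viscRep, viscRep]; ring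
    have hq : q ^ 2 ≤ C ^ 2 * jetSq wh x := by
      calc q ^ 2 = |q| ^ 2 := (sq_abs q).symm
        _ ≤ (C * ‖jet wh x‖) ^ 2 := pow_le_pow_left₀ (abs_nonneg _) hL 2
        _ = C ^ 2 * ‖jet wh x‖ ^ 2 := mul_pow _ _ _
        _ ≤ _ := mul_le_mul_of_nonneg_left (norm_jet_sq_le wh x) (sq_nonneg C)
    have hv2 : viscRep ε₀ F wv x ^ 2 ≤ 2 * ε₀ ^ 2 * lapRep wh x ^ 2 + 2 * C ^ 2 * jetSq wh x := by
      rw [hv]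
      nlinarith [sq_nonneg (-ε₀ * lapRep wh x - q)]
    calc weight r b lam β x * viscRep ε₀ F wv x ^ 2 ≤ |Wm| * viscRep ε₀ F wv x ^ 2 :=
          mul_le_mul_of_nonneg_right (((le_abs_self _).trans (hWm x hx)).trans (le_abs_self _))
            (sq_nonneg _)
      _ ≤ |Wm| * (2 * ε₀ ^ 2 * lapRep wh x ^ 2 + 2 * C ^ 2 * jetSq wh x) :=
          mul_le_mul_of_nonneg_left hv2 (abs_nonneg _)
      _ = _ := by ring
  have hint := integral_mono_ae (int (bW.mul (hwv.bddContOn_viscRep (ε₀ := ε₀) hR hF).sq))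
    ((int b1).add (int b2)) hpt
  simp only [Pi.add_apply] at hint
  rw [integral_add (int b1) (int b2), integral_const_mul, integral_const_mul,
    hwh.integral_jetSq] at hint
  have h1 := mul_le_mul_of_nonneg_left (hwh.integral_lapRep_sq_le (p := p) (by omega))
    (by positivity : 0 ≤ |Wm| * (2 * ε₀ ^ 2))
  have h2 := mul_le_mul_of_nonneg_left (pow_le_pow_left₀ (sobNorm_nonneg _ 1 (v - u))
    (sobNorm_mono (Ω := cube (n + 1) R) (by omega : 1 ≤ p) (v - u)) 2)
    (by positivity : 0 ≤ |Wm| * (2 * C ^ 2))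
  rw [hwv.functional_eq hvH]
  linarith

/-- The parallelogram law with the difference term dropped. -/
theorem MemH.sobNorm_add_sq_le {d : ℕ} {Ω : Set (Pt d)} (hΩ : IsOpen Ω) {u v : Pt d → ℝ}
    (hu : MemH Ω p u) (hv : MemH Ω p v) :
    sobNorm Ω p (u + v) ^ 2 ≤ 2 * sobNorm Ω p u ^ 2 + 2 * sobNorm Ω p v ^ 2 := by
  have h1 := hu.sobNorm_linear_sq hΩ hv 1 1
  have h2 := hu.sobNorm_linear_sq hΩ hv 1 (-1)
  rw [one_smul, one_smul] at h1
  linarith [sq_nonneg (sobNorm Ω p ((1 : ℝ) • u + (-1 : ℝ) • v))]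

theorem MemH.sobNorm_sub_sq_le {d : ℕ} {Ω : Set (Pt d)} (hΩ : IsOpen Ω) {u v : Pt d → ℝ}
    (hu : MemH Ω p u) (hv : MemH Ω p v) :
    sobNorm Ω p (u - v) ^ 2 ≤ 2 * sobNorm Ω p u ^ 2 + 2 * sobNorm Ω p v ^ 2 := by
  have h1 := hu.sobNorm_linear_sq hΩ hv 1 1
  have h2 := hu.sobNorm_linear_sq hΩ hv 1 (-1)
  rw [one_smul, neg_one_smul, ← sub_eq_add_neg] at h2
  linarith [sq_nonneg (sobNorm Ω p ((1 : ℝ) • u + (1 : ℝ) • v))]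

/-- The constant must not depend on `η`. If `η ≤ 1`, then `η E ≤ δ²` and the bound on `D` from
convexity suffices. If `η > 1`, dividing the bound on `η N` by `η` controls the minimizer itself,
and `U ≤ η U` finishes without convexity. The constant is the sum of those of the two cases. -/
theorem stability_arithmetic {c C η δ E U N D A : ℝ} (hc : 0 < c) (hC : 0 ≤ C) (hη : 0 < η)
    (hA : A ≤ 2 * E + 2 * D) (hAN : A ≤ 2 * N + 2 * U)
    (hE : E ≤ δ ^ 2) (hU : 0 ≤ U)
    (hD : c / 2 * D ≤ C * E + η * (2 * U + 2 * E)) (hN : η * N ≤ C * E + η * (2 * U + 2 * E)) :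
    A ≤ (2 + 4 / c * (C + 2) + 2 * C + 6) * (η * U + δ ^ 2) := by
  have hηU : 0 ≤ η * U := mul_nonneg hη.le hU
  have hδ : 0 ≤ δ ^ 2 := sq_nonneg δ
  have hc4 : 0 < 4 / c := by positivity
  have hCE : C * E ≤ C * δ ^ 2 := mul_le_mul_of_nonneg_left hE hC
  rcases le_or_gt η 1 with h1 | h1
  · have hηE : η * E ≤ δ ^ 2 :=
      (mul_le_mul_of_nonneg_left hE hη.le).trans (mul_le_of_le_one_left hδ h1)
    have hD' : 2 * D ≤ 4 / c * ((C + 2) * (η * U + δ ^ 2)) := by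
      have : c / 2 * D ≤ (C + 2) * (η * U + δ ^ 2) := by
        nlinarith [mul_nonneg hC hηU]
      have h2 := mul_le_mul_of_nonneg_left this hc4.le
      refine le_trans (le_of_eq ?_) h2
      field_simp
      ring
    have : 0 ≤ (2 * C + 6) * (η * U + δ ^ 2) := by positivity
    nlinarith
  · have hUη : U ≤ η * U := le_mul_of_one_le_left hU h1.le
    have hN' : N ≤ C * δ ^ 2 + 2 * U + 2 * δ ^ 2 := by
      have h2 : η * (N - 2 * U - 2 * E) ≤ C * δ ^ 2 := by linarith
      have h3 : η * (N - 2 * U - 2 * E) ≤ η * (C * δ ^ 2) :=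
        h2.trans (le_mul_of_one_le_left (mul_nonneg hC hδ) h1.le)
      linarith [le_of_mul_le_mul_left h3 hη]
    have h4 : 0 ≤ (2 + 4 / c * (C + 2)) * (η * U + δ ^ 2) := by positivity
    nlinarith [mul_nonneg hC hηU]

/-- Stability of minimizers with respect to noise in the data. -/
theorem exists_stability (hR : 0 < R) (hr : R < r) (hb : 0 < b)
    (hk : n + 1 + 1 ≤ 2 * k) (hp : k + 2 ≤ p)
    {F : Pt (n + 1) → ℝ → Pt (n + 1) → ℝ} (hF : IsC2On (cube (n + 1) R) F) (lam β ε₀ : ℝ)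
    {c : ℝ} (hc : 0 < c) :
    ∃ C : ℝ, 0 < C ∧ ∀ η : ℝ, 0 < η → ∀ δ : ℝ, 0 < δ →
      ∀ fs gs fd gd : Pt (n + 1) → ℝ,
        ConvexityInequality R r b ε₀ p F M lam β η c fd gd →
        (∃ err ∈ dataSet R p (fd - fs) (gd - gs), sobNorm (cube (n + 1) R) p err ≤ δ) →
        ∀ uε : Pt (n + 1) → ℝ, IsSolution R ε₀ p F fs gs uε →
          sobNorm (cube (n + 1) R) p uε < M - δ →
        ∀ umin : Pt (n + 1) → ℝ, IsMinimizer R r b ε₀ p F M lam β η fd gd umin →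
          sobNorm (cube (n + 1) R) 1 (umin - uε) ^ 2 ≤
            C * (η * sobNorm (cube (n + 1) R) p uε ^ 2 + δ ^ 2) := by
  obtain ⟨C, hC, hJ⟩ := exists_J_le (p := p) (M := M) hR hr hb hk hp hF lam β ε₀
  refine ⟨2 + 4 / c * (C + 2) + 2 * C + 6, by positivity, ?_⟩
  rintro η hη δ hδ fs gs fd gd hconv ⟨err, herr, herrδ⟩ uε ⟨huD, hu0⟩ huM umin hmin
  have hΩ := isOpen_cube (n + 1) R
  have hle := hp.trans' (by omega : 2 ≤ k + 2)
  -- The correction `err` carries the exact data to the noisy data, and the margin `M - δ` keeps the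
  -- sum in the ball.
  have hvD : uε + err ∈ dataSet R p fd gd := by
    have := dataSet_linear (by omega) huD herr 1 1
    simpa only [one_smul, add_sub_cancel] using this
  have hvM : sobNorm (cube (n + 1) R) p (uε + err) ≤ M := by
    have := huD.1.sobNorm_linear_le hΩ herr.1 1 1
    rw [one_smul, one_smul, abs_one] at this
    linarith
  have hJv := hJ η uε (uε + err) huD.1 hvD.1 (by linarith) hvM hu0
  rw [add_sub_cancel_left] at hJv
  have hsq := mul_le_mul_of_nonneg_left (huD.1.sobNorm_add_sq_le hΩ herr.1) hη.le
  have hvB : uε + err ∈ dataBall R p M fd gd := ⟨hvD, hvM⟩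
  have herr1 : sobNorm (cube (n + 1) R) 1 err ^ 2 ≤ sobNorm (cube (n + 1) R) p err ^ 2 :=
    pow_le_pow_left₀ (sobNorm_nonneg _ _ _) (sobNorm_mono (by omega) err) 2
  have hmono : sobNorm (cube (n + 1) R) 1 (umin - uε) ^ 2
      ≤ sobNorm (cube (n + 1) R) p (umin - uε) ^ 2 :=
    pow_le_pow_left₀ (sobNorm_nonneg _ _ _) (sobNorm_mono (by omega) _) 2
  have hdiff : MemH (cube (n + 1) R) p (uε + err - umin) := by
    have := hvD.1.linear hmin.1.1.1 1 (-1)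
    rwa [one_smul, neg_one_smul, ← sub_eq_add_neg] at this
  have htri := (herr.1.mono (by omega : 1 ≤ p)).sobNorm_sub_sq_le hΩ (hdiff.mono (by omega))
  rw [show err - (uε + err - umin) = umin - uε by abel] at htri
  refine stability_arithmetic (E := sobNorm (cube (n + 1) R) p err ^ 2)
    (N := sobNorm (cube (n + 1) R) p umin ^ 2)
    (D := sobNorm (cube (n + 1) R) 1 (uε + err - umin) ^ 2) hc hC hη (by linarith)
    (hmono.trans (hmin.1.1.1.sobNorm_sub_sq_le hΩ huD.1))
    (pow_le_pow_left₀ (sobNorm_nonneg _ _ _) herrδ 2) (sq_nonneg _) ?_ ?_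
  · exact (hmin.sobNorm_sub_sq_le hle hη.le hconv hvB).trans (hJv.trans (by linarith))
  · exact (le_J umin).trans ((hmin.2 _ hvB).trans (hJv.trans (by linarith)))

end Stability

end HJ

end

theorem theorem4p3 (n : ℕ) (R r b ε₀ M : ℝ) (p : ℕ)
    (hR : 0 < R) (hr : R + 1 < r) (hb : R + r < b) (hε₀ : 0 < ε₀) (hM : 0 < M)
    (hp : ⌈((n + 1 : ℕ) : ℝ) / 2⌉₊ + 2 < p)
    (F : HJ.Pt (n + 1) → ℝ → HJ.Pt (n + 1) → ℝ) (hF : HJ.IsC2On (HJ.cube (n + 1) R) F)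
    (β : ℝ) (hβ : 1 < β) :
    (∃ lam₀ : ℝ, 1 < lam₀ ∧ ∀ lam : ℝ, lam₀ < lam → ∃ c : ℝ, 0 < c ∧
      ∀ η : ℝ, 0 < η → ∀ f g : HJ.Pt (n + 1) → ℝ,
        HJ.ConvexityInequality R r b ε₀ p F M lam β η c f g) ∧
    (∀ lam : ℝ, 1 < lam → ∀ c : ℝ, 0 < c → ∃ C : ℝ, 0 < C ∧
      ∀ η : ℝ, 0 < η → ∀ δ : ℝ, 0 < δ →
      ∀ fs gs fd gd : HJ.Pt (n + 1) → ℝ,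
        HJ.ConvexityInequality R r b ε₀ p F M lam β η c fd gd →
        (∃ err ∈ HJ.dataSet R p (fd - fs) (gd - gs),
          HJ.sobNorm (HJ.cube (n + 1) R) p err ≤ δ) →
        ∀ uε : HJ.Pt (n + 1) → ℝ, HJ.IsSolution R ε₀ p F fs gs uε →
          HJ.sobNorm (HJ.cube (n + 1) R) p uε < M - δ →
        ∀ umin : HJ.Pt (n + 1) → ℝ, HJ.IsMinimizer R r b ε₀ p F M lam β η fd gd umin →
          HJ.sobNorm (HJ.cube (n + 1) R) 1 (umin - uε) ^ 2 ≤
            C * (η * HJ.sobNorm (HJ.cube (n + 1) R) p uε ^ 2 + δ ^ 2)) := by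
  -- The Sobolev inequality is used with `k = ⌈d / 2⌉ + 1`, which exceeds `d / 2`; the strict
  -- hypothesis on `p` is then exactly `k + 2 ≤ p`.
  have hk : n + 1 + 1 ≤ 2 * (⌈((n + 1 : ℕ) : ℝ) / 2⌉₊ + 1) := by
    have h := Nat.le_ceil (((n + 1 : ℕ) : ℝ) / 2)
    have h' : ((n + 1 : ℕ) : ℝ) ≤ ((2 * ⌈((n + 1 : ℕ) : ℝ) / 2⌉₊ : ℕ) : ℝ) := by
      push_cast at h ⊢
      linarith
    have := Nat.cast_le.1 h'
    omega
  have hp' : ⌈((n + 1 : ℕ) : ℝ) / 2⌉₊ + 1 + 2 ≤ p := by omega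
  have hr' : R < r := by linarith
  have hb' : 0 < b := by linarith
  constructor
  · obtain ⟨lam₀, h1, h⟩ := HJ.exists_convexityInequality n hR hr' hb' hε₀ hM hk hp' hF hβ
    exact ⟨lam₀, h1, fun lam hlam => ⟨1, one_pos, fun η _ => h lam hlam η⟩⟩
  · exact fun lam _ c hc => HJ.exists_stability hR hr' hb' hk hp' hF lam β ε₀ hc
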